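/- **Conventions.** Algebras are associative and unital over $\mathbb C$; algebra maps are unital unless stated otherwise. For $x$ in an algebra and idempotents $p,q$, the quasi-inverse of $x$ with respect to $(p,q)$ is the (unique, if it exists) element $x^{-1}$ with $xx^{-1}=p$, $x^{-1}x=q$, $xx^{-1}x=x$, $x^{-1}xx^{-1}=x^{-1}$. *Weak quasi-Hopf algebra.* An algebra $\mathcal G$ with a (not necessarily unital) algebra map $\Delta:\mathcal G\to\mathcal G\otimes\mathcal G$, an algebra map $\epsilon:\mathcal G\to\mathbb C$ and $\phi\in\mathcal G^{\otimes 3}$ such that $(\mathrm{id}\otimes\Delta)(\Delta(a))\,\phi=\phi\,(\Delta\otimes\mathrm{id})(\Delta(a))$; $\phi$ has a quasi-inverse $\phi^{-1}$ with $\phi\phi^{-1}=(\mathrm{id}\otimes\Delta)(\Delta(1))$, $\phi^{-1}\phi=(\Delta\otimes\mathrm{id})(\Delta(1))$; $(\mathrm{id}\otimes\mathrm{id}\otimes\Delta)(\phi)(\Delta\otimes\mathrm{id}\otimes\mathrm{id})(\phi)=(1\otimes\phi)(\mathrm{id}\otimes\Delta\otimes\mathrm{id})(\phi)(\phi\otimes1)$;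 $(\epsilon\otimes\mathrm{id})\Delta=\mathrm{id}=(\mathrm{id}\otimes\epsilon)\Delta$; $(\mathrm{id}\otimes\epsilon\otimes\mathrm{id})(\phi)=\Delta(1)$; together with an invertible unital algebra antimorphism $S$ and $\alpha,\beta\in\mathcal G$ such that $S(a_{(1)})\alpha a_{(2)}=\epsilon(a)\alpha$, $a_{(1)}\beta S(a_{(2)})=\epsilon(a)\beta$, $\sum X\beta S(Y)\alpha Z=1=\sum S(P)\alpha Q\beta S(R)$, where $\phi=\sum X\otimes Y\otimes Z$, $\phi^{-1}=\sum P\otimes Q\otimes R$. *Coactions.* A left coaction on an algebra $\mathcal M$ is a (not necessarily unital) algebra map $\lambda:\mathcal M\to\mathcal G\otimes\mathcal M$ and $\phi_\lambda\in\mathcal G\otimes\mathcal G\otimes\mathcal M$ with $(\mathrm{id}\otimes\lambda)(\lambda(m))\phi_\lambda=\phi_\lambda(\Delta\otimes\mathrm{id})(\lambda(m))$, a quasi-inverse with $\phi_\lambda\phi_\lambda^{-1}=(\mathrm{id}\otimes\lambda)(\lambda(1))$, $\phi_\lambda^{-1}\phi_\lambda=(\Delta\otimes\mathrm{id})(\lambda(1))$,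 $(1\otimes\phi_\lambda)(\mathrm{id}\otimes\Delta\otimes\mathrm{id})(\phi_\lambda)(\phi\otimes1)=(\mathrm{id}\otimes\mathrm{id}\otimes\lambda)(\phi_\lambda)(\Delta\otimes\mathrm{id}\otimes\mathrm{id})(\phi_\lambda)$, $(\epsilon\otimes\mathrm{id})\lambda=\mathrm{id}$, $(\mathrm{id}\otimes\epsilon\otimes\mathrm{id})(\phi_\lambda)=(\epsilon\otimes\mathrm{id}\otimes\mathrm{id})(\phi_\lambda)=\lambda(1)$. A right coaction is a (not necessarily unital) algebra map $\rho:\mathcal M\to\mathcal M\otimes\mathcal G$ and $\phi_\rho\in\mathcal M\otimes\mathcal G\otimes\mathcal G$ with $\phi_\rho(\rho\otimes\mathrm{id})(\rho(m))=(\mathrm{id}\otimes\Delta)(\rho(m))\phi_\rho$, a quasi-inverse with $\phi_\rho\phi_\rho^{-1}=(\mathrm{id}\otimes\Delta)(\rho(1))$, $\phi_\rho^{-1}\phi_\rho=(\rho\otimes\mathrm{id})(\rho(1))$, $(1\otimes\phi)(\mathrm{id}\otimes\Delta\otimes\mathrm{id})(\phi_\rho)(\phi_\rho\otimes1)=(\mathrm{id}\otimes\mathrm{id}\otimes\Delta)(\phi_\rho)(\rho\otimes\mathrm{id}\otimes\mathrm{id})(\phi_\rho)$,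 $(\mathrm{id}\otimes\epsilon)\rho=\mathrm{id}$, $(\mathrm{id}\otimes\epsilon\otimes\mathrm{id})(\phi_\rho)=(\mathrm{id}\otimes\mathrm{id}\otimes\epsilon)(\phi_\rho)=\rho(1)$. They form a quasi-commuting pair with $\phi_{\lambda\rho}\in\mathcal G\otimes\mathcal M\otimes\mathcal G$ if $\phi_{\lambda\rho}(\lambda\otimes\mathrm{id})(\rho(m))=(\mathrm{id}\otimes\rho)(\lambda(m))\phi_{\lambda\rho}$, $\phi_{\lambda\rho}$ has a quasi-inverse with $\phi_{\lambda\rho}\phi_{\lambda\rho}^{-1}=(\mathrm{id}\otimes\rho)(\lambda(1))$, $\phi_{\lambda\rho}^{-1}\phi_{\lambda\rho}=(\lambda\otimes\mathrm{id})(\rho(1))$, and $$(1\otimes\phi_{\lambda\rho})(\mathrm{id}\otimes\lambda\otimes\mathrm{id})(\phi_{\lambda\rho})(\phi_\lambda\otimes1)=(\mathrm{id}\otimes\mathrm{id}\otimes\rho)(\phi_\lambda)(\Delta\otimes\mathrm{id}\otimes\mathrm{id})(\phi_{\lambda\rho}),$$ $$(1\otimes\phi_\rho)(\mathrm{id}\otimes\rho\otimes\mathrm{id})(\phi_{\lambda\rho})(\phi_{\lambda\rho}\otimes1)=(\mathrm{id}\otimes\mathrm{id}\otimes\Delta)(\phi_{\lambda\rho})(\lambda\otimes\mathrm{id}\otimes\mathrm{id})(\phi_\rho).$$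 **Theorem.** Let $\mathcal G$ be a finite dimensional weak quasi-Hopf algebra with dual $\hat{\mathcal G}$, and let $(\lambda,\phi_\lambda,\rho,\phi_\rho,\phi_{\lambda\rho})$ be a quasi-commuting pair of left and right $\mathcal G$-coactions on an algebra $\mathcal M$. Write $\varphi\mapsto\varphi_{(1)}\otimes\varphi_{(2)}$ for the coproduct of $\hat{\mathcal G}$ dual to the product of $\mathcal G$, and $\hat S^{-1}(\varphi)=\varphi\circ S^{-1}$. 1. There are a unital algebra extension $\mathcal M_1\supset\mathcal M$ and a linear map $\Gamma:\hat{\mathcal G}\to\mathcal M_1$ such that $\mathcal M_1$ is generated as an algebra by $\mathcal M$ and $\Gamma(\hat{\mathcal G})$, and for every algebra map $\gamma:\mathcal M\to\mathcal A$ into an algebra $\mathcal A$ the relation $\gamma_T(\Gamma(\varphi))=(\varphi\otimes\mathrm{id})(T)$, $\varphi\in\hat{\mathcal G}$, is a one-to-one correspondence between algebra maps $\gamma_T:\mathcal M_1\to\mathcal A$ extending $\gamma$ and elements $T\in\mathcal G\otimes\mathcal A$ with $(\epsilon\otimes\mathrm{id})(T)=\gamma(1)$ and $$T\lambda_{\mathcal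 A}(m)=\rho^{op}_{\mathcal A}(m)T\ (m\in\mathcal M),\qquad T\lambda_{\mathcal A}(1)=\rho^{op}_{\mathcal A}(1)T=T,$$ $$(\phi_\rho^{312})_{\mathcal A}\,T^{13}\,(\phi_{\lambda\rho}^{132})^{-1}_{\mathcal A}\,T^{23}\,(\phi_\lambda)_{\mathcal A}=(\Delta\otimes\mathrm{id})(T).$$ Here the index $\mathcal A$ means that $\gamma$ is applied to the factor $\mathcal M$, $\rho^{op}$ is $\rho$ followed by the flip, $(x\otimes y\otimes z)^{312}=y\otimes z\otimes x$ and $(x\otimes y\otimes z)^{132}=x\otimes z\otimes y$. The same correspondence holds for algebra maps $\gamma,\gamma_T$ that need not be unital. 2. If $\mathcal M\subset\tilde{\mathcal M}_1$ and $\tilde\Gamma:\hat{\mathcal G}\to\tilde{\mathcal M}_1$ have the same universal property (for unital algebra maps), there is a unique algebra isomorphism $f:\mathcal M_1\to\tilde{\mathcal M}_1$ that is the identity on $\mathcal M$ and satisfies $\tilde\Gamma=f\circ\Gamma$. 3. Put $p_\lambda=\sum y\,S^{-1}(x\beta)\otimes z\in\mathcal G\otimes\mathcal M$ for $\phi_\lambda=\sum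 x\otimes y\otimes z$ and $q_\rho=\sum x\otimes S^{-1}(\alpha z)\,y\in\mathcal M\otimes\mathcal G$ for $\phi_\rho=\sum x\otimes y\otimes z$. The linear maps $$\mu_L:\hat{\mathcal G}\otimes\mathcal M\to\mathcal M_1,\ \varphi\otimes m\mapsto(\mathrm{id}\otimes\varphi_{(1)})(q_\rho)\,\Gamma(\varphi_{(2)})\,m,$$ $$\mu_R:\mathcal M\otimes\hat{\mathcal G}\to\mathcal M_1,\ m\otimes\varphi\mapsto m\,\Gamma(\varphi_{(1)})\,(\varphi_{(2)}\otimes\mathrm{id})(p_\lambda)$$ are surjective. 4. Let $\delta_l=(\lambda\otimes\mathrm{id})\circ\rho$, $\delta_r=(\mathrm{id}\otimes\rho)\circ\lambda$, and $$P_L(\varphi\otimes m)=\varphi_{(2)}\otimes(\varphi_{(3)}\otimes\mathrm{id}\otimes\hat S^{-1}(\varphi_{(1)}))(\delta_l(1))\,m,$$ $$P_R(m\otimes\varphi)=m\,(\hat S^{-1}(\varphi_{(3)})\otimes\mathrm{id}\otimes\varphi_{(1)})(\delta_r(1))\otimes\varphi_{(2)}.$$ Then $P_L$, $P_R$ are projections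 (idempotent linear maps), $\ker\mu_L=\ker P_L$ and $\ker\mu_R=\ker P_R$. Hence $\mu_L$ and $\mu_R$ restrict to linear isomorphisms $P_L(\hat{\mathcal G}\otimes\mathcal M)\cong\mathcal M_1$ and $P_R(\mathcal M\otimes\hat{\mathcal G})\cong\mathcal M_1$. -/

import Mathlib

open scoped TensorProduct

universe u v w

noncomputable section

namespace WeakQuasiHopf

/-! Iterated tensor products are nested to the right: `A ⊗ (B ⊗ C)`. -/

section Linear

variable {V V₁ V₂ W : Type*}
  [AddCommGroup V] [Module ℂ V] [AddCommGroup V₁] [Module ℂ V₁]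
  [AddCommGroup V₂] [Module ℂ V₂] [AddCommGroup W] [Module ℂ W]

/-- `f ⊗ id ⊗ ⋯ ⊗ id` for a map `f : V → V₁ ⊗ V₂`, as a map `V ⊗ W → V₁ ⊗ (V₂ ⊗ W)`. -/
def splitFst (W : Type*) [AddCommGroup W] [Module ℂ W] (f : V →ₗ[ℂ] V₁ ⊗[ℂ] V₂) :
    V ⊗[ℂ] W →ₗ[ℂ] V₁ ⊗[ℂ] (V₂ ⊗[ℂ] W) :=
  (TensorProduct.assoc ℂ V₁ V₂ W).toLinearMap ∘ₗ f.rTensor W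

/-- `f ⊗ id : V ⊗ W → W` for a functional `f` on `V`. -/
def evalFst (W : Type*) [AddCommGroup W] [Module ℂ W] (f : V →ₗ[ℂ] ℂ) : V ⊗[ℂ] W →ₗ[ℂ] W :=
  (TensorProduct.lid ℂ W).toLinearMap ∘ₗ f.rTensor W

/-- `id ⊗ f : V ⊗ W → V` for a functional `f` on `W`. -/
def evalSnd (V : Type*) [AddCommGroup V] [Module ℂ V] (f : W →ₗ[ℂ] ℂ) : V ⊗[ℂ] W →ₗ[ℂ] V :=
  (TensorProduct.rid ℂ V).toLinearMap ∘ₗ f.lTensor V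

/-- `x ↦ x ⊗ 1`. -/
def tensorOne (V A : Type*) [AddCommGroup V] [Module ℂ V] [Ring A] [Algebra ℂ A] :
    V →ₗ[ℂ] V ⊗[ℂ] A :=
  (TensorProduct.mk ℂ V A).flip 1

/-- `f ↦ (f ⊗ id)(x)`, linear in the functional `f`. -/
def sliceFst (x : V ⊗[ℂ] W) : Module.Dual ℂ V →ₗ[ℂ] W where
  toFun f := evalFst W f x
  map_add' f g := by simp [evalFst, LinearMap.rTensor_add]
  map_smul' c f := by simp [evalFst, LinearMap.rTensor_smul]

/-- `f ↦ (id ⊗ f)(x)`, linear in the functional `f`. -/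
def sliceSnd (x : V ⊗[ℂ] W) : Module.Dual ℂ W →ₗ[ℂ] V where
  toFun f := evalSnd V f x
  map_add' f g := by simp [evalSnd, LinearMap.lTensor_add]
  map_smul' c f := by simp [evalSnd, LinearMap.lTensor_smul]

/-- `f ⊗ g ↦ (f ⊗ id ⊗ g)(x)` for `x ∈ V ⊗ (W ⊗ V)`. -/
def sliceOuter (x : V ⊗[ℂ] (W ⊗[ℂ] V)) :
    Module.Dual ℂ V ⊗[ℂ] Module.Dual ℂ V →ₗ[ℂ] W :=
  TensorProduct.lift (LinearMap.mk₂ ℂ (fun f g => evalSnd W g (evalFst (W ⊗[ℂ] V) f x))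
    (fun f₁ f₂ g => by simp [evalFst, LinearMap.rTensor_add])
    (fun c f g => by simp [evalFst, LinearMap.rTensor_smul])
    (fun f g₁ g₂ => by simp [evalSnd, LinearMap.lTensor_add])
    (fun c f g => by simp [evalSnd, LinearMap.lTensor_smul]))

end Linear

/-- `y` is the quasi-inverse of `x` with respect to `(p, q)`: `x y = p` and `y x = q`. -/
structure IsQuasiInverse {A : Type*} [Ring A] (x y p q : A) : Prop where
  mul_eq : x * y = p
  mul_eq' : y * x = q
  mul_mul_eq : x * y * x = x
  mul_mul_eq' : y * x * y = y

variable {G : Type u} [Ring G] [Algebra ℂ G] {M : Type v} [Ring M] [Algebra ℂ M]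

/-- A weak quasi-bialgebra structure on a unital algebra `G`. The coproduct `Δ` is multiplicative
but need not preserve the unit; `φInv` is the (uniquely determined) quasi-inverse of the
reassociator `φ`. -/
structure WeakQuasiBialgebra (G : Type u) [Ring G] [Algebra ℂ G] where
  Δ : G →ₙₐ[ℂ] G ⊗[ℂ] G
  ε : G →ₐ[ℂ] ℂ
  φ : G ⊗[ℂ] (G ⊗[ℂ] G)
  φInv : G ⊗[ℂ] (G ⊗[ℂ] G)
  /-- `(id ⊗ Δ)(Δ a) φ = φ (Δ ⊗ id)(Δ a)` -/
  quasi_coassoc : ∀ a : G,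
    LinearMap.lTensor G (Δ : G →ₗ[ℂ] G ⊗[ℂ] G) (Δ a) * φ
      = φ * splitFst G (Δ : G →ₗ[ℂ] G ⊗[ℂ] G) (Δ a)
  quasiInverse : IsQuasiInverse φ φInv
    (LinearMap.lTensor G (Δ : G →ₗ[ℂ] G ⊗[ℂ] G) (Δ 1))
    (splitFst G (Δ : G →ₗ[ℂ] G ⊗[ℂ] G) (Δ 1))
  /-- `(id ⊗ id ⊗ Δ)(φ) (Δ ⊗ id ⊗ id)(φ) = (1 ⊗ φ) (id ⊗ Δ ⊗ id)(φ) (φ ⊗ 1)` -/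
  pentagon :
    LinearMap.lTensor G (LinearMap.lTensor G (Δ : G →ₗ[ℂ] G ⊗[ℂ] G)) φ
        * splitFst (G ⊗[ℂ] G) (Δ : G →ₗ[ℂ] G ⊗[ℂ] G) φ
      = ((1 : G) ⊗ₜ[ℂ] φ)
        * LinearMap.lTensor G (splitFst G (Δ : G →ₗ[ℂ] G ⊗[ℂ] G)) φ
        * LinearMap.lTensor G (LinearMap.lTensor G (tensorOne G G)) φ
  counit_left : ∀ a : G, evalFst G ε.toLinearMap (Δ a) = a
  counit_right : ∀ a : G, evalSnd G ε.toLinearMap (Δ a) = a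
  /-- `(id ⊗ ε ⊗ id)(φ) = Δ(1)` -/
  counit_φ : LinearMap.lTensor G (evalFst G ε.toLinearMap) φ = Δ 1

/-- A weak quasi-Hopf algebra structure on `G`: a weak quasi-bialgebra with an invertible unital
anti-automorphism `S` (an isomorphism onto the opposite algebra) and elements `α`, `β`. -/
structure WeakQuasiHopfAlgebra (G : Type u) [Ring G] [Algebra ℂ G] extends
    WeakQuasiBialgebra G where
  S : G ≃ₐ[ℂ] Gᵐᵒᵖ
  α : G
  β : G
  /-- `S(a₁) α a₂ = ε(a) α` -/
  antipode_left : ∀ a : G,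
    LinearMap.mul' ℂ G (TensorProduct.map
      (LinearMap.mulRight ℂ α ∘ₗ (MulOpposite.opLinearEquiv ℂ).symm.toLinearMap ∘ₗ S.toLinearMap)
      LinearMap.id (Δ a)) = ε a • α
  /-- `a₁ β S(a₂) = ε(a) β` -/
  antipode_right : ∀ a : G,
    LinearMap.mul' ℂ G (TensorProduct.map (LinearMap.mulRight ℂ β)
      ((MulOpposite.opLinearEquiv ℂ).symm.toLinearMap ∘ₗ S.toLinearMap) (Δ a)) = ε a • β
  /-- `∑ X β S(Y) α Z = 1` for `φ = ∑ X ⊗ Y ⊗ Z` -/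
  antipode_φ :
    LinearMap.mul' ℂ G (TensorProduct.map (LinearMap.mulRight ℂ β)
      (LinearMap.mul' ℂ G ∘ₗ TensorProduct.map
        (LinearMap.mulRight ℂ α ∘ₗ (MulOpposite.opLinearEquiv ℂ).symm.toLinearMap
          ∘ₗ S.toLinearMap)
        LinearMap.id) φ) = 1
  /-- `∑ S(P) α Q β S(R) = 1` for `φ⁻¹ = ∑ P ⊗ Q ⊗ R` -/
  antipode_φInv :
    LinearMap.mul' ℂ G (TensorProduct.map
      (LinearMap.mulRight ℂ α ∘ₗ (MulOpposite.opLinearEquiv ℂ).symm.toLinearMap ∘ₗ S.toLinearMap)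
      (LinearMap.mul' ℂ G ∘ₗ TensorProduct.map (LinearMap.mulRight ℂ β)
        ((MulOpposite.opLinearEquiv ℂ).symm.toLinearMap ∘ₗ S.toLinearMap)) φInv) = 1

/-- The inverse antipode `S⁻¹ : G → G` as a linear map. -/
def WeakQuasiHopfAlgebra.antipodeInv (H : WeakQuasiHopfAlgebra G) : G →ₗ[ℂ] G :=
  H.S.symm.toLinearMap ∘ₗ (MulOpposite.opLinearEquiv ℂ).toLinearMap

/-- A left coaction `(lam, φ)` on `M`, with the quasi-inverse `φInv` of `φ`. -/
structure LeftCoaction (H : WeakQuasiBialgebra G) (M : Type v) [Ring M] [Algebra ℂ M] where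
  lam : M →ₙₐ[ℂ] G ⊗[ℂ] M
  φ : G ⊗[ℂ] (G ⊗[ℂ] M)
  φInv : G ⊗[ℂ] (G ⊗[ℂ] M)
  /-- `(id ⊗ λ)(λ m) φ = φ (Δ ⊗ id)(λ m)` -/
  quasi_coassoc : ∀ m : M,
    LinearMap.lTensor G (lam : M →ₗ[ℂ] G ⊗[ℂ] M) (lam m) * φ
      = φ * splitFst M (H.Δ : G →ₗ[ℂ] G ⊗[ℂ] G) (lam m)
  quasiInverse : IsQuasiInverse φ φInv
    (LinearMap.lTensor G (lam : M →ₗ[ℂ] G ⊗[ℂ] M) (lam 1))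
    (splitFst M (H.Δ : G →ₗ[ℂ] G ⊗[ℂ] G) (lam 1))
  /-- `(1 ⊗ φ_λ) (id ⊗ Δ ⊗ id)(φ_λ) (φ ⊗ 1) = (id ⊗ id ⊗ λ)(φ_λ) (Δ ⊗ id ⊗ id)(φ_λ)` -/
  pentagon :
    ((1 : G) ⊗ₜ[ℂ] φ)
        * LinearMap.lTensor G (splitFst M (H.Δ : G →ₗ[ℂ] G ⊗[ℂ] G)) φ
        * LinearMap.lTensor G (LinearMap.lTensor G (tensorOne G M)) H.φ
      = LinearMap.lTensor G (LinearMap.lTensor G (lam : M →ₗ[ℂ] G ⊗[ℂ] M)) φ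
        * splitFst (G ⊗[ℂ] M) (H.Δ : G →ₗ[ℂ] G ⊗[ℂ] G) φ
  counit : ∀ m : M, evalFst M H.ε.toLinearMap (lam m) = m
  /-- `(id ⊗ ε ⊗ id)(φ) = λ(1)` -/
  counit_φ_mid : LinearMap.lTensor G (evalFst M H.ε.toLinearMap) φ = lam 1
  /-- `(ε ⊗ id ⊗ id)(φ) = λ(1)` -/
  counit_φ_left : evalFst (G ⊗[ℂ] M) H.ε.toLinearMap φ = lam 1

/-- A right coaction `(rho, φ)` on `M`, with the quasi-inverse `φInv` of `φ`. -/
structure RightCoaction (H : WeakQuasiBialgebra G) (M : Type v) [Ring M] [Algebra ℂ M] where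
  rho : M →ₙₐ[ℂ] M ⊗[ℂ] G
  φ : M ⊗[ℂ] (G ⊗[ℂ] G)
  φInv : M ⊗[ℂ] (G ⊗[ℂ] G)
  /-- `φ (ρ ⊗ id)(ρ m) = (id ⊗ Δ)(ρ m) φ` -/
  quasi_coassoc : ∀ m : M,
    φ * splitFst G (rho : M →ₗ[ℂ] M ⊗[ℂ] G) (rho m)
      = LinearMap.lTensor M (H.Δ : G →ₗ[ℂ] G ⊗[ℂ] G) (rho m) * φ
  quasiInverse : IsQuasiInverse φ φInv
    (LinearMap.lTensor M (H.Δ : G →ₗ[ℂ] G ⊗[ℂ] G) (rho 1))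
    (splitFst G (rho : M →ₗ[ℂ] M ⊗[ℂ] G) (rho 1))
  /-- `(1 ⊗ φ) (id ⊗ Δ ⊗ id)(φ_ρ) (φ_ρ ⊗ 1) = (id ⊗ id ⊗ Δ)(φ_ρ) (ρ ⊗ id ⊗ id)(φ_ρ)` -/
  pentagon :
    ((1 : M) ⊗ₜ[ℂ] H.φ)
        * LinearMap.lTensor M (splitFst G (H.Δ : G →ₗ[ℂ] G ⊗[ℂ] G)) φ
        * LinearMap.lTensor M (LinearMap.lTensor G (tensorOne G G)) φ
      = LinearMap.lTensor M (LinearMap.lTensor G (H.Δ : G →ₗ[ℂ] G ⊗[ℂ] G)) φ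
        * splitFst (G ⊗[ℂ] G) (rho : M →ₗ[ℂ] M ⊗[ℂ] G) φ
  counit : ∀ m : M, evalSnd M H.ε.toLinearMap (rho m) = m
  /-- `(id ⊗ ε ⊗ id)(φ) = ρ(1)` -/
  counit_φ_mid : LinearMap.lTensor M (evalFst G H.ε.toLinearMap) φ = rho 1
  /-- `(id ⊗ id ⊗ ε)(φ) = ρ(1)` -/
  counit_φ_right : LinearMap.lTensor M (evalSnd G H.ε.toLinearMap) φ = rho 1

/-- A quasi-commuting pair of a left and a right coaction on `M`; `φInv` is the quasi-inverse of
`φ = φ_{λρ}`. -/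
structure QuasiCommutingPair (H : WeakQuasiBialgebra G) (M : Type v) [Ring M] [Algebra ℂ M] where
  left : LeftCoaction H M
  right : RightCoaction H M
  φ : G ⊗[ℂ] (M ⊗[ℂ] G)
  φInv : G ⊗[ℂ] (M ⊗[ℂ] G)
  /-- `φ_{λρ} (λ ⊗ id)(ρ m) = (id ⊗ ρ)(λ m) φ_{λρ}` -/
  quasi_comm : ∀ m : M,
    φ * splitFst G (left.lam : M →ₗ[ℂ] G ⊗[ℂ] M) (right.rho m)
      = LinearMap.lTensor G (right.rho : M →ₗ[ℂ] M ⊗[ℂ] G) (left.lam m) * φ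
  quasiInverse : IsQuasiInverse φ φInv
    (LinearMap.lTensor G (right.rho : M →ₗ[ℂ] M ⊗[ℂ] G) (left.lam 1))
    (splitFst G (left.lam : M →ₗ[ℂ] G ⊗[ℂ] M) (right.rho 1))
  /-- `(1 ⊗ φ_{λρ}) (id ⊗ λ ⊗ id)(φ_{λρ}) (φ_λ ⊗ 1)
  = (id ⊗ id ⊗ ρ)(φ_λ) (Δ ⊗ id ⊗ id)(φ_{λρ})` -/
  pentagon_left :
    ((1 : G) ⊗ₜ[ℂ] φ)
        * LinearMap.lTensor G (splitFst G (left.lam : M →ₗ[ℂ] G ⊗[ℂ] M)) φ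
        * LinearMap.lTensor G (LinearMap.lTensor G (tensorOne M G)) left.φ
      = LinearMap.lTensor G (LinearMap.lTensor G (right.rho : M →ₗ[ℂ] M ⊗[ℂ] G)) left.φ
        * splitFst (M ⊗[ℂ] G) (H.Δ : G →ₗ[ℂ] G ⊗[ℂ] G) φ
  /-- `(1 ⊗ φ_ρ) (id ⊗ ρ ⊗ id)(φ_{λρ}) (φ_{λρ} ⊗ 1)
  = (id ⊗ id ⊗ Δ)(φ_{λρ}) (λ ⊗ id ⊗ id)(φ_ρ)` -/
  pentagon_right :
    ((1 : G) ⊗ₜ[ℂ] right.φ)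
        * LinearMap.lTensor G (splitFst G (right.rho : M →ₗ[ℂ] M ⊗[ℂ] G)) φ
        * LinearMap.lTensor G (LinearMap.lTensor M (tensorOne G G)) φ
      = LinearMap.lTensor G (LinearMap.lTensor M (H.Δ : G →ₗ[ℂ] G ⊗[ℂ] G)) φ
        * splitFst (G ⊗[ℂ] G) (left.lam : M →ₗ[ℂ] G ⊗[ℂ] M) right.φ

/-- `δ_l(1) = (λ ⊗ id)(ρ(1))`. -/
def QuasiCommutingPair.deltaLOne {H : WeakQuasiBialgebra G} (Q : QuasiCommutingPair H M) :
    G ⊗[ℂ] (M ⊗[ℂ] G) :=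
  splitFst G (Q.left.lam : M →ₗ[ℂ] G ⊗[ℂ] M) (Q.right.rho 1)

/-- `δ_r(1) = (id ⊗ ρ)(λ(1))`. -/
def QuasiCommutingPair.deltaROne {H : WeakQuasiBialgebra G} (Q : QuasiCommutingPair H M) :
    G ⊗[ℂ] (M ⊗[ℂ] G) :=
  LinearMap.lTensor G (Q.right.rho : M →ₗ[ℂ] M ⊗[ℂ] G) (Q.left.lam 1)

section Intertwiner

variable {A : Type w} [Ring A] [Algebra ℂ A]

/-- `T ∈ G ⊗ A` is a normal coherent `λρ`-intertwiner with respect to `γ : M → A`. -/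
structure IsIntertwiner {H : WeakQuasiBialgebra G} (Q : QuasiCommutingPair H M)
    (γ : M →ₙₐ[ℂ] A) (T : G ⊗[ℂ] A) : Prop where
  /-- `(ε ⊗ id)(T) = γ(1)` -/
  normal : evalFst A H.ε.toLinearMap T = γ 1
  /-- `T λ_A(m) = ρ_A^op(m) T` -/
  intertwines : ∀ m : M,
    T * LinearMap.lTensor G (γ : M →ₗ[ℂ] A) (Q.left.lam m)
      = TensorProduct.comm ℂ A G (LinearMap.rTensor G (γ : M →ₗ[ℂ] A) (Q.right.rho m)) * T
  /-- `T λ_A(1) = T` -/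
  mul_left_one : T * LinearMap.lTensor G (γ : M →ₗ[ℂ] A) (Q.left.lam 1) = T
  /-- `ρ_A^op(1) T = T` -/
  right_one_mul :
    TensorProduct.comm ℂ A G (LinearMap.rTensor G (γ : M →ₗ[ℂ] A) (Q.right.rho 1)) * T = T
  /-- `(φ_ρ^{312})_A T^{13} (φ_{λρ}^{132})⁻¹_A T^{23} (φ_λ)_A = (Δ ⊗ id)(T)`, where
  `(x ⊗ y ⊗ z)^{312} = y ⊗ z ⊗ x` and `(x ⊗ y ⊗ z)^{132} = x ⊗ z ⊗ y`. -/
  coherent :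
    LinearMap.lTensor G (LinearMap.lTensor G (γ : M →ₗ[ℂ] A))
          (TensorProduct.assoc ℂ G G M (TensorProduct.comm ℂ M (G ⊗[ℂ] G) Q.right.φ))
        * LinearMap.lTensor G (TensorProduct.mk ℂ G A 1) T
        * LinearMap.lTensor G (LinearMap.lTensor G (γ : M →ₗ[ℂ] A))
          (LinearMap.lTensor G (TensorProduct.comm ℂ M G).toLinearMap Q.φInv)
        * ((1 : G) ⊗ₜ[ℂ] T)
        * LinearMap.lTensor G (LinearMap.lTensor G (γ : M →ₗ[ℂ] A)) Q.left.φ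
      = splitFst A (H.Δ : G →ₗ[ℂ] G ⊗[ℂ] G) T

end Intertwiner

/-- `(ι : M → M₁, Γ : Ĝ → M₁)` is a universal extension: `M₁` is an extension of `M` generated by
`M` and `Γ(Ĝ)`, and for every algebra map `γ : M → A` the relation `g (Γ ψ) = (ψ ⊗ id)(T)` is a
one-to-one correspondence between algebra maps `g : M₁ → A` extending `γ` and normal coherent
`λρ`-intertwiners `T ∈ G ⊗ A`. -/
structure IsUniversalExtension {H : WeakQuasiBialgebra G} (Q : QuasiCommutingPair H M)
    {M₁ : Type*} [Ring M₁] [Algebra ℂ M₁]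
    (ι : M →ₐ[ℂ] M₁) (Γ : Module.Dual ℂ G →ₗ[ℂ] M₁) : Prop where
  injective : Function.Injective ι
  generated : Algebra.adjoin ℂ (Set.range ι ∪ Set.range Γ) = ⊤
  exists_extension : ∀ (A : Type w) [Ring A] [Algebra ℂ A] (γ : M →ₐ[ℂ] A) (T : G ⊗[ℂ] A),
    IsIntertwiner Q (γ : M →ₙₐ[ℂ] A) T →
      ∃! g : M₁ →ₐ[ℂ] A, (∀ m, g (ι m) = γ m) ∧ ∀ ψ, g (Γ ψ) = evalFst A ψ T
  exists_intertwiner : ∀ (A : Type w) [Ring A] [Algebra ℂ A] (γ : M →ₐ[ℂ] A) (g : M₁ →ₐ[ℂ] A),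
    (∀ m, g (ι m) = γ m) →
      ∃! T : G ⊗[ℂ] A, IsIntertwiner Q (γ : M →ₙₐ[ℂ] A) T ∧ ∀ ψ, g (Γ ψ) = evalFst A ψ T

/-- The same one-to-one correspondence for algebra maps `γ` and `g` that need not be unital. -/
def HasNonUnitalCorrespondence {H : WeakQuasiBialgebra G} (Q : QuasiCommutingPair H M)
    {M₁ : Type*} [Ring M₁] [Algebra ℂ M₁]
    (ι : M →ₐ[ℂ] M₁) (Γ : Module.Dual ℂ G →ₗ[ℂ] M₁) : Prop :=
  ∀ (A : Type w) [Ring A] [Algebra ℂ A] (γ : M →ₙₐ[ℂ] A),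
    (∀ T : G ⊗[ℂ] A, IsIntertwiner Q γ T →
      ∃! g : M₁ →ₙₐ[ℂ] A, (∀ m, g (ι m) = γ m) ∧ ∀ ψ, g (Γ ψ) = evalFst A ψ T) ∧
    (∀ g : M₁ →ₙₐ[ℂ] A, (∀ m, g (ι m) = γ m) →
      ∃! T : G ⊗[ℂ] A, IsIntertwiner Q γ T ∧ ∀ ψ, g (Γ ψ) = evalFst A ψ T)

/-- The coproduct `ψ ↦ ψ₁ ⊗ ψ₂` of `Ĝ`, dual to the multiplication of `G`:
`ψ₁(a) ψ₂(b) = ψ(a b)`. -/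
def dualComul (G : Type u) [Ring G] [Algebra ℂ G] [FiniteDimensional ℂ G] :
    Module.Dual ℂ G →ₗ[ℂ] Module.Dual ℂ G ⊗[ℂ] Module.Dual ℂ G :=
  (TensorProduct.dualDistribEquiv ℂ G G).symm.toLinearMap ∘ₗ (LinearMap.mul' ℂ G).dualMap

/-- `ψ ↦ ψ₁ ⊗ (ψ₂ ⊗ ψ₃)`. -/
def dualComul₂ (G : Type u) [Ring G] [Algebra ℂ G] [FiniteDimensional ℂ G] :
    Module.Dual ℂ G →ₗ[ℂ]
      Module.Dual ℂ G ⊗[ℂ] (Module.Dual ℂ G ⊗[ℂ] Module.Dual ℂ G) :=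
  LinearMap.lTensor (Module.Dual ℂ G) (dualComul G) ∘ₗ dualComul G

section Maps

variable (H : WeakQuasiHopfAlgebra G) (Q : QuasiCommutingPair H.toWeakQuasiBialgebra M)

/-- `p_λ = ∑ y S⁻¹(x β) ⊗ z` for `φ_λ = ∑ x ⊗ y ⊗ z`. -/
def pLam : G ⊗[ℂ] M :=
  LinearMap.rTensor M
    (LinearMap.mul' ℂ G ∘ₗ (TensorProduct.comm ℂ G G).toLinearMap ∘ₗ
      LinearMap.rTensor G (H.antipodeInv ∘ₗ LinearMap.mulRight ℂ H.β))
    ((TensorProduct.assoc ℂ G G M).symm Q.left.φ)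

/-- `q_ρ = ∑ x ⊗ S⁻¹(α z) y` for `φ_ρ = ∑ x ⊗ y ⊗ z`. -/
def qRho : M ⊗[ℂ] G :=
  LinearMap.lTensor M
    (LinearMap.mul' ℂ G ∘ₗ (TensorProduct.comm ℂ G G).toLinearMap ∘ₗ
      LinearMap.lTensor G (H.antipodeInv ∘ₗ LinearMap.mulLeft ℂ H.α))
    Q.right.φ

variable {M₁ : Type w} [Ring M₁] [Algebra ℂ M₁] [FiniteDimensional ℂ G]

/-- `μ_L(ψ ⊗ m) = (id ⊗ ψ₁)(q) Γ(ψ₂) m`. -/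
def muL (ι : M →ₐ[ℂ] M₁) (Γ : Module.Dual ℂ G →ₗ[ℂ] M₁) (q : M ⊗[ℂ] G) :
    Module.Dual ℂ G ⊗[ℂ] M →ₗ[ℂ] M₁ :=
  LinearMap.mul' ℂ M₁ ∘ₗ TensorProduct.map
    (LinearMap.mul' ℂ M₁ ∘ₗ TensorProduct.map (ι.toLinearMap ∘ₗ sliceSnd q) Γ ∘ₗ dualComul G)
    ι.toLinearMap

/-- `μ_R(m ⊗ ψ) = m Γ(ψ₁) (ψ₂ ⊗ id)(p)`. -/
def muR (ι : M →ₐ[ℂ] M₁) (Γ : Module.Dual ℂ G →ₗ[ℂ] M₁) (p : G ⊗[ℂ] M) :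
    M ⊗[ℂ] Module.Dual ℂ G →ₗ[ℂ] M₁ :=
  LinearMap.mul' ℂ M₁ ∘ₗ TensorProduct.map ι.toLinearMap
    (LinearMap.mul' ℂ M₁ ∘ₗ TensorProduct.map Γ (ι.toLinearMap ∘ₗ sliceFst p) ∘ₗ dualComul G)

/-- `Ŝ⁻¹(ψ) = ψ ∘ S⁻¹` on `Ĝ`. -/
def dualAntipodeInv : Module.Dual ℂ G →ₗ[ℂ] Module.Dual ℂ G :=
  H.antipodeInv.dualMap

/-- `P_L(ψ ⊗ m) = ψ₂ ⊗ (ψ₃ ⊗ id ⊗ Ŝ⁻¹(ψ₁))(δ_l(1)) m`. -/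
def projL : Module.Dual ℂ G ⊗[ℂ] M →ₗ[ℂ] Module.Dual ℂ G ⊗[ℂ] M :=
  LinearMap.lTensor (Module.Dual ℂ G) (LinearMap.mul' ℂ M) ∘ₗ
    (TensorProduct.assoc ℂ (Module.Dual ℂ G) M M).toLinearMap ∘ₗ
    LinearMap.rTensor M
      (LinearMap.lTensor (Module.Dual ℂ G)
          (sliceOuter Q.deltaLOne ∘ₗ
            (TensorProduct.comm ℂ (Module.Dual ℂ G) (Module.Dual ℂ G)).toLinearMap ∘ₗ
            LinearMap.rTensor (Module.Dual ℂ G) (dualAntipodeInv H)) ∘ₗ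
        (TensorProduct.leftComm ℂ (Module.Dual ℂ G) (Module.Dual ℂ G)
          (Module.Dual ℂ G)).toLinearMap ∘ₗ
        dualComul₂ G)

/-- `P_R(m ⊗ ψ) = m (Ŝ⁻¹(ψ₃) ⊗ id ⊗ ψ₁)(δ_r(1)) ⊗ ψ₂`. -/
def projR : M ⊗[ℂ] Module.Dual ℂ G →ₗ[ℂ] M ⊗[ℂ] Module.Dual ℂ G :=
  LinearMap.rTensor (Module.Dual ℂ G) (LinearMap.mul' ℂ M) ∘ₗ
    (TensorProduct.assoc ℂ M M (Module.Dual ℂ G)).symm.toLinearMap ∘ₗ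
    LinearMap.lTensor M
      ((TensorProduct.comm ℂ (Module.Dual ℂ G) M).toLinearMap ∘ₗ
        LinearMap.lTensor (Module.Dual ℂ G)
          (sliceOuter Q.deltaROne ∘ₗ
            (TensorProduct.comm ℂ (Module.Dual ℂ G) (Module.Dual ℂ G)).toLinearMap ∘ₗ
            LinearMap.lTensor (Module.Dual ℂ G) (dualAntipodeInv H)) ∘ₗ
        (TensorProduct.leftComm ℂ (Module.Dual ℂ G) (Module.Dual ℂ G)
          (Module.Dual ℂ G)).toLinearMap ∘ₗ
        dualComul₂ G)

end Maps

end WeakQuasiHopf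

end

/-! The extension is made by generators and relations: the tensor algebra on `M × Ĝ`, modulo exactly
the relations saying that the element `T` of `G ⊗ M₁` whose slices are the `Γ(ψ)` is a normal
coherent intertwiner (`ExtRel`, `UnivExt`). Generation, the universal property and uniqueness are
then formal, and a non-unital `γ` is handled by corestricting to the corner `γ(1) A γ(1)`. The
substance is the size of `M₁`: `M` has to embed, `μ_L` has to be onto, and its kernel must be no
larger than that of `P_L`.

The main tool is a change of variable. To an intertwiner `T` attach `L = q_ρ T`. Then `m L = L ◁
ρ(m)`, where `L ◁ (c ⊗ a) = S⁻¹(a) L λ(c)`, and `T = L ◁ p_ρ`, where `p_ρ = ∑ x ⊗ y β S(z)` is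
formed from `φ_ρ⁻¹`. The two passages undo each other because the pentagon for `φ_ρ`, contracted
with the antipode, collapses to the antipode axioms for `φ` and `φ⁻¹` (`pMap_qElt`, `qMap_pElt`). In
these terms `μ_L(ψ ⊗ m)` is the `ψ`-slice of `L` times `m`, and `L = 1 L = L ◁ ρ(1)` says that `μ_L
∘ P_L = μ_L`. Surjectivity follows since the range of `μ_L` contains `1` and is stable under left
multiplication by `M` (the relation for `L`) and by `Γ(Ĝ)` (coherence, `slice_mul_leftElt_eq`).

For the kernel one constructs a representation on `M × (Ĝ ⊗ M)` in which `L` is free: its `ψ`-slice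
sends `m` in the first summand to `ψ ⊗ m` in the second. Every `Y` with `Y (1 ⊗ γ(1)) = Y` can then
be written `(1 ⊗ x) L` (`Hat`), so the relations can be read as definitions. The action of `M` is
defined by `hatLeft(m) L = L ◁ ρ(m)`, and `T` is defined by the value of `T¹³ L²³` that coherence
between `T` and `t = L ◁ p_ρ` forces (`hatProd`). What remains to be checked on `T` is checked after
right multiplication by `L`, or after composition with `t`, which carries the same information
(`recover_of_composite`); coherence of `T` turns into associativity of fusion (`coherence_chain`).

The resulting map `g : M₁ → End` satisfies `g(μ_L y) e = L(P_L y)`, where `e = (ε ⊗ id)(t)` and `L(ψ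
⊗ m)` is the `ψ`-slice of `L` times `m` (`map_muL_mul_baseVec`). Evaluated at `(1, 0)`, `L(y)`
returns `y`, so `ker μ_L ⊆ ker P_L`. As `e` is a nonzero multiple of `m ↦ ε ⊗ m`, `M` embeds too.

The right-handed statements are the left-handed ones for opposite algebras with reversed legs, where
`λ` and `ρ`, and also `α` and `β`, trade places. -/

open scoped TensorProduct

set_option maxSynthPendingDepth 3
set_option linter.unusedSectionVars false

noncomputable section

namespace WeakQuasiHopf


/-! ### Evaluating tensors in an algebra through commuting multiplicative maps -/

section

section MulPair

variable {A B C D V W R R' : Type*}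
  [AddCommGroup A] [Module ℂ A] [AddCommGroup B] [Module ℂ B] [AddCommGroup C] [Module ℂ C]
  [AddCommGroup D] [Module ℂ D]
  [AddCommGroup V] [Module ℂ V] [AddCommGroup W] [Module ℂ W] [Ring R] [Algebra ℂ R]
  [Ring R'] [Algebra ℂ R']

/-- The linear map `a ⊗ c ↦ f a * g c`. -/
def mulPair (f : A →ₗ[ℂ] R) (g : C →ₗ[ℂ] R) : A ⊗[ℂ] C →ₗ[ℂ] R :=
  LinearMap.mul' ℂ R ∘ₗ TensorProduct.map f g

infixr:72 " ◇ " => mulPair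

@[simp] theorem mulPair_tmul (f : A →ₗ[ℂ] R) (g : C →ₗ[ℂ] R) (a : A) (c : C) :
    (f ◇ g) (a ⊗ₜ c) = f a * g c := rfl

/-- `f ◇ g` after a map `u` with values in a tensor product. -/
def leg (u : V →ₗ[ℂ] A ⊗[ℂ] C) (f : A →ₗ[ℂ] R) (g : C →ₗ[ℂ] R) : V →ₗ[ℂ] R :=
  (f ◇ g) ∘ₗ u

theorem leg_apply (u : V →ₗ[ℂ] A ⊗[ℂ] C) (f : A →ₗ[ℂ] R) (g : C →ₗ[ℂ] R) (x : V) :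
    leg u f g x = (f ◇ g) (u x) := rfl

theorem mulPair_lTensor (u : V →ₗ[ℂ] C) (f : A →ₗ[ℂ] R) (g : C →ₗ[ℂ] R) (x : A ⊗[ℂ] V) :
    (f ◇ g) (u.lTensor A x) = (f ◇ (g ∘ₗ u)) x := by
  induction x with
  | zero => simp
  | tmul a c => simp
  | add x y hx hy => simp only [map_add, hx, hy]

theorem mulPair_rTensor (u : V →ₗ[ℂ] A) (f : A →ₗ[ℂ] R) (g : C →ₗ[ℂ] R) (x : V ⊗[ℂ] C) :
    (f ◇ g) (u.rTensor C x) = ((f ∘ₗ u) ◇ g) x := by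
  induction x with
  | zero => simp
  | tmul a c => simp
  | add x y hx hy => simp only [map_add, hx, hy]

theorem mulPair_assoc (f : A →ₗ[ℂ] R) (g : B →ₗ[ℂ] R) (h : C →ₗ[ℂ] R) (x : (A ⊗[ℂ] B) ⊗[ℂ] C) :
    (f ◇ g ◇ h) (TensorProduct.assoc ℂ A B C x) = ((f ◇ g) ◇ h) x := by
  induction x with
  | zero => simp
  | add x y hx hy => simp only [map_add, hx, hy]
  | tmul a c =>
    induction a with
    | zero => simp
    | tmul a b => simp [mul_assoc]
    | add x y hx hy => simp only [TensorProduct.add_tmul, map_add, hx, hy]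

theorem mulPair_splitFst (u : V →ₗ[ℂ] A ⊗[ℂ] B) (f : A →ₗ[ℂ] R) (g : B →ₗ[ℂ] R)
    (h : W →ₗ[ℂ] R) (x : V ⊗[ℂ] W) :
    (f ◇ g ◇ h) (splitFst W u x) = (leg u f g ◇ h) x := by
  simp only [splitFst, LinearMap.comp_apply, LinearEquiv.coe_coe, mulPair_assoc, mulPair_rTensor]
  rfl

theorem mulPair_comp (π : R →ₗ[ℂ] R') (hπ : ∀ x y, π (x * y) = π x * π y) (f : A →ₗ[ℂ] R)
    (g : C →ₗ[ℂ] R) (x : A ⊗[ℂ] C) : π ((f ◇ g) x) = ((π ∘ₗ f) ◇ (π ∘ₗ g)) x := by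
  induction x with
  | zero => simp
  | tmul a c => simp [hπ]
  | add x y hx hy => simp only [map_add, hx, hy]

/-- The images of `f` and `g` commute. -/
class Comm (f : A →ₗ[ℂ] R) (g : C →ₗ[ℂ] R) : Prop where
  commute : ∀ a c, Commute (f a) (g c)

theorem commute_mulPair {x : R} {f : A →ₗ[ℂ] R} {g : C →ₗ[ℂ] R} (hf : ∀ a, Commute x (f a))
    (hg : ∀ c, Commute x (g c)) (y : A ⊗[ℂ] C) : Commute x ((f ◇ g) y) := by
  induction y with
  | zero => simp
  | tmul a c => exact (hf a).mul_right (hg c)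
  | add y z hy hz => rw [map_add]; exact hy.add_right hz

theorem Comm.symm {f : A →ₗ[ℂ] R} {g : C →ₗ[ℂ] R} (h : Comm f g) : Comm g f :=
  ⟨fun a c => (h.commute c a).symm⟩

instance {f : A →ₗ[ℂ] R} {g : B →ₗ[ℂ] R} {h : C →ₗ[ℂ] R} [Comm f h] [Comm g h] :
    Comm (f ◇ g) h :=
  ⟨fun a c => (commute_mulPair (fun x => (Comm.commute x c).symm)
    (fun x => (Comm.commute x c).symm) a).symm⟩

instance {f : A →ₗ[ℂ] R} {g : B →ₗ[ℂ] R} {h : C →ₗ[ℂ] R} [Comm h f] [Comm h g] :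
    Comm h (f ◇ g) :=
  ⟨fun a c => commute_mulPair (fun x => Comm.commute a x) (fun x => Comm.commute a x) c⟩

instance {u : V →ₗ[ℂ] A} {f : A →ₗ[ℂ] R} {g : C →ₗ[ℂ] R} [Comm f g] : Comm (f ∘ₗ u) g :=
  ⟨fun a c => Comm.commute (u a) c⟩

instance {u : V →ₗ[ℂ] C} {f : A →ₗ[ℂ] R} {g : C →ₗ[ℂ] R} [Comm f g] : Comm f (g ∘ₗ u) :=
  ⟨fun a c => Comm.commute a (u c)⟩

instance {u : V →ₗ[ℂ] A ⊗[ℂ] B} {f : A →ₗ[ℂ] R} {g : B →ₗ[ℂ] R} {h : C →ₗ[ℂ] R} [Comm f h]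
    [Comm g h] : Comm (leg u f g) h :=
  inferInstanceAs (Comm ((f ◇ g) ∘ₗ u) h)

instance {u : V →ₗ[ℂ] A ⊗[ℂ] B} {f : A →ₗ[ℂ] R} {g : B →ₗ[ℂ] R} {h : C →ₗ[ℂ] R} [Comm h f]
    [Comm h g] : Comm h (leg u f g) :=
  inferInstanceAs (Comm h ((f ◇ g) ∘ₗ u))

theorem mulPair_comm (f : A →ₗ[ℂ] R) (g : C →ₗ[ℂ] R) [Comm f g] (x : A ⊗[ℂ] C) :
    (g ◇ f) (TensorProduct.comm ℂ A C x) = (f ◇ g) x := by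
  induction x with
  | zero => simp
  | tmul a c => simpa using (Comm.commute a c).symm.eq
  | add x y hx hy => simp only [map_add, hx, hy]

end MulPair

section Multiplicative

variable {A B C D R : Type*} [Ring A] [Algebra ℂ A] [Ring B] [Algebra ℂ B] [Ring C] [Algebra ℂ C]
  [Ring D] [Algebra ℂ D] [Ring R] [Algebra ℂ R]

/-- A multiplicative linear map. -/
class IsMul (f : A →ₗ[ℂ] R) : Prop where
  map_mul : ∀ x y, f (x * y) = f x * f y

/-- A linear map that preserves the unit. -/
class Unital (f : A →ₗ[ℂ] R) : Prop where
  map_one : f 1 = 1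

instance (f : A →ₙₐ[ℂ] R) : IsMul (f : A →ₗ[ℂ] R) := ⟨fun x y => map_mul f x y⟩
instance (f : A →ₐ[ℂ] R) : IsMul f.toLinearMap := ⟨fun x y => map_mul f x y⟩
instance (f : A →ₐ[ℂ] R) : Unital f.toLinearMap := ⟨map_one f⟩

instance {f : B →ₗ[ℂ] R} {u : A →ₗ[ℂ] B} [IsMul f] [IsMul u] : IsMul (f ∘ₗ u) :=
  ⟨fun x y => by simp [IsMul.map_mul]⟩

instance {f : B →ₗ[ℂ] R} {u : A →ₗ[ℂ] B} [Unital f] [Unital u] : Unital (f ∘ₗ u) :=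
  ⟨by simp [Unital.map_one]⟩

/-- With this, an identity between products of tensors becomes an identity between products in `R`.
Commutation and multiplicativity are classes so that they are found automatically for nested legs
such as `leg Δ i j ◇ k`. -/
instance {f : A →ₗ[ℂ] R} {g : C →ₗ[ℂ] R} [IsMul f] [IsMul g] [Comm f g] : IsMul (f ◇ g) where
  map_mul x y := by
    induction x with
    | zero => simp
    | add x z hx hz => simp only [add_mul, map_add, hx, hz]
    | tmul a c =>
      induction y with
      | zero => simp
      | add x z hx hz => simp only [mul_add, map_add, hx, hz]
      | tmul a' c' =>
        simp only [Algebra.TensorProduct.tmul_mul_tmul, mulPair_tmul, IsMul.map_mul]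
        rw [mul_assoc, mul_assoc, ← mul_assoc (g c), ← (Comm.commute a' c).eq, mul_assoc]

instance {u : A →ₗ[ℂ] B ⊗[ℂ] C} {f : B →ₗ[ℂ] R} {g : C →ₗ[ℂ] R} [IsMul u] [IsMul f] [IsMul g]
    [Comm f g] : IsMul (leg u f g) :=
  inferInstanceAs (IsMul ((f ◇ g) ∘ₗ u))

/-- `x ↦ 1 ⊗ x`. -/
def oneTensor (A V : Type*) [Ring A] [Algebra ℂ A] [AddCommGroup V] [Module ℂ V] :
    V →ₗ[ℂ] A ⊗[ℂ] V := TensorProduct.mk ℂ A V 1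

@[simp] theorem oneTensor_apply (x : C) : oneTensor A C x = 1 ⊗ₜ x := rfl
@[simp] theorem tensorOne_apply (x : C) : tensorOne C A x = x ⊗ₜ 1 := rfl

instance : IsMul (oneTensor A C) := ⟨fun x y => by simp⟩
instance : IsMul (tensorOne A C) := ⟨fun x y => by simp⟩
instance : Unital (oneTensor A C) := ⟨by simp [Algebra.TensorProduct.one_def]⟩
instance : Unital (tensorOne A C) := ⟨by simp [Algebra.TensorProduct.one_def]⟩
instance : Comm (oneTensor A C) (tensorOne A C) := ⟨fun a c => by simp [Commute, SemiconjBy]⟩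
instance : Comm (tensorOne A C) (oneTensor A C) := ⟨fun a c => by simp [Commute, SemiconjBy]⟩
instance : IsMul (LinearMap.id : A →ₗ[ℂ] A) := ⟨fun _ _ => rfl⟩
instance : Unital (LinearMap.id : A →ₗ[ℂ] A) := ⟨rfl⟩

/-- Post-composition with a multiplicative map preserves commutation. -/
instance {V W : Type*} [AddCommGroup V] [Module ℂ V] [AddCommGroup W] [Module ℂ W]
    {π : B →ₗ[ℂ] R} [IsMul π] {f : V →ₗ[ℂ] B} {g : W →ₗ[ℂ] B} [Comm f g] :
    Comm (π ∘ₗ f) (π ∘ₗ g) :=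
  ⟨fun a c => by
    simp only [LinearMap.comp_apply, Commute, SemiconjBy, ← IsMul.map_mul,
      (Comm.commute (f := f) (g := g) a c).eq]⟩

theorem mulPair_one_tmul {V : Type*} [AddCommGroup V] [Module ℂ V] (f : A →ₗ[ℂ] R) (g : V →ₗ[ℂ] R)
    (x : V) : (f ◇ g) (1 ⊗ₜ x) = f 1 * g x := rfl

/-- Coproducts and coactions are not unital, so `f 1` is in general just an idempotent; it still
acts as a unit on whatever has `f` as its first leg. Absorptions of this kind replace cancellation
of units throughout. -/
theorem map_one_mul_mulPair {V : Type*} [AddCommGroup V] [Module ℂ V] (f : A →ₗ[ℂ] R) [IsMul f]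
    (g : V →ₗ[ℂ] R) (x : A ⊗[ℂ] V) : f 1 * (f ◇ g) x = (f ◇ g) x := by
  induction x with
  | zero => simp
  | tmul a c => simp [← mul_assoc, ← IsMul.map_mul]
  | add x y hx hy => simp only [map_add, mul_add, hx, hy]

theorem leg_tensorOne {V : Type*} [AddCommGroup V] [Module ℂ V] (g : V →ₗ[ℂ] R) (h : C →ₗ[ℂ] R)
    [Unital h] : leg (tensorOne V C) g h = g := by
  ext b; simp [leg, Unital.map_one, tensorOne]

end Multiplicative

end


/-! ### Quasi-invertible intertwiners and the axioms in evaluated form -/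

section

instance Comm.symm' {A C R : Type*} [AddCommGroup A] [Module ℂ A] [AddCommGroup C] [Module ℂ C]
    [Ring R] [Algebra ℂ R] {f : A →ₗ[ℂ] R} {g : C →ₗ[ℂ] R} [h : Comm f g] : Comm g f := h.symm

section Comps
variable {A B C V W R : Type*}
  [AddCommGroup A] [Module ℂ A] [AddCommGroup B] [Module ℂ B] [AddCommGroup C] [Module ℂ C]
  [AddCommGroup V] [Module ℂ V] [AddCommGroup W] [Module ℂ W] [Ring R] [Algebra ℂ R]

theorem leg_lTensor (u : V →ₗ[ℂ] C) (f : A →ₗ[ℂ] R) (g : C →ₗ[ℂ] R) :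
    leg (u.lTensor A) f g = f ◇ (g ∘ₗ u) :=
  LinearMap.ext (mulPair_lTensor u f g)

theorem leg_splitFst (u : V →ₗ[ℂ] A ⊗[ℂ] B) (f : A →ₗ[ℂ] R) (g : B →ₗ[ℂ] R)
    (h : W →ₗ[ℂ] R) : leg (splitFst W u) f (g ◇ h) = leg u f g ◇ h :=
  LinearMap.ext (mulPair_splitFst u f g h)

theorem mulPair_comp_eq_leg (u : V →ₗ[ℂ] A ⊗[ℂ] B) (f : A →ₗ[ℂ] R) (g : B →ₗ[ℂ] R) :
    (f ◇ g) ∘ₗ u = leg u f g := rfl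

end Comps

/-- `x` is quasi-invertible with quasi-inverse `y` and intertwines the multiplicative maps
`a` and `b`. -/
structure Reassoc {D R : Type*} [Ring D] [Algebra ℂ D] [Ring R] [Algebra ℂ R] (a b : D →ₗ[ℂ] R)
    (x y : R) : Prop where
  mul_left : IsMul a
  mul_right : IsMul b
  comm : ∀ m, x * a m = b m * x
  inv : IsQuasiInverse x y (b 1) (a 1)

namespace Reassoc

variable {D R : Type*} [Ring D] [Algebra ℂ D] [Ring R] [Algebra ℂ R] {a b : D →ₗ[ℂ] R}
    {x y : R} (h : Reassoc a b x y)
include h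

theorem mul_inv : x * y = b 1 := h.inv.mul_eq
theorem inv_mul : y * x = a 1 := h.inv.mul_eq'
theorem one_mul : b 1 * x = x := by rw [← h.mul_inv, h.inv.mul_mul_eq]
theorem mul_one : x * a 1 = x := by rw [← h.inv_mul, ← mul_assoc, h.inv.mul_mul_eq]
theorem one_mul_inv : a 1 * y = y := by rw [← h.inv_mul, h.inv.mul_mul_eq']
theorem inv_mul_one : y * b 1 = y := by rw [← h.mul_inv, ← mul_assoc, h.inv.mul_mul_eq']

/-- Multiply the intertwining relation by `y` on both sides; the idempotents `y x = a 1` and `x y =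
b 1` that appear are absorbed by `a m` and `b m`. -/
theorem inv_comm (m : D) : a m * y = y * b m := by
  have := h.mul_left
  have := h.mul_right
  calc a m * y = a 1 * a m * y := by rw [← IsMul.map_mul, _root_.one_mul]
    _ = y * (x * a m) * y := by rw [← h.inv_mul]; simp only [mul_assoc]
    _ = y * (b m * b 1) := by rw [h.comm, ← h.mul_inv]; simp only [mul_assoc]
    _ = y * b m := by rw [← IsMul.map_mul, _root_.mul_one]

end Reassoc

variable {G : Type u} [Ring G] [Algebra ℂ G] {M : Type v} [Ring M] [Algebra ℂ M]
  {R : Type w} [Ring R] [Algebra ℂ R]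

section Hopf

variable (H : WeakQuasiBialgebra G) (i j k l : G →ₗ[ℂ] R) [IsMul i] [IsMul j] [IsMul k] [IsMul l]
  [Comm i j] [Comm i k] [Comm j k] [Comm i l] [Comm j l] [Comm k l]

theorem WeakQuasiBialgebra.reassoc : Reassoc
    (leg (H.Δ : G →ₗ[ℂ] G ⊗[ℂ] G) (leg (H.Δ : G →ₗ[ℂ] G ⊗[ℂ] G) i j) k)
    (leg (H.Δ : G →ₗ[ℂ] G ⊗[ℂ] G) i (leg (H.Δ : G →ₗ[ℂ] G ⊗[ℂ] G) j k))
    ((i ◇ j ◇ k) H.φ) ((i ◇ j ◇ k) H.φInv) where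
  mul_left := inferInstance
  mul_right := inferInstance
  comm m := by
    have := congrArg (i ◇ j ◇ k) (H.quasi_coassoc m)
    rw [IsMul.map_mul, IsMul.map_mul, mulPair_lTensor, mulPair_splitFst] at this
    exact this.symm
  inv := by
    constructor
    · have := congrArg (i ◇ j ◇ k) H.quasiInverse.mul_eq
      rwa [IsMul.map_mul, mulPair_lTensor] at this
    · have := congrArg (i ◇ j ◇ k) H.quasiInverse.mul_eq'
      rwa [IsMul.map_mul, mulPair_splitFst] at this
    · have := congrArg (i ◇ j ◇ k) H.quasiInverse.mul_mul_eq
      rwa [IsMul.map_mul, IsMul.map_mul] at this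
    · have := congrArg (i ◇ j ◇ k) H.quasiInverse.mul_mul_eq'
      rwa [IsMul.map_mul, IsMul.map_mul] at this

end Hopf

section Coactions

variable {H : WeakQuasiBialgebra G} (i j k : G →ₗ[ℂ] R) [IsMul i] [IsMul j] [IsMul k]
  [Comm i j] [Comm i k] [Comm j k] (g : M →ₗ[ℂ] R) [IsMul g] [Comm i g] [Comm j g] [Comm k g]

local notation "Δ" => (H.Δ : G →ₗ[ℂ] G ⊗[ℂ] G)

theorem LeftCoaction.reassoc (P : LeftCoaction H M) : Reassoc
    (leg (P.lam : M →ₗ[ℂ] G ⊗[ℂ] M) (leg Δ i j) g)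
    (leg (P.lam : M →ₗ[ℂ] G ⊗[ℂ] M) i (leg (P.lam : M →ₗ[ℂ] G ⊗[ℂ] M) j g))
    ((i ◇ j ◇ g) P.φ) ((i ◇ j ◇ g) P.φInv) where
  mul_left := inferInstance
  mul_right := inferInstance
  comm m := by
    have := congrArg (i ◇ j ◇ g) (P.quasi_coassoc m)
    rw [IsMul.map_mul, IsMul.map_mul, mulPair_lTensor, mulPair_splitFst] at this
    exact this.symm
  inv := by
    constructor
    · have := congrArg (i ◇ j ◇ g) P.quasiInverse.mul_eq
      rwa [IsMul.map_mul, mulPair_lTensor] at this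
    · have := congrArg (i ◇ j ◇ g) P.quasiInverse.mul_eq'
      rwa [IsMul.map_mul, mulPair_splitFst] at this
    · have := congrArg (i ◇ j ◇ g) P.quasiInverse.mul_mul_eq
      rwa [IsMul.map_mul, IsMul.map_mul] at this
    · have := congrArg (i ◇ j ◇ g) P.quasiInverse.mul_mul_eq'
      rwa [IsMul.map_mul, IsMul.map_mul] at this

theorem RightCoaction.reassoc (P : RightCoaction H M) : Reassoc
    (leg (P.rho : M →ₗ[ℂ] M ⊗[ℂ] G) (leg (P.rho : M →ₗ[ℂ] M ⊗[ℂ] G) g i) j)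
    (leg (P.rho : M →ₗ[ℂ] M ⊗[ℂ] G) g (leg Δ i j))
    ((g ◇ i ◇ j) P.φ) ((g ◇ i ◇ j) P.φInv) where
  mul_left := inferInstance
  mul_right := inferInstance
  comm m := by
    have := congrArg (g ◇ i ◇ j) (P.quasi_coassoc m)
    rw [IsMul.map_mul, IsMul.map_mul, mulPair_lTensor, mulPair_splitFst] at this
    exact this
  inv := by
    constructor
    · have := congrArg (g ◇ i ◇ j) P.quasiInverse.mul_eq
      rwa [IsMul.map_mul, mulPair_lTensor] at this
    · have := congrArg (g ◇ i ◇ j) P.quasiInverse.mul_eq'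
      rwa [IsMul.map_mul, mulPair_splitFst] at this
    · have := congrArg (g ◇ i ◇ j) P.quasiInverse.mul_mul_eq
      rwa [IsMul.map_mul, IsMul.map_mul] at this
    · have := congrArg (g ◇ i ◇ j) P.quasiInverse.mul_mul_eq'
      rwa [IsMul.map_mul, IsMul.map_mul] at this

theorem QuasiCommutingPair.reassoc (Q : QuasiCommutingPair H M) : Reassoc
    (leg (Q.right.rho : M →ₗ[ℂ] M ⊗[ℂ] G) (leg (Q.left.lam : M →ₗ[ℂ] G ⊗[ℂ] M) i g) j)
    (leg (Q.left.lam : M →ₗ[ℂ] G ⊗[ℂ] M) i (leg (Q.right.rho : M →ₗ[ℂ] M ⊗[ℂ] G) g j))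
    ((i ◇ g ◇ j) Q.φ) ((i ◇ g ◇ j) Q.φInv) where
  mul_left := inferInstance
  mul_right := inferInstance
  comm m := by
    have := congrArg (i ◇ g ◇ j) (Q.quasi_comm m)
    rw [IsMul.map_mul, IsMul.map_mul, mulPair_lTensor, mulPair_splitFst] at this
    exact this
  inv := by
    constructor
    · have := congrArg (i ◇ g ◇ j) Q.quasiInverse.mul_eq
      rwa [IsMul.map_mul, mulPair_lTensor] at this
    · have := congrArg (i ◇ g ◇ j) Q.quasiInverse.mul_eq'
      rwa [IsMul.map_mul, mulPair_splitFst] at this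
    · have := congrArg (i ◇ g ◇ j) Q.quasiInverse.mul_mul_eq
      rwa [IsMul.map_mul, IsMul.map_mul] at this
    · have := congrArg (i ◇ g ◇ j) Q.quasiInverse.mul_mul_eq'
      rwa [IsMul.map_mul, IsMul.map_mul] at this

/-- Unitality of `k` serves the padded last leg of `φ_ρ ⊗ 1`. The factor `1 ⊗ φ` contributes the
idempotent `g 1`, which commutes past `φ` and is absorbed by the next factor. No unitality of `g` is
required, as it will be an action in which `1` acts by a proper idempotent. -/
theorem RightCoaction.pentagon' (P : RightCoaction H M) [Unital k] :
    (i ◇ j ◇ k) H.φ * (g ◇ leg Δ i j ◇ k) P.φ * (g ◇ i ◇ j) P.φ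
      = (g ◇ i ◇ leg Δ j k) P.φ
        * (leg (P.rho : M →ₗ[ℂ] M ⊗[ℂ] G) g i ◇ j ◇ k) P.φ := by
  have h := congrArg (g ◇ i ◇ j ◇ k) P.pentagon
  simp only [IsMul.map_mul, mulPair_lTensor, mulPair_splitFst, leg_lTensor,
    leg_splitFst, mulPair_comp_eq_leg, mulPair_one_tmul, leg_tensorOne] at h
  rw [← h, ← (Comm.commute (f := i ◇ j ◇ k) (g := g) H.φ 1).eq, mul_assoc _ (g 1),
    map_one_mul_mulPair]

theorem LeftCoaction.pentagon' (P : LeftCoaction H M) [Unital i] :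
    (j ◇ k ◇ g) P.φ * (i ◇ leg Δ j k ◇ g) P.φ * (i ◇ j ◇ k) H.φ
      = (i ◇ j ◇ leg (P.lam : M →ₗ[ℂ] G ⊗[ℂ] M) k g) P.φ
        * (leg Δ i j ◇ k ◇ g) P.φ := by
  have h := congrArg (i ◇ j ◇ k ◇ g) P.pentagon
  have h2 : (i ◇ j ◇ leg (tensorOne G M) k g) H.φ = (i ◇ j ◇ k) H.φ * g 1 := by
    have : leg (tensorOne G M) k g = LinearMap.mulRight ℂ (g 1) ∘ₗ k := by
      ext a; simp [leg_apply]
    rw [this]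
    generalize H.φ = x
    induction x with
    | zero => simp
    | add x y hx hy => simp only [map_add, add_mul, hx, hy]
    | tmul a x =>
      induction x with
      | zero => simp
      | add x y hx hy => simp only [TensorProduct.tmul_add, map_add, add_mul, hx, hy]
      | tmul b c => simp [mul_assoc]
  have h3 : (i ◇ leg Δ j k ◇ g) P.φ * g 1 = (i ◇ leg Δ j k ◇ g) P.φ := by
    generalize P.φ = x
    induction x with
    | zero => simp
    | add x y hx hy => simp only [map_add, add_mul, hx, hy]
    | tmul a x =>
      induction x with
      | zero => simp
      | add x y hx hy => simp only [TensorProduct.tmul_add, map_add, add_mul, hx, hy]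
      | tmul b c => simp [mul_assoc, ← IsMul.map_mul]
  simp only [IsMul.map_mul, mulPair_lTensor, mulPair_splitFst, leg_lTensor, leg_splitFst,
    mulPair_comp_eq_leg, mulPair_one_tmul, Unital.map_one, one_mul, h2] at h
  rw [← h, (Comm.commute (f := i ◇ j ◇ k) (g := g) H.φ 1).eq, mul_assoc _ _ (g 1 * _), ← mul_assoc _ (g 1),
    h3, mul_assoc]

theorem QuasiCommutingPair.pentagon_left' (Q : QuasiCommutingPair H M) [Unital i] [Unital k] :
    (j ◇ g ◇ k) Q.φ * (i ◇ leg (Q.left.lam : M →ₗ[ℂ] G ⊗[ℂ] M) j g ◇ k) Q.φ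
        * (i ◇ j ◇ g) Q.left.φ
      = (i ◇ j ◇ leg (Q.right.rho : M →ₗ[ℂ] M ⊗[ℂ] G) g k) Q.left.φ
        * (leg Δ i j ◇ g ◇ k) Q.φ := by
  have h := congrArg (i ◇ j ◇ g ◇ k) Q.pentagon_left
  simp only [IsMul.map_mul, mulPair_lTensor, mulPair_splitFst, leg_lTensor,
    leg_splitFst, mulPair_comp_eq_leg, mulPair_one_tmul, leg_tensorOne,
    Unital.map_one, one_mul] at h
  exact h

theorem QuasiCommutingPair.pentagon_right' (Q : QuasiCommutingPair H M) [Unital i] [Unital k] :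
    (g ◇ j ◇ k) Q.right.φ * (i ◇ leg (Q.right.rho : M →ₗ[ℂ] M ⊗[ℂ] G) g j ◇ k) Q.φ
        * (i ◇ g ◇ j) Q.φ
      = (i ◇ g ◇ leg Δ j k) Q.φ
        * (leg (Q.left.lam : M →ₗ[ℂ] G ⊗[ℂ] M) i g ◇ j ◇ k) Q.right.φ := by
  have h := congrArg (i ◇ g ◇ j ◇ k) Q.pentagon_right
  simp only [IsMul.map_mul, mulPair_lTensor, mulPair_splitFst, leg_lTensor,
    leg_splitFst, mulPair_comp_eq_leg, mulPair_one_tmul, leg_tensorOne,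
    Unital.map_one, one_mul] at h
  exact h

end Coactions

end


/-! ### Pentagons solved for products with quasi-inverses -/

section

section Absorption

variable {A C D R : Type*} [Ring A] [Algebra ℂ A] [Ring C] [Algebra ℂ C] [Ring D] [Algebra ℂ D]
  [Ring R] [Algebra ℂ R]

theorem mulPair_mul_fst_one (f : A →ₗ[ℂ] R) [IsMul f] (g : C →ₗ[ℂ] R) [Comm f g] (x : A ⊗[ℂ] C) :
    (f ◇ g) x * f 1 = (f ◇ g) x := by
  induction x with
  | zero => simp
  | tmul a c =>
    rw [mulPair_tmul, mul_assoc, ← (Comm.commute (f := f) (g := g) 1 c).eq, ← mul_assoc,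
      ← IsMul.map_mul, mul_one]
  | add x y hx hy => simp only [map_add, add_mul, hx, hy]

theorem mulPair_mul_snd_one (f : A →ₗ[ℂ] R) (g : C →ₗ[ℂ] R) [IsMul g] (x : A ⊗[ℂ] C) :
    (f ◇ g) x * g 1 = (f ◇ g) x := by
  induction x with
  | zero => simp
  | tmul a c => rw [mulPair_tmul, mul_assoc, ← IsMul.map_mul, mul_one]
  | add x y hx hy => simp only [map_add, add_mul, hx, hy]

theorem fst_one_mul_mulPair (f : A →ₗ[ℂ] R) [IsMul f] (g : C →ₗ[ℂ] R) (x : A ⊗[ℂ] C) :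
    f 1 * (f ◇ g) x = (f ◇ g) x := map_one_mul_mulPair f g x

theorem snd_one_mul_mulPair (f : A →ₗ[ℂ] R) (g : C →ₗ[ℂ] R) [IsMul g] [Comm f g] (x : A ⊗[ℂ] C) :
    g 1 * (f ◇ g) x = (f ◇ g) x := by
  rw [← (commute_mulPair (fun a => (Comm.commute (f := g) (g := f) 1 a))
    (fun c => by rw [Commute, SemiconjBy, ← IsMul.map_mul, ← IsMul.map_mul, mul_one, one_mul])
    x).eq.symm, mulPair_mul_snd_one]

/-- If `x` intertwines `a` and `b` and commutes with `k`, it intertwines `a ◇ k` and `b ◇ k`. -/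
theorem mul_mulPair_fst {V W : Type*} [AddCommGroup V] [Module ℂ V] [AddCommGroup W] [Module ℂ W]
    {x : R} {a b : V →ₗ[ℂ] R} (h : ∀ m, x * a m = b m * x)
    (k : W →ₗ[ℂ] R) (hk : ∀ c, Commute x (k c)) (y : V ⊗[ℂ] W) :
    x * (a ◇ k) y = (b ◇ k) y * x := by
  induction y with
  | zero => simp
  | tmul a c => rw [mulPair_tmul, mulPair_tmul, ← mul_assoc, h, mul_assoc, (hk c).eq, mul_assoc]
  | add y z hy hz => simp only [map_add, add_mul, mul_add, hy, hz]

/-- If `x` intertwines `a` and `b` and commutes with `k`, it intertwines `k ◇ a` and `k ◇ b`. -/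
theorem mul_mulPair_snd {V W : Type*} [AddCommGroup V] [Module ℂ V] [AddCommGroup W] [Module ℂ W]
    {x : R} {a b : V →ₗ[ℂ] R} (h : ∀ m, x * a m = b m * x)
    (k : W →ₗ[ℂ] R) (hk : ∀ c, Commute x (k c)) (y : W ⊗[ℂ] V) :
    x * (k ◇ a) y = (k ◇ b) y * x := by
  induction y with
  | zero => simp
  | tmul c a => rw [mulPair_tmul, mulPair_tmul, ← mul_assoc, (hk c).eq, mul_assoc, h, mul_assoc]
  | add y z hy hz => simp only [map_add, add_mul, mul_add, hy, hz]

end Absorption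

section Abstract

variable {R : Type*} [Ring R] {x y z u v x' y' z' u' v' : R}

/-- Quasi-inverses cancel only up to idempotents, so solving `x y z = u v` for a product has to
assume the absorptions that make each cancellation legitimate. -/
theorem pentagon_solve_a (h : x * y * z = u * v) (h1 : u' * u * v = v) (h2 : y * (z * z') = y) :
    v * z' = u' * x * y := by
  calc v * z' = u' * (u * v) * z' := by rw [← mul_assoc, h1]
    _ = u' * x * (y * (z * z')) := by rw [← h]; simp only [mul_assoc]
    _ = u' * x * y := by rw [h2]

theorem pentagon_solve_b (h : x * y * z = u * v) (h1 : y' * (x' * x) = y')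
    (h2 : y' * y * z * v' = z * v') (h3 : u * (v * v') = u) : z * v' = y' * x' * u := by
  calc z * v' = y' * (x' * x) * y * z * v' := by rw [h1, h2]
    _ = y' * x' * (x * y * z) * v' := by simp only [mul_assoc]
    _ = y' * x' * (u * (v * v')) := by rw [h]; simp only [mul_assoc]
    _ = y' * x' * u := by rw [h3]

theorem pentagon_solve_d (h : x * y * z = u * v) (h1 : u * (v * v') = u)
    (h2 : x' * x * y = y) : x' * u = y * z * v' := by
  calc x' * u = x' * (u * v) * v' := by rw [mul_assoc, mul_assoc, h1]
    _ = x' * x * y * z * v' := by rw [← h]; simp only [mul_assoc]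
    _ = y * z * v' := by rw [h2]

end Abstract

variable {G : Type u} [Ring G] [Algebra ℂ G] {M : Type v} [Ring M] [Algebra ℂ M]
  {R : Type w} [Ring R] [Algebra ℂ R]

section Coactions

variable {H : WeakQuasiBialgebra G} (i j k : G →ₗ[ℂ] R) [IsMul i] [IsMul j] [IsMul k]
  [Comm i j] [Comm i k] [Comm j k] (g : M →ₗ[ℂ] R) [IsMul g] [Comm i g] [Comm j g] [Comm k g]

local notation "Δ" => (H.Δ : G →ₗ[ℂ] G ⊗[ℂ] G)

namespace RightCoaction
variable (P : RightCoaction H M)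
local notation "ρ" => (P.rho : M →ₗ[ℂ] M ⊗[ℂ] G)

/-- The left side has the shape met when `q_ρ` is inserted into the map built from `p_ρ`; on the
right the coproducts stand where the antipode can contract them, around a single `φ`. -/
theorem pentagon_a [Unital k] :
    (leg ρ g i ◇ j ◇ k) P.φ * (g ◇ i ◇ j) P.φInv
      = (g ◇ i ◇ leg Δ j k) P.φInv * (i ◇ j ◇ k) H.φ * (g ◇ leg Δ i j ◇ k) P.φ := by
  refine pentagon_solve_a (P.pentagon' i j k g) ?_ ?_
  · rw [(P.reassoc i (leg Δ j k) g).inv_mul, (P.reassoc j k (leg ρ g i)).one_mul]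
  · rw [(P.reassoc i j g).mul_inv, ← (P.reassoc (leg Δ i j) k g).mul_one, mul_assoc, leg_apply _ _ k,
      mulPair_mul_fst_one]

/-- The counterpart of `pentagon_a` for inserting `p_ρ` into the map built from `q_ρ`; here a single
`φ⁻¹` is left in the middle. -/
theorem pentagon_b [Unital k] :
    (g ◇ i ◇ j) P.φ * (leg ρ g i ◇ j ◇ k) P.φInv
      = (g ◇ leg Δ i j ◇ k) P.φInv * (i ◇ j ◇ k) H.φInv * (g ◇ i ◇ leg Δ j k) P.φ := by
  refine pentagon_solve_b (P.pentagon' i j k g) ?_ ?_ ?_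
  · rw [(H.reassoc i j k).inv_mul, ← (P.reassoc (leg Δ i j) k g).inv_mul_one, mul_assoc,
      leg_apply _ g, mulPair_mul_snd_one]
  · rw [(P.reassoc (leg Δ i j) k g).inv_mul, leg_apply _ _ k,
      ← mul_mulPair_fst (P.reassoc i j g).comm k (fun c => Comm.commute (f := g ◇ i ◇ j) (g := k) _ c),
      mul_assoc]
    congr 1
    exact (P.reassoc j k (leg ρ g i)).one_mul_inv
  · rw [(P.reassoc j k (leg ρ g i)).mul_inv]
    exact (P.reassoc i (leg Δ j k) g).mul_one

theorem pentagon_inv [Unital k] :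
    (g ◇ i ◇ j) P.φ * (leg ρ g i ◇ j ◇ k) P.φInv * (g ◇ i ◇ leg Δ j k) P.φInv
      = (g ◇ leg Δ i j ◇ k) P.φInv * (i ◇ j ◇ k) H.φInv := by
  rw [P.pentagon_b i j k g, mul_assoc, (P.reassoc i (leg Δ j k) g).mul_inv, mul_assoc,
    leg_apply _ g, mul_mulPair_snd (fun m => ((H.reassoc i j k).inv_comm m).symm) g
      (fun c => Comm.commute (f := i ◇ j ◇ k) (g := g) _ c), ← mul_assoc]
  congr 1
  exact (P.reassoc (leg Δ i j) k g).inv_mul_one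

end RightCoaction

namespace LeftCoaction
variable (P : LeftCoaction H M)
local notation "lam" => (P.lam : M →ₗ[ℂ] G ⊗[ℂ] M)

theorem pentagon_d [Unital i] :
    (j ◇ k ◇ g) P.φInv * (i ◇ j ◇ leg lam k g) P.φ
      = (i ◇ leg Δ j k ◇ g) P.φ * (i ◇ j ◇ k) H.φ * (leg Δ i j ◇ k ◇ g) P.φInv := by
  refine pentagon_solve_d (P.pentagon' i j k g) ?_ ?_
  · rw [(P.reassoc (leg Δ i j) k g).mul_inv]
    exact (P.reassoc i j (leg lam k g)).mul_one
  · rw [(P.reassoc j k g).inv_mul, ← (P.reassoc i (leg Δ j k) g).one_mul, ← mul_assoc,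
      leg_apply _ i, snd_one_mul_mulPair]

theorem pentagon_inv [Unital i] :
    (i ◇ leg Δ j k ◇ g) P.φInv * (j ◇ k ◇ g) P.φInv * (i ◇ j ◇ leg lam k g) P.φ
      = (i ◇ j ◇ k) H.φ * (leg Δ i j ◇ k ◇ g) P.φInv := by
  rw [mul_assoc, P.pentagon_d i j k g, ← mul_assoc, ← mul_assoc,
    (P.reassoc i (leg Δ j k) g).inv_mul, leg_apply _ _ g,
    ← mul_mulPair_fst (H.reassoc i j k).comm g
      (fun c => Comm.commute (f := i ◇ j ◇ k) (g := g) _ c), mul_assoc]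
  congr 1
  exact (P.reassoc (leg Δ i j) k g).one_mul_inv

end LeftCoaction

namespace QuasiCommutingPair
variable (Q : QuasiCommutingPair H M)
local notation "lam" => (Q.left.lam : M →ₗ[ℂ] G ⊗[ℂ] M)
local notation "ρ" => (Q.right.rho : M →ₗ[ℂ] M ⊗[ℂ] G)

theorem pentagon_left_solve [Unital i] [Unital k] :
    (i ◇ j ◇ g) Q.left.φ * (leg Δ i j ◇ g ◇ k) Q.φInv
      = (i ◇ leg lam j g ◇ k) Q.φInv * (j ◇ g ◇ k) Q.φInv * (i ◇ j ◇ leg ρ g k) Q.left.φ := by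
  refine pentagon_solve_b (Q.pentagon_left' i j k g) ?_ ?_ ?_
  · rw [(Q.reassoc j k g).inv_mul, ← (Q.reassoc i k (leg lam j g)).inv_mul_one, mul_assoc,
      leg_apply _ i, mulPair_mul_snd_one]
  · rw [(Q.reassoc i k (leg lam j g)).inv_mul, leg_apply _ _ k,
      ← mul_mulPair_fst (Q.left.reassoc i j g).comm k
        (fun c => Comm.commute (f := i ◇ j ◇ g) (g := k) _ c), mul_assoc]
    congr 1
    exact (Q.reassoc (leg Δ i j) k g).one_mul_inv
  · rw [(Q.reassoc (leg Δ i j) k g).mul_inv]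
    exact (Q.left.reassoc i j (leg ρ g k)).mul_one

theorem pentagon_right_solve [Unital i] [Unital k] :
    (i ◇ g ◇ j) Q.φ * (leg lam i g ◇ j ◇ k) Q.right.φInv
      = (i ◇ leg ρ g j ◇ k) Q.φInv * (g ◇ j ◇ k) Q.right.φInv * (i ◇ g ◇ leg Δ j k) Q.φ := by
  refine pentagon_solve_b (Q.pentagon_right' i j k g) ?_ ?_ ?_
  · rw [(Q.right.reassoc j k g).inv_mul, ← (Q.reassoc i k (leg ρ g j)).inv_mul_one, mul_assoc,
      leg_apply _ i, mulPair_mul_snd_one]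
  · rw [(Q.reassoc i k (leg ρ g j)).inv_mul, leg_apply _ _ k,
      ← mul_mulPair_fst (Q.reassoc i j g).comm k
        (fun c => Comm.commute (f := i ◇ g ◇ j) (g := k) _ c), mul_assoc]
    congr 1
    exact (Q.right.reassoc j k (leg lam i g)).one_mul_inv
  · rw [(Q.right.reassoc j k (leg lam i g)).mul_inv]
    exact (Q.reassoc i (leg Δ j k) g).mul_one

theorem pentagon_right_inv [Unital i] [Unital k] :
    (i ◇ g ◇ j) Q.φInv * (i ◇ leg ρ g j ◇ k) Q.φInv * (g ◇ j ◇ k) Q.right.φInv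
      = (leg lam i g ◇ j ◇ k) Q.right.φInv * (i ◇ g ◇ leg Δ j k) Q.φInv := by
  have h1 : (i ◇ g ◇ j) Q.φInv * (i ◇ g ◇ j) Q.φ * (leg lam i g ◇ j ◇ k) Q.right.φInv
      = (leg lam i g ◇ j ◇ k) Q.right.φInv := by
    rw [(Q.reassoc i j g).inv_mul, ← (Q.right.reassoc j k (leg lam i g)).one_mul_inv, ← mul_assoc,
      leg_apply _ _ k, fst_one_mul_mulPair]
  have h2 : (i ◇ leg ρ g j ◇ k) Q.φInv * ((g ◇ j ◇ k) Q.right.φInv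
      * leg lam i (leg ρ g (leg Δ j k)) 1)
      = (i ◇ leg ρ g j ◇ k) Q.φInv * (g ◇ j ◇ k) Q.right.φInv := by
    rw [leg_apply _ i, mul_mulPair_snd (fun m => ((Q.right.reassoc j k g).inv_comm m).symm) i
        (fun c => Comm.commute (f := g ◇ j ◇ k) (g := i) _ c), ← mul_assoc]
    congr 1
    exact (Q.reassoc i k (leg ρ g j)).inv_mul_one
  rw [← h1, mul_assoc _ _ ((leg lam i g ◇ j ◇ k) Q.right.φInv), Q.pentagon_right_solve i j k g]
  simp only [mul_assoc]
  rw [(Q.reassoc i (leg Δ j k) g).mul_inv, h2]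

end QuasiCommutingPair

end Coactions

end


/-! ### Leg embeddings, and consequences of the counit axioms -/

section

section Positions

variable (A B C D : Type*) [Ring A] [Algebra ℂ A] [Ring B] [Algebra ℂ B] [Ring C] [Algebra ℂ C]
  [Ring D] [Algebra ℂ D]

/-- The first leg of a fourfold tensor product. -/
abbrev pos₁ : A →ₗ[ℂ] A ⊗[ℂ] (B ⊗[ℂ] (C ⊗[ℂ] D)) := tensorOne A (B ⊗[ℂ] (C ⊗[ℂ] D))
/-- The second leg of a fourfold tensor product. -/
abbrev pos₂ : B →ₗ[ℂ] A ⊗[ℂ] (B ⊗[ℂ] (C ⊗[ℂ] D)) :=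
  oneTensor A (B ⊗[ℂ] (C ⊗[ℂ] D)) ∘ₗ tensorOne B (C ⊗[ℂ] D)
/-- The third leg of a fourfold tensor product. -/
abbrev pos₃ : C →ₗ[ℂ] A ⊗[ℂ] (B ⊗[ℂ] (C ⊗[ℂ] D)) :=
  oneTensor A (B ⊗[ℂ] (C ⊗[ℂ] D)) ∘ₗ oneTensor B (C ⊗[ℂ] D) ∘ₗ tensorOne C D
/-- The fourth leg of a fourfold tensor product. -/
abbrev pos₄ : D →ₗ[ℂ] A ⊗[ℂ] (B ⊗[ℂ] (C ⊗[ℂ] D)) :=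
  oneTensor A (B ⊗[ℂ] (C ⊗[ℂ] D)) ∘ₗ oneTensor B (C ⊗[ℂ] D) ∘ₗ oneTensor C D

/-- The way back from evaluated identities to tensors: an identity valid for all commuting
multiplicative maps is specialised to the leg embeddings. -/
theorem pos_mulPair (x : A ⊗[ℂ] (B ⊗[ℂ] (C ⊗[ℂ] D))) :
    (pos₁ A B C D ◇ pos₂ A B C D ◇ pos₃ A B C D ◇ pos₄ A B C D) x = x := by
  suffices h : (pos₁ A B C D ◇ pos₂ A B C D ◇ pos₃ A B C D ◇ pos₄ A B C D) = LinearMap.id by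
    rw [h]; rfl
  ext a b c d
  simp

end Positions

section Positions

variable {A B C D : Type*} [Ring A] [Algebra ℂ A] [Ring B] [Algebra ℂ B] [Ring C] [Algebra ℂ C]
  [Ring D] [Algebra ℂ D]

theorem pos3_mulPair (x : A ⊗[ℂ] (B ⊗[ℂ] C)) :
    (tensorOne A (B ⊗[ℂ] C) ◇ (oneTensor A (B ⊗[ℂ] C) ∘ₗ tensorOne B C)
      ◇ (oneTensor A (B ⊗[ℂ] C) ∘ₗ oneTensor B C)) x = x := by
  suffices h : (tensorOne A (B ⊗[ℂ] C) ◇ (oneTensor A (B ⊗[ℂ] C) ∘ₗ tensorOne B C)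
      ◇ (oneTensor A (B ⊗[ℂ] C) ∘ₗ oneTensor B C)) = LinearMap.id by
    rw [h]; rfl
  ext a b c
  simp

theorem pos2_mulPair (x : A ⊗[ℂ] B) : (tensorOne A B ◇ oneTensor A B) x = x := by
  suffices h : (tensorOne A B ◇ oneTensor A B) = LinearMap.id by
    rw [h]; rfl
  ext a b
  simp

theorem pos_splitFst {V : Type*} [AddCommGroup V] [Module ℂ V] (u : V →ₗ[ℂ] A ⊗[ℂ] B)
    (x : V ⊗[ℂ] (C ⊗[ℂ] D)) : splitFst (C ⊗[ℂ] D) u x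
      = (leg u (pos₁ A B C D) (pos₂ A B C D) ◇ pos₃ A B C D ◇ pos₄ A B C D) x := by
  rw [← mulPair_splitFst, pos_mulPair]

theorem pos_lTensor_splitFst {V : Type*} [AddCommGroup V] [Module ℂ V] (u : V →ₗ[ℂ] B ⊗[ℂ] C)
    (x : A ⊗[ℂ] (V ⊗[ℂ] D)) : LinearMap.lTensor A (splitFst D u) x
      = (pos₁ A B C D ◇ leg u (pos₂ A B C D) (pos₃ A B C D) ◇ pos₄ A B C D) x := by
  rw [← leg_splitFst, leg, ← mulPair_lTensor, pos_mulPair]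

theorem pos_lTensor_lTensor {V : Type*} [AddCommGroup V] [Module ℂ V] (u : V →ₗ[ℂ] C ⊗[ℂ] D)
    (x : A ⊗[ℂ] (B ⊗[ℂ] V)) : LinearMap.lTensor A (LinearMap.lTensor B u) x
      = (pos₁ A B C D ◇ pos₂ A B C D ◇ leg u (pos₃ A B C D) (pos₄ A B C D)) x := by
  rw [leg, ← leg_lTensor, leg, ← mulPair_lTensor, pos_mulPair]

theorem pos_tensorOne (x : A ⊗[ℂ] (B ⊗[ℂ] C)) :
    LinearMap.lTensor A (LinearMap.lTensor B (tensorOne C D)) x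
      = (pos₁ A B C D ◇ pos₂ A B C D ◇ pos₃ A B C D) x := by
  rw [pos_lTensor_lTensor, leg_tensorOne]

theorem pos_one_tmul (x : B ⊗[ℂ] (C ⊗[ℂ] D)) : (1 : A) ⊗ₜ x
      = (pos₂ A B C D ◇ pos₃ A B C D ◇ pos₄ A B C D) x := by
  rw [← pos_mulPair _ _ _ _ ((1 : A) ⊗ₜ[ℂ] x), mulPair_tmul, Unital.map_one, one_mul]

end Positions

section Counit

variable {G : Type u} [Ring G] [Algebra ℂ G] {M : Type v} [Ring M] [Algebra ℂ M]
  {R : Type w} [Ring R] [Algebra ℂ R] (H : WeakQuasiBialgebra G)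

/-- `a ↦ ε(a) 1`. -/
def counitLeg (R : Type*) [Ring R] [Algebra ℂ R] : G →ₗ[ℂ] R :=
  Algebra.linearMap ℂ R ∘ₗ H.ε.toLinearMap

@[simp] theorem counitLeg_apply (a : G) : counitLeg H R a = H.ε a • (1 : R) := by
  simp [counitLeg, Algebra.algebraMap_eq_smul_one]

instance : IsMul (counitLeg H R) := ⟨fun x y => by simp [smul_smul, mul_comm]⟩
instance : Unital (counitLeg H R) := ⟨by simp⟩
instance {V : Type*} [AddCommGroup V] [Module ℂ V] (f : V →ₗ[ℂ] R) : Comm (counitLeg H R) f :=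
  ⟨fun a c => by simp [Commute, SemiconjBy]⟩

theorem mulPair_counitLeg {V : Type*} [AddCommGroup V] [Module ℂ V] (f : V →ₗ[ℂ] R)
    (x : V ⊗[ℂ] G) : (f ◇ counitLeg H R) x = f (evalSnd V H.ε.toLinearMap x) := by
  induction x with
  | zero => simp
  | tmul a c => simp [evalSnd]
  | add x y hx hy => simp only [map_add, hx, hy]

theorem counitLeg_mulPair {V : Type*} [AddCommGroup V] [Module ℂ V] (f : V →ₗ[ℂ] R)
    (x : G ⊗[ℂ] V) : (counitLeg H R ◇ f) x = f (evalFst V H.ε.toLinearMap x) := by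
  induction x with
  | zero => simp
  | tmul a c => simp [evalFst]
  | add x y hx hy => simp only [map_add, hx, hy]

@[simp] theorem leg_counitLeg_right (i : G →ₗ[ℂ] R) :
    leg (H.Δ : G →ₗ[ℂ] G ⊗[ℂ] G) i (counitLeg H R) = i := by
  ext a; rw [leg_apply, mulPair_counitLeg]; exact congrArg i (H.counit_right a)

@[simp] theorem leg_counitLeg_left (i : G →ₗ[ℂ] R) :
    leg (H.Δ : G →ₗ[ℂ] G ⊗[ℂ] G) (counitLeg H R) i = i := by
  ext a; rw [leg_apply, counitLeg_mulPair]; exact congrArg i (H.counit_left a)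

variable {H}

@[simp] theorem LeftCoaction.leg_counitLeg (P : LeftCoaction H M) (g : M →ₗ[ℂ] R) :
    leg (P.lam : M →ₗ[ℂ] G ⊗[ℂ] M) (counitLeg H R) g = g := by
  ext a; rw [leg_apply, counitLeg_mulPair]; exact congrArg g (P.counit a)

@[simp] theorem RightCoaction.leg_counitLeg (P : RightCoaction H M) (g : M →ₗ[ℂ] R) :
    leg (P.rho : M →ₗ[ℂ] M ⊗[ℂ] G) g (counitLeg H R) = g := by
  ext a; rw [leg_apply, mulPair_counitLeg]; exact congrArg g (P.counit a)

theorem Reassoc.inv_eq_one {D : Type*} [Ring D] [Algebra ℂ D] {a b : D →ₗ[ℂ] R} {x y : R}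
    (h : Reassoc a b x y) (h1 : x = a 1) : y = b 1 := by
  rw [← h.one_mul_inv, ← h1, h.mul_inv]

variable (i k : G →ₗ[ℂ] R) [IsMul i] [IsMul k] [Comm i k] (g : M →ₗ[ℂ] R) [IsMul g] [Comm i g]
  [Comm k g]

theorem RightCoaction.mulPair_counit_right (P : RightCoaction H M) (g : M →ₗ[ℂ] R)
    (i : G →ₗ[ℂ] R) : (g ◇ i ◇ counitLeg H R) P.φ = leg (P.rho : M →ₗ[ℂ] M ⊗[ℂ] G) g i 1 := by
  have : (i ◇ counitLeg H R) = i ∘ₗ evalSnd G H.ε.toLinearMap :=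
    LinearMap.ext (mulPair_counitLeg H i)
  rw [this, ← mulPair_lTensor, P.counit_φ_right]; rfl

theorem RightCoaction.mulPair_counit_mid (P : RightCoaction H M) (g : M →ₗ[ℂ] R)
    (i : G →ₗ[ℂ] R) : (g ◇ counitLeg H R ◇ i) P.φ = leg (P.rho : M →ₗ[ℂ] M ⊗[ℂ] G) g i 1 := by
  have : (counitLeg H R ◇ i) = i ∘ₗ evalFst G H.ε.toLinearMap :=
    LinearMap.ext (counitLeg_mulPair H i)
  rw [this, ← mulPair_lTensor, P.counit_φ_mid]; rfl

theorem LeftCoaction.mulPair_counit_mid (P : LeftCoaction H M) (g : M →ₗ[ℂ] R)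
    (i : G →ₗ[ℂ] R) : (i ◇ counitLeg H R ◇ g) P.φ = leg (P.lam : M →ₗ[ℂ] G ⊗[ℂ] M) i g 1 := by
  have : (counitLeg H R ◇ g) = g ∘ₗ evalFst M H.ε.toLinearMap :=
    LinearMap.ext (counitLeg_mulPair H g)
  rw [this, ← mulPair_lTensor, P.counit_φ_mid]; rfl

theorem LeftCoaction.mulPair_counit_left (P : LeftCoaction H M) (g : M →ₗ[ℂ] R)
    (i : G →ₗ[ℂ] R) : (counitLeg H R ◇ i ◇ g) P.φ = leg (P.lam : M →ₗ[ℂ] G ⊗[ℂ] M) i g 1 := by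
  rw [counitLeg_mulPair, P.counit_φ_left]; rfl

theorem RightCoaction.mulPair_counit_right_inv (P : RightCoaction H M) :
    (g ◇ i ◇ counitLeg H R) P.φInv = leg (P.rho : M →ₗ[ℂ] M ⊗[ℂ] G) g i 1 := by
  have h := P.reassoc i (counitLeg H R) g
  simpa using h.inv_eq_one (by simp [P.mulPair_counit_right])

theorem RightCoaction.mulPair_counit_mid_inv (P : RightCoaction H M) :
    (g ◇ counitLeg H R ◇ i) P.φInv = leg (P.rho : M →ₗ[ℂ] M ⊗[ℂ] G) g i 1 := by
  have h := P.reassoc (counitLeg H R) i g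
  simpa using h.inv_eq_one (by simp [P.mulPair_counit_mid])

theorem LeftCoaction.mulPair_counit_mid_inv (P : LeftCoaction H M) :
    (i ◇ counitLeg H R ◇ g) P.φInv = leg (P.lam : M →ₗ[ℂ] G ⊗[ℂ] M) i g 1 := by
  have h := P.reassoc i (counitLeg H R) g
  simpa using h.inv_eq_one (by simp [P.mulPair_counit_mid])

theorem LeftCoaction.mulPair_counit_left_inv (P : LeftCoaction H M) :
    (counitLeg H R ◇ i ◇ g) P.φInv = leg (P.lam : M →ₗ[ℂ] G ⊗[ℂ] M) i g 1 := by
  have h := P.reassoc (counitLeg H R) i g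
  simpa using h.inv_eq_one (by simp [P.mulPair_counit_left])

/-- This is not an axiom for `φ_{λρ}`. Putting `ε` into the first two legs of the left pentagon
shows that the element is idempotent; both of its products with its quasi-inverse are `ρ(1)`, so it
is `ρ(1)` itself. -/
theorem QuasiCommutingPair.mulPair_counit_left (Q : QuasiCommutingPair H M) [Unital k] :
    (counitLeg H R ◇ g ◇ k) Q.φ = leg (Q.right.rho : M →ₗ[ℂ] M ⊗[ℂ] G) g k 1 := by
  have hr := Q.reassoc (counitLeg H R) k g
  have h := Q.pentagon_left' (counitLeg H R) (counitLeg H R) k g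
  simp only [Q.left.leg_counitLeg, Q.left.mulPair_counit_mid, leg_counitLeg_right] at h hr
  have h1 : (counitLeg H R ◇ g ◇ k) Q.φ * g 1 = (counitLeg H R ◇ g ◇ k) Q.φ := by
    rw [← hr.mul_one, mul_assoc, leg_apply, mulPair_mul_fst_one]
  rw [mul_assoc, h1, hr.one_mul] at h
  rw [← hr.mul_one, ← hr.mul_inv, ← mul_assoc, h, hr.mul_inv]

theorem QuasiCommutingPair.mulPair_counit_right (Q : QuasiCommutingPair H M) [Unital i] :
    (i ◇ g ◇ counitLeg H R) Q.φ = leg (Q.left.lam : M →ₗ[ℂ] G ⊗[ℂ] M) i g 1 := by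
  have hr := Q.reassoc i (counitLeg H R) g
  have h := Q.pentagon_right' i (counitLeg H R) (counitLeg H R) g
  simp only [Q.right.leg_counitLeg, Q.right.mulPair_counit_mid, leg_counitLeg_right] at h hr
  have h1 : g 1 * (i ◇ g ◇ counitLeg H R) Q.φ = (i ◇ g ◇ counitLeg H R) Q.φ := by
    rw [← hr.one_mul, ← mul_assoc, leg_apply, snd_one_mul_mulPair]
  rw [h1, hr.mul_one] at h
  rw [← hr.one_mul, ← hr.inv_mul, mul_assoc, h]

end Counit

end


/-! ### Contractions with the antipode, and the elements `p_ρ` and `q_ρ` -/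

section

variable {G : Type u} [Ring G] [Algebra ℂ G] {M : Type v} [Ring M] [Algebra ℂ M]

@[simp] theorem linearMap_apply {A B : Type*} [Ring A] [Algebra ℂ A] [Ring B] [Algebra ℂ B]
    (f : A →ₙₐ[ℂ] B) (x : A) : (f : A →ₗ[ℂ] B) x = f x := rfl


section Antipode

variable (H : WeakQuasiHopfAlgebra G)

/-- The antipode as a linear map. -/
def WeakQuasiHopfAlgebra.antipode : G →ₗ[ℂ] G :=
  (MulOpposite.opLinearEquiv ℂ).symm.toLinearMap ∘ₗ H.S.toLinearMap

@[simp] theorem antipode_mul (a b : G) : H.antipode (a * b) = H.antipode b * H.antipode a := by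
  simp [WeakQuasiHopfAlgebra.antipode]
@[simp] theorem antipodeInv_mul (a b : G) :
    H.antipodeInv (a * b) = H.antipodeInv b * H.antipodeInv a := by
  simp [WeakQuasiHopfAlgebra.antipodeInv]
@[simp] theorem antipode_antipodeInv (a : G) : H.antipode (H.antipodeInv a) = a := by
  simp [WeakQuasiHopfAlgebra.antipode, WeakQuasiHopfAlgebra.antipodeInv]
@[simp] theorem antipodeInv_antipode (a : G) : H.antipodeInv (H.antipode a) = a := by
  simp [WeakQuasiHopfAlgebra.antipode, WeakQuasiHopfAlgebra.antipodeInv]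
@[simp] theorem antipode_one : H.antipode 1 = 1 := by
  simp [WeakQuasiHopfAlgebra.antipode]
@[simp] theorem antipodeInv_one : H.antipodeInv 1 = 1 := by
  simp [WeakQuasiHopfAlgebra.antipodeInv]

/-- `y ⊗ z ↦ S(y) α z`. -/
def antiL : G ⊗[ℂ] G →ₗ[ℂ] G := (LinearMap.mulRight ℂ H.α ∘ₗ H.antipode) ◇ LinearMap.id
/-- `y ⊗ z ↦ y β S(z)`. -/
def antiR : G ⊗[ℂ] G →ₗ[ℂ] G := (LinearMap.mulRight ℂ H.β) ◇ H.antipode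
/-- `y ⊗ z ↦ S⁻¹(α z) y`. -/
def antiInvL : G ⊗[ℂ] G →ₗ[ℂ] G :=
  LinearMap.mul' ℂ G ∘ₗ (TensorProduct.comm ℂ G G).toLinearMap ∘ₗ
      LinearMap.lTensor G (H.antipodeInv ∘ₗ LinearMap.mulLeft ℂ H.α)

@[simp] theorem antiL_tmul (y z : G) : antiL H (y ⊗ₜ z) = H.antipode y * H.α * z := rfl
@[simp] theorem antiR_tmul (y z : G) : antiR H (y ⊗ₜ z) = y * H.β * H.antipode z := rfl
@[simp] theorem antiInvL_tmul (y z : G) :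
    antiInvL H (y ⊗ₜ z) = H.antipodeInv z * H.antipodeInv H.α * y := by
  simp [antiInvL]

@[simp] theorem antiL_comul (a : G) : antiL H (H.Δ a) = H.ε a • H.α := H.antipode_left a
@[simp] theorem antiR_comul (a : G) : antiR H (H.Δ a) = H.ε a • H.β := H.antipode_right a

/-- `x ⊗ y ⊗ z ↦ x β S(y) α z`. -/
def antiRL : G ⊗[ℂ] (G ⊗[ℂ] G) →ₗ[ℂ] G := LinearMap.mulRight ℂ H.β ◇ antiL H
/-- `x ⊗ y ⊗ z ↦ S(x) α y β S(z)`. -/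
def antiLR : G ⊗[ℂ] (G ⊗[ℂ] G) →ₗ[ℂ] G := (LinearMap.mulRight ℂ H.α ∘ₗ H.antipode) ◇ antiR H

@[simp] theorem antiRL_tmul (x y z : G) :
    antiRL H (x ⊗ₜ (y ⊗ₜ z)) = x * H.β * (H.antipode y * H.α * z) := rfl
@[simp] theorem antiLR_tmul (x y z : G) :
    antiLR H (x ⊗ₜ (y ⊗ₜ z)) = H.antipode x * H.α * (y * H.β * H.antipode z) := rfl
@[simp] theorem antiRL_φ : antiRL H H.φ = 1 := H.antipode_φ
@[simp] theorem antiLR_φInv : antiLR H H.φInv = 1 := H.antipode_φInv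

/-- The contraction is `S⁻¹` of `S(y) α z`; multiplying by `Δ(a)` on the left places `S(a₁) α a₂ =
ε(a) α` in the middle. -/
theorem antiInvL_comul_mul (a : G) (u : G ⊗[ℂ] G) :
    antiInvL H (H.Δ a * u) = H.ε a • antiInvL H u := by
  have key : ∀ w : G ⊗[ℂ] G, ∀ y z, antiInvL H (w * (y ⊗ₜ z))
      = H.antipodeInv z * H.antipodeInv (antiL H w) * y := by
    intro w y z
    induction w with
    | zero => simp
    | tmul w w' => simp [mul_assoc]
    | add x y hx hy => simp only [add_mul, map_add, mul_add, hx, hy]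
  induction u with
  | zero => simp
  | tmul y z => simp [key, mul_assoc]
  | add x y hx hy => simp only [mul_add, map_add, smul_add, hx, hy]

theorem antiR_mul_comul (a : G) (u : G ⊗[ℂ] G) :
    antiR H (u * H.Δ a) = H.ε a • antiR H u := by
  have key : ∀ w : G ⊗[ℂ] G, ∀ y z, antiR H ((y ⊗ₜ z) * w)
      = y * antiR H w * H.antipode z := by
    intro w y z
    induction w with
    | zero => simp
    | tmul w w' => simp [mul_assoc]
    | add x y hx hy => simp only [add_mul, map_add, mul_add, hx, hy]
  induction u with
  | zero => simp
  | tmul y z => simp [key, mul_assoc]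
  | add x y hx hy => simp only [add_mul, map_add, smul_add, hx, hy]

/-- On `a ⊗ b ⊗ c` the contraction reads `x a z₁ β S(z₂) S(b) S(y₁) α y₂ c w`, so both coproducts
meet the antipode axioms. -/
theorem antiRL_mul (x y z w : G) (u : G ⊗[ℂ] (G ⊗[ℂ] G)) :
    antiRL H ((x ⊗ₜ H.Δ y) * u * splitFst G (H.Δ : G →ₗ[ℂ] G ⊗[ℂ] G) (z ⊗ₜ w))
      = H.ε y • H.ε z • (x * antiRL H u * w) := by
  have key : ∀ (a b c : G) (s t : G ⊗[ℂ] G),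
      antiRL H ((x ⊗ₜ s) * (a ⊗ₜ (b ⊗ₜ c)) * TensorProduct.assoc ℂ G G G (t ⊗ₜ w))
        = x * a * antiR H t * H.antipode b * antiL H s * c * w := by
    intro a b c s t
    induction s with
    | zero => simp
    | add s s' hs hs' =>
      simp only [TensorProduct.tmul_add, add_mul, map_add, mul_add, hs, hs']
    | tmul s s' =>
      induction t with
      | zero => simp
      | add t t' ht ht' =>
        simp only [TensorProduct.add_tmul, add_mul, map_add, mul_add, ht, ht']
      | tmul t t' => simp [mul_assoc]
  induction u with
  | zero => simp
  | add u v hu hv => simp only [mul_add, add_mul, map_add, smul_add, hu, hv]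
  | tmul a u =>
    induction u with
    | zero => simp
    | add u v hu hv =>
      simp only [TensorProduct.tmul_add, mul_add, add_mul, map_add, smul_add, hu, hv]
    | tmul b c =>
      simp only [splitFst, LinearMap.comp_apply, LinearMap.rTensor_tmul, LinearEquiv.coe_coe, key,
        linearMap_apply, antiR_comul, antiL_comul]
      simp [mul_assoc, smul_smul]

theorem antiLR_mul (x y z w : G) (u : G ⊗[ℂ] (G ⊗[ℂ] G)) :
    antiLR H (splitFst G (H.Δ : G →ₗ[ℂ] G ⊗[ℂ] G) (z ⊗ₜ w) * u * (x ⊗ₜ H.Δ y))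
      = H.ε y • H.ε z • (H.antipode x * antiLR H u * H.antipode w) := by
  have key : ∀ (a b c : G) (s t : G ⊗[ℂ] G),
      antiLR H (TensorProduct.assoc ℂ G G G (t ⊗ₜ w) * (a ⊗ₜ (b ⊗ₜ c)) * (x ⊗ₜ s))
        = H.antipode x * H.antipode a * antiL H t * b * antiR H s * H.antipode c
          * H.antipode w := by
    intro a b c s t
    induction s with
    | zero => simp
    | add s s' hs hs' =>
      simp only [TensorProduct.tmul_add, add_mul, map_add, mul_add, hs, hs']
    | tmul s s' =>
      induction t with
      | zero => simp
      | add t t' ht ht' =>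
        simp only [TensorProduct.add_tmul, add_mul, map_add, mul_add, ht, ht']
      | tmul t t' => simp [mul_assoc]
  induction u with
  | zero => simp
  | add u v hu hv => simp only [mul_add, add_mul, map_add, smul_add, hu, hv]
  | tmul a u =>
    induction u with
    | zero => simp
    | add u v hu hv =>
      simp only [TensorProduct.tmul_add, mul_add, add_mul, map_add, smul_add, hu, hv]
    | tmul b c =>
      simp only [splitFst, LinearMap.comp_apply, LinearMap.rTensor_tmul, LinearEquiv.coe_coe, key,
        linearMap_apply, antiR_comul, antiL_comul]
      simp [mul_assoc, smul_smul]

end Antipode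

section Right

variable (H : WeakQuasiHopfAlgebra G) (P : RightCoaction H.toWeakQuasiBialgebra M)

local notation "Δ" => (H.Δ : G →ₗ[ℂ] G ⊗[ℂ] G)
local notation "ρ" => (P.rho : M →ₗ[ℂ] M ⊗[ℂ] G)

namespace RightCoaction

/-- `q = ∑ x ⊗ S⁻¹(α z) y` for `φ_ρ = ∑ x ⊗ y ⊗ z`. -/
def qElt : M ⊗[ℂ] G := (antiInvL H).lTensor M P.φ
/-- `p = ∑ x ⊗ y β S(z)` for `φ_ρ⁻¹ = ∑ x ⊗ y ⊗ z`. -/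
def pElt : M ⊗[ℂ] G := (antiR H).lTensor M P.φInv
/-- `m ⊗ a ↦ ρ(m) p (1 ⊗ S(a))`. -/
def pMap : M ⊗[ℂ] G →ₗ[ℂ] M ⊗[ℂ] G :=
  (antiR H).lTensor M ∘ₗ LinearMap.mulRight ℂ P.φInv ∘ₗ splitFst G ρ
/-- `m ⊗ a ↦ (1 ⊗ S⁻¹(a)) q ρ(m)`. -/
def qMap : M ⊗[ℂ] G →ₗ[ℂ] M ⊗[ℂ] G :=
  (antiInvL H).lTensor M ∘ₗ LinearMap.mulLeft ℂ P.φ ∘ₗ splitFst G ρ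

theorem pMap_apply (w : M ⊗[ℂ] G) :
    P.pMap H w = (antiR H).lTensor M (splitFst G ρ w * P.φInv) := rfl
theorem qMap_apply (w : M ⊗[ℂ] G) :
    P.qMap H w = (antiInvL H).lTensor M (P.φ * splitFst G ρ w) := rfl

theorem pMap_tmul (m : M) (a : G) :
    P.pMap H (m ⊗ₜ a) = P.rho m * P.pElt H * (1 ⊗ₜ H.antipode a) := by
  have key : ∀ (w : M ⊗[ℂ] G) (u : M ⊗[ℂ] (G ⊗[ℂ] G)),
      (antiR H).lTensor M (TensorProduct.assoc ℂ M G G (w ⊗ₜ a) * u)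
        = w * (antiR H).lTensor M u * (1 ⊗ₜ H.antipode a) := by
    intro w u
    induction w with
    | zero => simp
    | add w w' h h' => simp only [TensorProduct.add_tmul, add_mul, map_add, h, h']
    | tmul w w' =>
      induction u with
      | zero => simp
      | add u v hu hv => simp only [mul_add, add_mul, map_add, hu, hv]
      | tmul n u =>
        induction u with
        | zero => simp
        | add u v hu hv =>
          simp only [TensorProduct.tmul_add, mul_add, add_mul, map_add, hu, hv]
        | tmul b c => simp [mul_assoc]
  exact key (P.rho m) P.φInv

theorem qMap_tmul (m : M) (a : G) :
    P.qMap H (m ⊗ₜ a) = (1 ⊗ₜ H.antipodeInv a) * P.qElt H * P.rho m := by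
  have key : ∀ (w : M ⊗[ℂ] G) (u : M ⊗[ℂ] (G ⊗[ℂ] G)),
      (antiInvL H).lTensor M (u * TensorProduct.assoc ℂ M G G (w ⊗ₜ a))
        = (1 ⊗ₜ H.antipodeInv a) * (antiInvL H).lTensor M u * w := by
    intro w u
    induction w with
    | zero => simp
    | add w w' h h' => simp only [TensorProduct.add_tmul, mul_add, map_add, h, h']
    | tmul w w' =>
      induction u with
      | zero => simp
      | add u v hu hv => simp only [mul_add, add_mul, map_add, hu, hv]
      | tmul n u =>
        induction u with
        | zero => simp
        | add u v hu hv =>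
          simp only [TensorProduct.tmul_add, mul_add, add_mul, map_add, hu, hv]
        | tmul b c => simp [mul_assoc]
  exact key (P.rho m) P.φ

theorem lTensor_antiR_mul (w : M ⊗[ℂ] G) (u : M ⊗[ℂ] (G ⊗[ℂ] G)) :
    (antiR H).lTensor M (u * LinearMap.lTensor M Δ w)
      = (antiR H).lTensor M u * tensorOne M G (evalSnd M H.ε.toLinearMap w) := by
  induction w with
  | zero => simp
  | add w w' h h' => simp only [mul_add, map_add, h, h']
  | tmul m a =>
    induction u with
    | zero => simp
    | add u v hu hv => simp only [add_mul, map_add, hu, hv]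
    | tmul n u => simp [antiR_mul_comul, evalSnd, TensorProduct.smul_tmul']

theorem lTensor_antiInvL_mul (w : M ⊗[ℂ] G) (u : M ⊗[ℂ] (G ⊗[ℂ] G)) :
    (antiInvL H).lTensor M (LinearMap.lTensor M Δ w * u)
      = tensorOne M G (evalSnd M H.ε.toLinearMap w) * (antiInvL H).lTensor M u := by
  induction w with
  | zero => simp
  | add w w' h h' => simp only [add_mul, map_add, h, h']
  | tmul m a =>
    induction u with
    | zero => simp
    | add u v hu hv => simp only [mul_add, map_add, hu, hv]
    | tmul n u => simp [antiInvL_comul_mul, evalSnd, TensorProduct.smul_tmul']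

theorem reassoc_id : Reassoc (splitFst G ρ ∘ₗ ρ) (LinearMap.lTensor M Δ ∘ₗ ρ) P.φ P.φInv := by
  have h := P.reassoc (oneTensor M (G ⊗[ℂ] G) ∘ₗ tensorOne G G)
    (oneTensor M (G ⊗[ℂ] G) ∘ₗ oneTensor G G) (tensorOne M (G ⊗[ℂ] G))
  rw [pos3_mulPair, pos3_mulPair] at h
  convert h using 1
  · ext m
    rw [leg_apply, ← mulPair_splitFst, pos3_mulPair]; rfl
  · ext m
    rw [leg_apply, leg, ← mulPair_lTensor, pos3_mulPair]; rfl

/-- Commuting `φ_ρ⁻¹` past `(ρ ⊗ id)(ρ(m))` leaves `(id ⊗ Δ)(ρ(m))` on the right, where the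
contraction with `β` turns it into `ε`. -/
theorem pMap_rho (m : M) : P.pMap H (P.rho m) = P.pElt H * (m ⊗ₜ 1) := by
  rw [pMap_apply]
  have := (P.reassoc_id H).inv_comm m
  simp only [LinearMap.comp_apply] at this
  erw [this, lTensor_antiR_mul, P.counit]
  rfl

theorem qMap_rho (m : M) : P.qMap H (P.rho m) = (m ⊗ₜ 1) * P.qElt H := by
  rw [qMap_apply]
  have := P.quasi_coassoc m
  rw [this, lTensor_antiInvL_mul, P.counit]
  rfl

theorem lTensor_antiRL_mul (X Y : M ⊗[ℂ] (G ⊗[ℂ] G)) (u : G ⊗[ℂ] (G ⊗[ℂ] G)) :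
    (antiRL H).lTensor M (LinearMap.lTensor M (LinearMap.lTensor G Δ) X * (1 ⊗ₜ u)
        * LinearMap.lTensor M (splitFst G Δ) Y)
      = LinearMap.lTensor M (evalSnd G H.ε.toLinearMap) X * (1 ⊗ₜ antiRL H u)
        * LinearMap.lTensor M (evalFst G H.ε.toLinearMap) Y := by
  induction X with
  | zero => simp
  | add x y hx hy => simp only [add_mul, map_add, hx, hy]
  | tmul m x =>
    induction x with
    | zero => simp
    | add x y hx hy => simp only [TensorProduct.tmul_add, add_mul, map_add, hx, hy]
    | tmul a b =>
      induction Y with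
      | zero => simp
      | add x y hx hy => simp only [mul_add, map_add, hx, hy]
      | tmul n y =>
        induction y with
        | zero => simp
        | add x y hx hy => simp only [TensorProduct.tmul_add, mul_add, map_add, hx, hy]
        | tmul c d =>
          simp only [LinearMap.lTensor_tmul, Algebra.TensorProduct.tmul_mul_tmul, mul_one,
            linearMap_apply, antiRL_mul]
          simp [evalSnd, evalFst, smul_smul, mul_assoc, mul_comm (H.ε c)]

theorem lTensor_antiLR_mul (X Y : M ⊗[ℂ] (G ⊗[ℂ] G)) (u : G ⊗[ℂ] (G ⊗[ℂ] G)) :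
    (H.antipodeInv ∘ₗ antiLR H).lTensor M (LinearMap.lTensor M (splitFst G Δ) Y * (1 ⊗ₜ u)
        * LinearMap.lTensor M (LinearMap.lTensor G Δ) X)
      = LinearMap.lTensor M (evalFst G H.ε.toLinearMap) Y * (1 ⊗ₜ H.antipodeInv (antiLR H u))
        * LinearMap.lTensor M (evalSnd G H.ε.toLinearMap) X := by
  induction X with
  | zero => simp
  | add x y hx hy => simp only [mul_add, map_add, hx, hy]
  | tmul m x =>
    induction x with
    | zero => simp
    | add x y hx hy => simp only [TensorProduct.tmul_add, mul_add, map_add, hx, hy]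
    | tmul a b =>
      induction Y with
      | zero => simp
      | add x y hx hy => simp only [add_mul, map_add, hx, hy]
      | tmul n y =>
        induction y with
        | zero => simp
        | add x y hx hy => simp only [TensorProduct.tmul_add, add_mul, map_add, hx, hy]
        | tmul c d =>
          simp only [LinearMap.lTensor_tmul, Algebra.TensorProduct.tmul_mul_tmul, mul_one,
            linearMap_apply, LinearMap.comp_apply, antiLR_mul]
          simp [evalSnd, evalFst, smul_smul, mul_assoc]

/-- Since `S(S⁻¹(α b) a) = S(a) α b`, the `β` contraction of `p_ρ` and the `α` contraction of `q_ρ`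
merge into the single contraction `x β S(y) α z` of a fourfold tensor. -/
theorem pMap_antiInvL (X U : M ⊗[ℂ] (G ⊗[ℂ] G)) :
    (antiR H).lTensor M (splitFst G ρ ((antiInvL H).lTensor M X) * U)
      = (antiRL H).lTensor M (splitFst (G ⊗[ℂ] G) ρ X
        * LinearMap.lTensor M (LinearMap.lTensor G (tensorOne G G)) U) := by
  have key : ∀ (w : M ⊗[ℂ] G) (a b : G),
      (antiR H).lTensor M (TensorProduct.assoc ℂ M G G (w ⊗ₜ antiInvL H (a ⊗ₜ b)) * U)
        = (antiRL H).lTensor M (TensorProduct.assoc ℂ M G (G ⊗[ℂ] G) (w ⊗ₜ (a ⊗ₜ b))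
        * LinearMap.lTensor M (LinearMap.lTensor G (tensorOne G G)) U) := by
    intro w a b
    induction w with
    | zero => simp
    | add w w' h h' => simp only [TensorProduct.add_tmul, add_mul, map_add, h, h']
    | tmul w w' =>
      induction U with
      | zero => simp
      | add u v hu hv => simp only [mul_add, map_add, hu, hv]
      | tmul n u =>
        induction u with
        | zero => simp
        | add u v hu hv =>
          simp only [TensorProduct.tmul_add, mul_add, map_add, hu, hv]
        | tmul c d => simp [mul_assoc]
  induction X with
  | zero => simp
  | add x y hx hy => simp only [add_mul, map_add, hx, hy]
  | tmul m x =>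
    induction x with
    | zero => simp
    | add x y hx hy => simp only [TensorProduct.tmul_add, add_mul, map_add, hx, hy]
    | tmul a b => exact key (P.rho m) a b

theorem qMap_antiR (X U : M ⊗[ℂ] (G ⊗[ℂ] G)) :
    (antiInvL H).lTensor M (U * splitFst G ρ ((antiR H).lTensor M X))
      = (H.antipodeInv ∘ₗ antiLR H).lTensor M
        (LinearMap.lTensor M (LinearMap.lTensor G (tensorOne G G)) U
          * splitFst (G ⊗[ℂ] G) ρ X) := by
  have key : ∀ (w : M ⊗[ℂ] G) (a b : G),
      (antiInvL H).lTensor M (U * TensorProduct.assoc ℂ M G G (w ⊗ₜ antiR H (a ⊗ₜ b)))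
        = (H.antipodeInv ∘ₗ antiLR H).lTensor M
          (LinearMap.lTensor M (LinearMap.lTensor G (tensorOne G G)) U
            * TensorProduct.assoc ℂ M G (G ⊗[ℂ] G) (w ⊗ₜ (a ⊗ₜ b))) := by
    intro w a b
    induction w with
    | zero => simp
    | add w w' h h' => simp only [TensorProduct.add_tmul, mul_add, map_add, h, h']
    | tmul w w' =>
      induction U with
      | zero => simp
      | add u v hu hv => simp only [add_mul, map_add, hu, hv]
      | tmul n u =>
        induction u with
        | zero => simp
        | add u v hu hv =>
          simp only [TensorProduct.tmul_add, add_mul, map_add, hu, hv]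
        | tmul c d => simp [mul_assoc]
  induction X with
  | zero => simp
  | add x y hx hy => simp only [mul_add, map_add, hx, hy]
  | tmul m x =>
    induction x with
    | zero => simp
    | add x y hx hy => simp only [TensorProduct.tmul_add, mul_add, map_add, hx, hy]
    | tmul a b => exact key (P.rho m) a b

end RightCoaction

end Right

end


/-! ### `p_ρ` and `q_ρ` are mutually inverse; `p_ρ` against `φ_{λρ}` -/

section

variable {G : Type u} [Ring G] [Algebra ℂ G] {M : Type v} [Ring M] [Algebra ℂ M]

section Right

variable (H : WeakQuasiHopfAlgebra G) (P : RightCoaction H.toWeakQuasiBialgebra M)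

local notation "Δ" => (H.Δ : G →ₗ[ℂ] G ⊗[ℂ] G)
local notation "ρ" => (P.rho : M →ₗ[ℂ] M ⊗[ℂ] G)

namespace RightCoaction

theorem lTensor_counit_right_φInv :
    LinearMap.lTensor M (evalSnd G H.ε.toLinearMap) P.φInv = P.rho 1 := by
  have h := P.mulPair_counit_right_inv (oneTensor M G) (tensorOne M G)
  have : (oneTensor M G ◇ counitLeg H.toWeakQuasiBialgebra (M ⊗[ℂ] G))
      = oneTensor M G ∘ₗ evalSnd G H.ε.toLinearMap :=
    LinearMap.ext (mulPair_counitLeg _ _)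
  rw [this, ← mulPair_lTensor, leg_apply, pos2_mulPair, pos2_mulPair] at h
  exact h

theorem lTensor_counit_mid_φInv :
    LinearMap.lTensor M (evalFst G H.ε.toLinearMap) P.φInv = P.rho 1 := by
  have h := P.mulPair_counit_mid_inv (oneTensor M G) (tensorOne M G)
  have : (counitLeg H.toWeakQuasiBialgebra (M ⊗[ℂ] G) ◇ oneTensor M G)
      = oneTensor M G ∘ₗ evalFst G H.ε.toLinearMap :=
    LinearMap.ext (counitLeg_mulPair _ _)
  rw [this, ← mulPair_lTensor, leg_apply, pos2_mulPair, pos2_mulPair] at h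
  exact h

/-- Rewrite by `pentagon_a` and contract: the two coproducts become counits, `φ` becomes `∑ X β S(Y)
α Z = 1`, and the counit legs of `φ_ρ⁻¹` and `φ_ρ` are both `ρ(1)`. -/
theorem pMap_qElt : P.pMap H (P.qElt H) = P.rho 1 := by
  have h := P.pentagon_a (pos₂ M G G G) (pos₃ M G G G) (pos₄ M G G G) (pos₁ M G G G)
  rw [← pos_splitFst, ← pos_tensorOne, ← pos_lTensor_lTensor, ← pos_one_tmul,
    ← pos_lTensor_splitFst] at h
  rw [pMap_apply, qElt, pMap_antiInvL, h, lTensor_antiRL_mul, lTensor_counit_right_φInv,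
    P.counit_φ_mid, antiRL_φ, ← Algebra.TensorProduct.one_def, mul_one, ← map_mul, mul_one]

/-- The mirror argument with `pentagon_b`; now the axiom used is `∑ S(P) α Q β S(R) = 1` for `φ⁻¹`.
-/
theorem qMap_pElt : P.qMap H (P.pElt H) = P.rho 1 := by
  have h := P.pentagon_b (pos₂ M G G G) (pos₃ M G G G) (pos₄ M G G G) (pos₁ M G G G)
  rw [← pos_splitFst, ← pos_tensorOne, ← pos_lTensor_lTensor, ← pos_one_tmul,
    ← pos_lTensor_splitFst] at h
  rw [qMap_apply, pElt, qMap_antiR, h, lTensor_antiLR_mul, lTensor_counit_mid_φInv,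
    P.counit_φ_right, antiLR_φInv, antipodeInv_one, ← Algebra.TensorProduct.one_def, mul_one,
    ← map_mul, mul_one]

theorem splitFst_tensorOne_mul (x : M ⊗[ℂ] G) :
    splitFst G ρ (1 ⊗ₜ 1) * splitFst G ρ x = splitFst G ρ x := by
  rw [← pos3_mulPair (splitFst G ρ (1 ⊗ₜ 1)), ← pos3_mulPair (splitFst G ρ x), mulPair_splitFst,
    mulPair_splitFst, mulPair_tmul,
    Unital.map_one (f := oneTensor M (G ⊗[ℂ] G) ∘ₗ oneTensor G G), mul_one, fst_one_mul_mulPair]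

theorem rho_one_mul_pElt : P.rho 1 * P.pElt H = P.pElt H := by
  have h : P.pMap H (1 ⊗ₜ 1) = P.rho 1 * P.pElt H := by
    rw [pMap_tmul, antipode_one, ← Algebra.TensorProduct.one_def, mul_one]
  have h2 := (P.reassoc_id H).one_mul_inv
  rw [← h, pMap_apply, ← h2, ← mul_assoc, LinearMap.comp_apply, splitFst_tensorOne_mul]
  rw [LinearMap.comp_apply] at h2
  rw [h2]; rfl

end RightCoaction

end Right

section Mixed

variable (H : WeakQuasiHopfAlgebra G) (Q : QuasiCommutingPair H.toWeakQuasiBialgebra M)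
local notation "Δ" => (H.Δ : G →ₗ[ℂ] G ⊗[ℂ] G)
local notation "lam" => (Q.left.lam : M →ₗ[ℂ] G ⊗[ℂ] M)
local notation "ρ" => (Q.right.rho : M →ₗ[ℂ] M ⊗[ℂ] G)

theorem lTensor_lTensor_antiR_mul (U : G ⊗[ℂ] (M ⊗[ℂ] (G ⊗[ℂ] G))) (Y : G ⊗[ℂ] (M ⊗[ℂ] G)) :
    LinearMap.lTensor G (LinearMap.lTensor M (antiR H))
        (U * LinearMap.lTensor G (LinearMap.lTensor M Δ) Y)
      = LinearMap.lTensor G (LinearMap.lTensor M (antiR H)) U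
        * LinearMap.lTensor G (tensorOne M G ∘ₗ evalSnd M H.ε.toLinearMap) Y := by
  induction Y with
  | zero => simp
  | add x y hx hy => simp only [mul_add, map_add, hx, hy]
  | tmul a y =>
    induction U with
    | zero => simp
    | add x y hx hy => simp only [add_mul, map_add, hx, hy]
    | tmul b u => simp [RightCoaction.lTensor_antiR_mul]

theorem lTensor_pMap (X : G ⊗[ℂ] (M ⊗[ℂ] G)) :
    LinearMap.lTensor G (Q.right.pMap H) X
      = LinearMap.lTensor G (LinearMap.lTensor M (antiR H))
        (LinearMap.lTensor G (splitFst G ρ) X * (1 ⊗ₜ Q.right.φInv)) := by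
  induction X with
  | zero => simp
  | add x y hx hy => simp only [add_mul, map_add, hx, hy]
  | tmul a y => simp [RightCoaction.pMap_apply]

theorem mul_splitFst_antiR (U : G ⊗[ℂ] (M ⊗[ℂ] G)) (X : M ⊗[ℂ] (G ⊗[ℂ] G)) :
    U * splitFst G lam (LinearMap.lTensor M (antiR H) X)
      = LinearMap.lTensor G (LinearMap.lTensor M (antiR H))
        (LinearMap.lTensor G (LinearMap.lTensor M (tensorOne G G)) U
          * splitFst (G ⊗[ℂ] G) lam X) := by
  have key : ∀ (w : G ⊗[ℂ] M) (a b : G),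
      U * TensorProduct.assoc ℂ G M G (w ⊗ₜ antiR H (a ⊗ₜ b))
        = LinearMap.lTensor G (LinearMap.lTensor M (antiR H))
          (LinearMap.lTensor G (LinearMap.lTensor M (tensorOne G G)) U
            * TensorProduct.assoc ℂ G M (G ⊗[ℂ] G) (w ⊗ₜ (a ⊗ₜ b))) := by
    intro w a b
    induction w with
    | zero => simp
    | add w w' h h' => simp only [TensorProduct.add_tmul, mul_add, map_add, h, h']
    | tmul w w' =>
      induction U with
      | zero => simp
      | add u v hu hv => simp only [add_mul, map_add, hu, hv]
      | tmul n u =>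
        induction u with
        | zero => simp
        | add u v hu hv =>
          simp only [TensorProduct.tmul_add, add_mul, map_add, hu, hv]
        | tmul c d => simp [mul_assoc]
  induction X with
  | zero => simp
  | add x y hx hy => simp only [mul_add, map_add, hx, hy]
  | tmul m x =>
    induction x with
    | zero => simp
    | add x y hx hy => simp only [TensorProduct.tmul_add, mul_add, map_add, hx, hy]
    | tmul a b => exact key (Q.left.lam m) a b

/-- `φ (λ ⊗ id)(p) = (id ⊗ E)(φ⁻¹) (λ(1) ⊗ 1)`, where `E (m ⊗ a) = ρ(m) p (1 ⊗ S(a))`. -/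
theorem QuasiCommutingPair.mul_splitFst_pElt :
    Q.φ * splitFst G lam (Q.right.pElt H)
      = LinearMap.lTensor G (Q.right.pMap H) Q.φInv
        * LinearMap.lTensor G (tensorOne M G) (Q.left.lam 1) := by
  have h := Q.pentagon_right_solve (pos₁ G M G G) (pos₃ G M G G) (pos₄ G M G G) (pos₂ G M G G)
  rw [← pos_splitFst, ← pos_tensorOne, ← pos_lTensor_lTensor, ← pos_one_tmul,
    ← pos_lTensor_splitFst] at h
  -- This is what survives of the factor `φ_{λρ}` once the contraction has turned the coproduct in
  -- its last leg into a counit.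
  have h2 : LinearMap.lTensor G (evalSnd M H.ε.toLinearMap) Q.φ = Q.left.lam 1 := by
    have h := Q.mulPair_counit_right (tensorOne G M) (oneTensor G M)
    have : (oneTensor G M ◇ counitLeg H.toWeakQuasiBialgebra (G ⊗[ℂ] M))
        = oneTensor G M ∘ₗ evalSnd M H.ε.toLinearMap :=
      LinearMap.ext (mulPair_counitLeg _ _)
    rw [this, ← mulPair_lTensor, leg_apply, pos2_mulPair, pos2_mulPair] at h
    exact h
  rw [RightCoaction.pElt, mul_splitFst_antiR, h, lTensor_lTensor_antiR_mul, ← lTensor_pMap,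
    LinearMap.lTensor_comp_apply, h2]

end Mixed

end


/-! ### The passage between intertwiners `T` and elements `L = q_ρ T` -/

section

instance isMul_splitFst {A B C D : Type*} [Ring A] [Algebra ℂ A] [Ring B] [Algebra ℂ B] [Ring C]
    [Algebra ℂ C] [Ring D] [Algebra ℂ D] (u : A →ₗ[ℂ] B ⊗[ℂ] C) [IsMul u] :
    IsMul (splitFst D u) := by
  have h : splitFst D u = leg u (tensorOne B (C ⊗[ℂ] D))
      (oneTensor B (C ⊗[ℂ] D) ∘ₗ tensorOne C D) ◇ (oneTensor B (C ⊗[ℂ] D) ∘ₗ oneTensor C D) := by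
    refine LinearMap.ext fun x => ?_
    rw [← leg_splitFst, leg_apply, pos3_mulPair]
  rw [h]; infer_instance

variable {G : Type u} [Ring G] [Algebra ℂ G] {M : Type v} [Ring M] [Algebra ℂ M]
  {R : Type w} [Ring R] [Algebra ℂ R] (H : WeakQuasiHopfAlgebra G)

section RightAct

variable {C : Type*} [Ring C] [Algebra ℂ C] (j k : G →ₗ[ℂ] R) (r : C →ₗ[ℂ] R)

/-- The right action `Z ◁ (c ⊗ a) = j(S⁻¹(a)) Z r(c)` of `C ⊗ G` on `R`. -/
def rightAct (Z : R) : C ⊗[ℂ] G →ₗ[ℂ] R :=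
  ((j ∘ₗ H.antipodeInv) ◇ (LinearMap.mulLeft ℂ Z ∘ₗ r)) ∘ₗ
    (TensorProduct.comm ℂ C G).toLinearMap

@[simp] theorem rightAct_tmul (Z : R) (c : C) (a : G) :
    rightAct H j r Z (c ⊗ₜ a) = j (H.antipodeInv a) * (Z * r c) := rfl

/-- The action law holds because `S⁻¹` reverses products and its values multiply from the left. It
turns manipulations of `L` into computations in the acting algebra. -/
theorem rightAct_rightAct [IsMul j] [IsMul r] (Z : R) (w w' : C ⊗[ℂ] G) :
    rightAct H j r (rightAct H j r Z w) w' = rightAct H j r Z (w * w') := by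
  induction w' with
  | zero => simp
  | add x y hx hy => simp only [mul_add, map_add, hx, hy]
  | tmul c a =>
    induction w with
    | zero => simp
    | add x y hx hy =>
      rw [rightAct_tmul] at hx hy ⊢
      simp only [add_mul, map_add, mul_add, hx, hy]
    | tmul c' a' => simp [IsMul.map_mul, mul_assoc]

theorem mul_rightAct {X : R} (hX : ∀ a, Commute (j a) X) (Z : R) (w : C ⊗[ℂ] G) :
    X * rightAct H j r Z w = rightAct H j r (X * Z) w := by
  induction w with
  | zero => simp
  | add x y hx hy => simp only [mul_add, map_add, hx, hy]
  | tmul c a => simp only [rightAct_tmul, ← mul_assoc, (hX _).eq]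

theorem leg_mul_rightAct [IsMul j] (Z : R) (a : G) (w : C ⊗[ℂ] G) :
    j a * rightAct H j r Z w = rightAct H j r Z (w * (1 ⊗ₜ H.antipode a)) := by
  induction w with
  | zero => simp
  | add x y hx hy => simp only [mul_add, add_mul, map_add, hx, hy]
  | tmul c b => simp [IsMul.map_mul, mul_assoc]

theorem rightAct_mul_tensorOne [IsMul r] (Z : R) (c : C) (w : C ⊗[ℂ] G) :
    rightAct H j r Z (w * (c ⊗ₜ 1)) = rightAct H j r Z w * r c := by
  induction w with
  | zero => simp
  | add x y hx hy => simp only [add_mul, map_add, hx, hy]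
  | tmul c b => simp [IsMul.map_mul, mul_assoc]

theorem commute_rightAct {Z x : R} (hj : ∀ a, Commute x (j a)) (hr : ∀ c, Commute x (r c))
    (hZ : Commute x Z) (w : C ⊗[ℂ] G) : Commute x (rightAct H j r Z w) := by
  induction w with
  | zero => simp
  | add x y hx hy => rw [map_add]; exact hx.add_right hy
  | tmul c b => exact (hj _).mul_right (hZ.mul_right (hr _))

/-- The right action of `G ⊗ (C ⊗ G)`. -/
def rightAct₃ (Z : R) : G ⊗[ℂ] (C ⊗[ℂ] G) →ₗ[ℂ] R :=
  rightAct H j (k ◇ r) Z ∘ₗ (TensorProduct.assoc ℂ G C G).symm.toLinearMap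

@[simp] theorem rightAct₃_tmul (Z : R) (a b : G) (c : C) :
    rightAct₃ H j k r Z (a ⊗ₜ (c ⊗ₜ b)) = j (H.antipodeInv b) * (Z * (k a * r c)) := rfl

theorem rightAct₃_rightAct₃ [IsMul j] [IsMul k] [IsMul r] [Comm k r] (Z : R)
    (w w' : G ⊗[ℂ] (C ⊗[ℂ] G)) :
    rightAct₃ H j k r (rightAct₃ H j k r Z w) w' = rightAct₃ H j k r Z (w * w') := by
  have := map_mul (Algebra.TensorProduct.assoc ℂ ℂ ℂ G C G).symm w w'
  simp only [rightAct₃, LinearMap.comp_apply, rightAct_rightAct]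
  congr 1
  exact this.symm

theorem mul_rightAct₃ {X : R} (hX : ∀ a, Commute (j a) X) (Z : R) (w : G ⊗[ℂ] (C ⊗[ℂ] G)) :
    X * rightAct₃ H j k r Z w = rightAct₃ H j k r (X * Z) w :=
  mul_rightAct H j (k ◇ r) hX Z _

theorem rightAct₃_splitFst (u : C →ₗ[ℂ] G ⊗[ℂ] C) (Z : R) (w : C ⊗[ℂ] G) :
    rightAct₃ H j k r Z (splitFst G u w) = rightAct H j (leg u k r) Z w := by
  induction w with
  | zero => simp
  | add x y hx hy => simp only [map_add, hx, hy]
  | tmul c b =>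
    rw [rightAct₃, LinearMap.comp_apply, splitFst, LinearMap.comp_apply, LinearEquiv.coe_coe,
      LinearEquiv.coe_coe, LinearEquiv.symm_apply_apply]
    rfl

theorem rightAct₃_mul_tensorOne [IsMul k] [IsMul r] [Comm k r] (Z : R) (y : G ⊗[ℂ] C)
    (w : G ⊗[ℂ] (C ⊗[ℂ] G)) :
    rightAct₃ H j k r Z (w * LinearMap.lTensor G (tensorOne C G) y)
      = rightAct₃ H j k r Z w * (k ◇ r) y := by
  induction y with
  | zero => simp
  | add x y hx hy => simp only [map_add, mul_add, hx, hy]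
  | tmul a c =>
    induction w with
    | zero => simp
    | add x y hx hy => simp only [add_mul, map_add, hx, hy]
    | tmul b w =>
      induction w with
      | zero => simp
      | add x y hx hy => simp only [TensorProduct.tmul_add, add_mul, map_add, hx, hy]
      | tmul c' b' =>
        simp only [LinearMap.lTensor_tmul, tensorOne_apply, Algebra.TensorProduct.tmul_mul_tmul,
          mul_one, rightAct₃_tmul, mulPair_tmul, IsMul.map_mul]
        simp only [mul_assoc]
        rw [← mul_assoc (r c') (k a), ← (Comm.commute (f := k) (g := r) a c').eq, mul_assoc]

theorem mul_rightAct_eq_rightAct₃ [Comm k j] [Comm k r] {Z : R} (hZ : ∀ a, Commute (k a) Z)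
    (a : G) (w : C ⊗[ℂ] G) :
    k a * rightAct H j r Z w = rightAct₃ H j k r Z (a ⊗ₜ w) := by
  induction w with
  | zero => simp
  | add x y hx hy => simp only [mul_add, TensorProduct.tmul_add, map_add, hx, hy]
  | tmul c b =>
    rw [rightAct₃_tmul, rightAct_tmul, ← mul_assoc,
      (Comm.commute (f := k) (g := j) a (H.antipodeInv b)).eq, mul_assoc, ← mul_assoc (k a),
      (hZ a).eq, mul_assoc]

end RightAct

section Correspondence

variable (P : RightCoaction H.toWeakQuasiBialgebra M) (j : G →ₗ[ℂ] R) (l r : M →ₗ[ℂ] R)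
  [IsMul j] [Unital j] [IsMul l] [IsMul r] [Comm j l]

local notation "ρ" => (P.rho : M →ₗ[ℂ] M ⊗[ℂ] G)

/-- Left factors can be pushed into the acting element: `l m` becomes `ρ(m)` by `hL`, and `j a`
becomes `1 ⊗ S(a)`. That is what `pMap` records. -/
theorem mulPair_mul_rightAct_pElt {L : R} (hL : ∀ m, l m * L = rightAct H j r L (P.rho m))
    (w : M ⊗[ℂ] G) :
    (l ◇ j) w * rightAct H j r L (P.pElt H) = rightAct H j r L (P.pMap H w) := by
  induction w with
  | zero => simp
  | add x y hx hy => simp only [add_mul, map_add, hx, hy]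
  | tmul m a =>
    rw [mulPair_tmul, ← (Comm.commute (f := j) (g := l) a m).eq, mul_assoc,
      mul_rightAct _ _ _ (fun b => Comm.commute b m), hL, rightAct_rightAct, leg_mul_rightAct,
      P.pMap_tmul]

theorem rightAct_pElt_mul {L : R} (hL : ∀ m, l m * L = rightAct H j r L (P.rho m)) (m : M) :
    rightAct H j r L (P.pElt H) * r m = leg ρ l j m * rightAct H j r L (P.pElt H) := by
  rw [leg_apply, mulPair_mul_rightAct_pElt H P j l r hL, linearMap_apply, P.pMap_rho,
    rightAct_mul_tensorOne]

theorem rightAct_pElt_mul_one (L : R) :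
    rightAct H j r L (P.pElt H) * r 1 = rightAct H j r L (P.pElt H) := by
  rw [← rightAct_mul_tensorOne, ← Algebra.TensorProduct.one_def, mul_one]

/-- One half of the correspondence, `L` recovered from `t = L ◁ p_ρ`: pushing `q_ρ` into the action
gives `ρ(1)` by `pMap_qElt`. -/
theorem qElt_mul_rightAct_pElt {L : R} (hL : ∀ m, l m * L = rightAct H j r L (P.rho m)) :
    (l ◇ j) (P.qElt H) * rightAct H j r L (P.pElt H) = l 1 * L := by
  rw [mulPair_mul_rightAct_pElt H P j l r hL, P.pMap_qElt, hL]

theorem rightAct_qElt_mul {T : R} (hT : ∀ m, T * r m = leg ρ l j m * T) (w : M ⊗[ℂ] G) :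
    rightAct H j r ((l ◇ j) (P.qElt H) * T) w = (l ◇ j) (P.qMap H w) * T := by
  induction w with
  | zero => simp
  | add x y hx hy => simp only [add_mul, map_add, hx, hy]
  | tmul m a =>
    rw [P.qMap_tmul, rightAct_tmul, mul_assoc _ T, hT, IsMul.map_mul, IsMul.map_mul, mulPair_tmul,
      leg_apply, ← (Comm.commute (f := j) (g := l) (H.antipodeInv a) 1).eq]
    simp only [mul_assoc]
    rw [← mul_assoc (l 1), fst_one_mul_mulPair]
    rfl

/-- The intertwining relation of `T` becomes a relation of module type for `q_ρ T`, because `qMap`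
takes `ρ(m)` to `(m ⊗ 1) q_ρ`. -/
theorem mul_qElt_mul {T : R} (hT : ∀ m, T * r m = leg ρ l j m * T) (m : M) :
    l m * ((l ◇ j) (P.qElt H) * T) = rightAct H j r ((l ◇ j) (P.qElt H) * T) (P.rho m) := by
  rw [rightAct_qElt_mul H P j l r hT, P.qMap_rho, IsMul.map_mul, mulPair_tmul, Unital.map_one,
    mul_one, mul_assoc]

/-- The other half of the correspondence, from `qMap_pElt`. It returns `ρ(1) T`, hence the
hypothesis `hT1`. -/
theorem rightAct_qElt_mul_pElt {T : R} (hT : ∀ m, T * r m = leg ρ l j m * T)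
    (hT1 : leg ρ l j 1 * T = T) :
    rightAct H j r ((l ◇ j) (P.qElt H) * T) (P.pElt H) = T := by
  rw [rightAct_qElt_mul H P j l r hT, P.qMap_pElt]
  exact hT1

end Correspondence

section Composite

variable (Q : QuasiCommutingPair H.toWeakQuasiBialgebra M) (j k : G →ₗ[ℂ] R) (g l r : M →ₗ[ℂ] R)
  [IsMul j] [Unital j] [IsMul k] [IsMul g] [IsMul r] [Comm j k] [Comm j g] [Comm k g]
  [Comm k r]

local notation "lam" => (Q.left.lam : M →ₗ[ℂ] G ⊗[ℂ] M)
local notation "ρ" => (Q.right.rho : M →ₗ[ℂ] M ⊗[ℂ] G)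

variable {L T : R} (hL : ∀ m, g m * L = rightAct H j r L (Q.right.rho m))
  (hkL : ∀ a, Commute (k a) L) (hjT : ∀ a, Commute (j a) T)
include hL hkL hjT

/-- The composite of an intertwiner `T` with `t = L ◁ p`. -/
theorem composite_eq : T * (k ◇ g ◇ j) Q.φInv * rightAct H j r L (Q.right.pElt H)
    = rightAct₃ H j k r (T * L) (Q.φ * splitFst G lam (Q.right.pElt H)) := by
  have h1 : ∀ x, (k ◇ g ◇ j) x * rightAct H j r L (Q.right.pElt H)
      = rightAct₃ H j k r L (LinearMap.lTensor G (Q.right.pMap H) x) := by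
    intro x
    induction x with
    | zero => simp
    | add x y hx hy => simp only [add_mul, map_add, hx, hy]
    | tmul a w =>
      rw [mulPair_tmul, mul_assoc, mulPair_mul_rightAct_pElt H Q.right j g r hL,
        LinearMap.lTensor_tmul, mul_rightAct_eq_rightAct₃ H j k r hkL]
  have h2 : ∀ y, rightAct H j r L (Q.right.pElt H) * (k ◇ r) y
      = (k ◇ leg ρ g j) y * rightAct H j r L (Q.right.pElt H) :=
    mul_mulPair_snd (rightAct_pElt_mul H Q.right j g r hL) k
      (fun a => (commute_rightAct H j r (fun b => Comm.commute a b) (fun b => Comm.commute a b)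
        (hkL a) _).symm)
  -- The idempotent `λ(1)` is inserted because the formula for `φ_{λρ} (λ ⊗ id)(p_ρ)` comes with
  -- this factor; it is free, being absorbed by `φ_{λρ}⁻¹` after passing through `L ◁ p_ρ`.
  have h3 : (k ◇ g ◇ j) Q.φInv * rightAct H j r L (Q.right.pElt H)
      = (k ◇ g ◇ j) Q.φInv * rightAct H j r L (Q.right.pElt H) * (k ◇ r) (Q.left.lam 1) := by
    rw [mul_assoc, h2, ← mul_assoc]
    congr 1
    exact (Q.reassoc k j g).inv_mul_one.symm
  rw [mul_assoc, h3, h1, ← rightAct₃_mul_tensorOne, Q.mul_splitFst_pElt,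
    mul_rightAct₃ H j k r hjT]

/-- The `ρ` inside the acting element is undone by `hL`, which leaves `λ(m)` between `T` and `L`;
then `T` carries it to the left as `l m`. -/
theorem mul_composite {l : M →ₗ[ℂ] R} (hT : ∀ m, T * leg lam k g m = l m * T) (m : M) :
    rightAct₃ H j k r (T * L) (LinearMap.lTensor G ρ (Q.left.lam m)) = l m * (T * L) := by
  have h : ∀ y, rightAct₃ H j k r L (LinearMap.lTensor G ρ y) = (k ◇ g) y * L := by
    intro y
    induction y with
    | zero => simp
    | add x y hx hy => simp only [add_mul, map_add, hx, hy]
    | tmul a m =>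
      rw [LinearMap.lTensor_tmul, linearMap_apply, ← mul_rightAct_eq_rightAct₃ H j k r hkL, ← hL,
        mulPair_tmul, mul_assoc]
  rw [← mul_rightAct₃ H j k r hjT, h, ← mul_assoc, ← mul_assoc]
  exact congrArg (· * L) (hT m)

/-- `T L` is determined by the composite of `T` with `t = L ◁ p`. -/
theorem recover_of_composite {l : M →ₗ[ℂ] R} [IsMul l] [Comm j l]
    (hT : ∀ m, T * leg lam k g m = l m * T) (hT1 : l 1 * T = T) :
    T * L = rightAct₃ H j k r ((l ◇ j) (Q.right.qElt H)
      * (T * (k ◇ g ◇ j) Q.φInv * rightAct H j r L (Q.right.pElt H))) Q.φInv := by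
  have hY := mul_composite H Q j k g r hL hkL hjT hT
  -- After twisting by `φ_{λρ}`, `T L` satisfies the module relation with right action through `λ`.
  -- So `q_ρ` recovers the twisted product from its action on `p_ρ`, and `φ_{λρ}⁻¹` removes the
  -- twist.
  have hΨ : ∀ m, l m * rightAct₃ H j k r (T * L) Q.φ
      = rightAct H j (leg lam k r) (rightAct₃ H j k r (T * L) Q.φ) (Q.right.rho m) := by
    intro m
    rw [mul_rightAct₃ H j k r (fun a => Comm.commute a m), ← hY, rightAct₃_rightAct₃,
      ← Q.quasi_comm, ← rightAct₃_rightAct₃, rightAct₃_splitFst]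
  rw [composite_eq H Q j k g r hL hkL hjT, ← rightAct₃_rightAct₃, rightAct₃_splitFst,
    qElt_mul_rightAct_pElt H Q.right j l (leg lam k r) hΨ,
    ← mul_rightAct₃ H j k r (fun a => Comm.commute a 1), rightAct₃_rightAct₃, Q.quasiInverse.mul_eq,
    hY, ← mul_assoc, ← mul_assoc, ← IsMul.map_mul, mul_one, hT1]

/-- Converse of the recovery formula: prescribing `T L` as a twist of `Z` prescribes the composite
of `T` with `t`, since `φ_{λρ}⁻¹ φ_{λρ}` is absorbed by `p_ρ`. This allows `T` to be defined by its
composite. -/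
theorem composite_of_eq {Z : R} (hZ : T * L = rightAct₃ H j k r Z Q.φInv) :
    T * (k ◇ g ◇ j) Q.φInv * rightAct H j r L (Q.right.pElt H)
      = rightAct H j (leg lam k r) Z (Q.right.pElt H) := by
  rw [composite_eq H Q j k g r hL hkL hjT, hZ, rightAct₃_rightAct₃, ← mul_assoc,
    Q.quasiInverse.mul_eq', ← IsMul.map_mul, rightAct₃_splitFst, Q.right.rho_one_mul_pElt]

end Composite

end


/-! ### Division by `L`, and the defining equations in evaluated form -/

section

section Hat

variable {B B' : Type*} [Ring B] [Algebra ℂ B] [Ring B'] [Algebra ℂ B']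

/-- `hat` is a left `B`-linear section of right multiplication by `L`, up to the idempotent `e`. -/
structure Hat (ext : B →ₗ[ℂ] B') (hat : B' →ₗ[ℂ] B) (L : B') (e : B) : Prop where
  mul_hat : ∀ x y, x * hat y = hat (ext x * y)
  hat_mul : ∀ y, ext (hat y) * L = y * ext e

namespace Hat

variable {ext : B →ₗ[ℂ] B'} {hat : B' →ₗ[ℂ] B} {L : B'} {e : B} (h : Hat ext hat L e)
include h

theorem lTensor (K : Type*) [Ring K] [Algebra ℂ K] :
    Hat (ext.lTensor K) (hat.lTensor K) (1 ⊗ₜ L) (1 ⊗ₜ e) where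
  mul_hat x y := by
    induction x with
    | zero => simp
    | add x x' hx hx' => simp only [add_mul, map_add, hx, hx']
    | tmul k b =>
      induction y with
      | zero => simp
      | add x x' hx hx' => simp only [mul_add, map_add, hx, hx']
      | tmul k' b' => simp [h.mul_hat]
  hat_mul y := by
    induction y with
    | zero => simp
    | add x x' hx hx' => simp only [add_mul, map_add, hx, hx']
    | tmul k b => simp [h.hat_mul]

theorem hat_mul_hat {y : B'} (hy : y * ext e = y) : hat y * hat L = hat y := by
  rw [h.mul_hat, h.hat_mul, hy]

/-- `hat L` is the idempotent projecting on the part of `B` that right multiplication by `L` sees;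
elements absorbing it on the right can be tested against `L`. -/
theorem eq_of_mul {x x' : B} (hx : x * hat L = x) (hx' : x' * hat L = x')
    (he : ext x * L = ext x' * L) : x = x' := by
  rw [← hx, ← hx', h.mul_hat, h.mul_hat, he]

end Hat
end Hat

section Transport

variable {A B C R V : Type*} [Ring A] [Algebra ℂ A] [Ring B] [Algebra ℂ B] [Ring C] [Algebra ℂ C]
  [Ring R] [Algebra ℂ R] [AddCommGroup V] [Module ℂ V]

theorem mulPair_eq_lTensor (f : V →ₗ[ℂ] B) (x : A ⊗[ℂ] V) :
    (tensorOne A B ◇ oneTensor A B ∘ₗ f) x = f.lTensor A x := by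
  rw [← mulPair_lTensor, pos2_mulPair]

theorem mulPair_eq_comm_rTensor (f : V →ₗ[ℂ] B) (x : V ⊗[ℂ] A) :
    (oneTensor A B ∘ₗ f ◇ tensorOne A B) x = TensorProduct.comm ℂ B A (f.rTensor A x) := by
  rw [← mulPair_rTensor, ← mulPair_comm, pos2_mulPair]

variable (i : A →ₗ[ℂ] R) (j : C →ₗ[ℂ] R) (b : B →ₗ[ℂ] R) (γ : V →ₗ[ℂ] B)

theorem mulPair_comp_tensorOne [Unital b] : (i ◇ b) ∘ₗ tensorOne A B = i := by
  ext a; simp [Unital.map_one]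

theorem mulPair_comp_oneTensor [Unital i] : (i ◇ b) ∘ₗ oneTensor A B = b := by
  ext a; simp [Unital.map_one]

theorem mulPair_lTensor_lTensor (x : A ⊗[ℂ] (C ⊗[ℂ] V)) :
    (i ◇ j ◇ b) (LinearMap.lTensor A (LinearMap.lTensor C γ) x) = (i ◇ j ◇ b ∘ₗ γ) x := by
  rw [← LinearMap.comp_id (i ◇ j ◇ b), LinearMap.comp_id, mulPair_lTensor]
  congr 2
  exact LinearMap.ext (mulPair_lTensor γ j b)

theorem mulPair_lTensor_comm [Comm j b] (x : A ⊗[ℂ] (V ⊗[ℂ] C)) :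
    (i ◇ j ◇ b) (LinearMap.lTensor A (LinearMap.lTensor C γ)
      (LinearMap.lTensor A (TensorProduct.comm ℂ V C).toLinearMap x)) = (i ◇ b ∘ₗ γ ◇ j) x := by
  rw [mulPair_lTensor_lTensor, mulPair_lTensor]
  congr 2
  exact LinearMap.ext fun y => mulPair_comm (b ∘ₗ γ) j y

/-- Leg permutations such as `φ_ρ^{312}` disappear under evaluation, because the legs commute with
one another in `R`. -/
theorem mulPair_assoc_comm [Comm i b] [Comm j b] (x : V ⊗[ℂ] (A ⊗[ℂ] C)) :
    (i ◇ j ◇ b) (LinearMap.lTensor A (LinearMap.lTensor C γ)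
      (TensorProduct.assoc ℂ A C V (TensorProduct.comm ℂ V (A ⊗[ℂ] C) x)))
        = (b ∘ₗ γ ◇ i ◇ j) x := by
  rw [mulPair_lTensor_lTensor, mulPair_assoc, mulPair_comm]

theorem mulPair_lTensor_mk [Comm j b] (x : A ⊗[ℂ] B) :
    (i ◇ j ◇ b) (LinearMap.lTensor A (TensorProduct.mk ℂ C B 1) x) = (i ◇ b) x * j 1 := by
  induction x with
  | zero => simp
  | add x y hx hy => simp only [map_add, add_mul, hx, hy]
  | tmul a c =>
    simp only [LinearMap.lTensor_tmul, TensorProduct.mk_apply, mulPair_tmul, mul_assoc]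
    rw [(Comm.commute (f := j) (g := b) 1 c).eq]

end Transport

variable {G : Type u} [Ring G] [Algebra ℂ G] {M : Type v} [Ring M] [Algebra ℂ M]
  {B : Type*} [Ring B] [Algebra ℂ B] {R : Type w} [Ring R] [Algebra ℂ R]

section Fuse

variable {H : WeakQuasiBialgebra G} (Q : QuasiCommutingPair H M)

local notation "lam" => (Q.left.lam : M →ₗ[ℂ] G ⊗[ℂ] M)
local notation "ρ" => (Q.right.rho : M →ₗ[ℂ] M ⊗[ℂ] G)

/-- `T¹³ (φ_{λρ}¹³²)⁻¹ t²³`. -/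
def fuse (γ : M →ₗ[ℂ] B) (T t : G ⊗[ℂ] B) : G ⊗[ℂ] (G ⊗[ℂ] B) :=
  LinearMap.lTensor G (TensorProduct.mk ℂ G B 1) T
    * LinearMap.lTensor G (LinearMap.lTensor G γ)
      (LinearMap.lTensor G (TensorProduct.comm ℂ M G).toLinearMap Q.φInv)
    * ((1 : G) ⊗ₜ[ℂ] t)

variable (i j : G →ₗ[ℂ] R) (b : B →ₗ[ℂ] R) [IsMul i] [IsMul j] [IsMul b] [Comm i j] [Comm i b]
  [Comm j b] (γ γ' : M →ₗ[ℂ] B) [IsMul γ]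

theorem mulPair_fuse (T t : G ⊗[ℂ] B) : (i ◇ j ◇ b) (fuse Q γ T t)
    = (i ◇ b) T * (i ◇ b ∘ₗ γ ◇ j) Q.φInv * (j ◇ b) t := by
  rw [fuse, IsMul.map_mul, IsMul.map_mul, mulPair_lTensor_mk, mulPair_lTensor_comm,
    mulPair_one_tmul]
  have h1 : j 1 * (i ◇ b ∘ₗ γ ◇ j) Q.φInv = (i ◇ b ∘ₗ γ ◇ j) Q.φInv := by
    have h := (Q.reassoc i j (b ∘ₗ γ)).one_mul_inv
    rw [← h, ← mul_assoc, leg_apply, snd_one_mul_mulPair]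
  rw [mul_assoc _ (j 1), h1, mul_assoc _ _ (i 1 * _), ← mul_assoc _ (i 1),
    mulPair_mul_fst_one, mul_assoc]

/-- `T λ_γ(m) = ρ_γ'(m) T`. -/
def Intertwines (γ γ' : M →ₗ[ℂ] B) (T : G ⊗[ℂ] B) : Prop :=
  ∀ m, T * γ.lTensor G (Q.left.lam m)
    = TensorProduct.comm ℂ B G (γ'.rTensor G (Q.right.rho m)) * T

variable {Q}

theorem Intertwines.mulPair {γ γ' : M →ₗ[ℂ] B} {T : G ⊗[ℂ] B}
    (h : Intertwines Q γ γ' T) (m : M) :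
    (i ◇ b) T * leg lam i (b ∘ₗ γ) m = leg ρ (b ∘ₗ γ') i m * (i ◇ b) T := by
  have := congrArg (i ◇ b) (h m)
  rwa [IsMul.map_mul, IsMul.map_mul, mulPair_lTensor, mulPair_comm, mulPair_rTensor] at this

theorem intertwines_iff {γ γ' : M →ₗ[ℂ] B} {T : G ⊗[ℂ] B} :
    Intertwines Q γ γ' T ↔ ∀ m, T * leg lam (tensorOne G B) (oneTensor G B ∘ₗ γ) m
      = leg ρ (oneTensor G B ∘ₗ γ') (tensorOne G B) m * T := by
  simp only [leg_apply, mulPair_eq_lTensor, mulPair_eq_comm_rTensor]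
  rfl

end Fuse

section Map
variable {R' : Type*} [Ring R'] [Algebra ℂ R'] (H : WeakQuasiHopfAlgebra G)

theorem map_rightAct {C : Type*} [Ring C] [Algebra ℂ C] (π : R →ₗ[ℂ] R') [IsMul π]
    (j : G →ₗ[ℂ] R) (r : C →ₗ[ℂ] R) (Z : R) (w : C ⊗[ℂ] G) :
    π (rightAct H j r Z w) = rightAct H (π ∘ₗ j) (π ∘ₗ r) (π Z) w := by
  induction w with
  | zero => simp
  | add x y hx hy => simp only [map_add, hx, hy]
  | tmul c a => simp [IsMul.map_mul]

theorem comp_leg {A C V : Type*} [AddCommGroup A] [Module ℂ A] [AddCommGroup C] [Module ℂ C]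
    [AddCommGroup V] [Module ℂ V] (π : R →ₗ[ℂ] R') [IsMul π] (u : V →ₗ[ℂ] A ⊗[ℂ] C)
    (f : A →ₗ[ℂ] R) (g : C →ₗ[ℂ] R) : π ∘ₗ leg u f g = leg u (π ∘ₗ f) (π ∘ₗ g) :=
  LinearMap.ext fun x => mulPair_comp π IsMul.map_mul f g (u x)

end Map

end


/-! ### The action of `M` and the intertwiner determined by `L` -/

section

variable {G : Type u} [Ring G] [Algebra ℂ G] {M : Type v} [Ring M] [Algebra ℂ M]
  {B : Type*} [Ring B] [Algebra ℂ B] {R : Type w} [Ring R] [Algebra ℂ R]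

section Classify

theorem rightAct_mul_of_forall {C : Type*} [Ring C] [Algebra ℂ C] (H : WeakQuasiHopfAlgebra G)
    (j : G →ₗ[ℂ] R) (r : C →ₗ[ℂ] R) {x : R} (hr : ∀ c, r c * x = r c) (Z : R) (w : C ⊗[ℂ] G) :
    rightAct H j r Z w * x = rightAct H j r Z w := by
  induction w with
  | zero => simp
  | add x y hx hy => simp only [map_add, add_mul, hx, hy]
  | tmul c a => rw [rightAct_tmul, mul_assoc, mul_assoc, hr]

variable (H : WeakQuasiHopfAlgebra G) (Q : QuasiCommutingPair H.toWeakQuasiBialgebra M)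
  (γ : M →ₗ[ℂ] B) (L : G ⊗[ℂ] B) (hat : G ⊗[ℂ] B →ₗ[ℂ] B)

local notation "Δ" => (H.Δ : G →ₗ[ℂ] G ⊗[ℂ] G)
local notation "lam" => (Q.left.lam : M →ₗ[ℂ] G ⊗[ℂ] M)
local notation "ρ" => (Q.right.rho : M →ₗ[ℂ] M ⊗[ℂ] G)
local notation "p₁" => tensorOne G B
local notation "p₂" => oneTensor G B
local notation "q₁" => tensorOne G (G ⊗[ℂ] B)
local notation "q₂" => oneTensor G (G ⊗[ℂ] B) ∘ₗ tensorOne G B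
local notation "q₃" => oneTensor G (G ⊗[ℂ] B) ∘ₗ oneTensor G B

/-- The map `w ↦ hat (L ◁ w)` on `M ⊗ G`. -/
def hatAct : M ⊗[ℂ] G →ₗ[ℂ] B := hat ∘ₗ rightAct H p₁ (leg lam p₁ (p₂ ∘ₗ γ)) L

/-- The map `m ↦ hat (L ◁ ρ(m))`. -/
def hatLeft : M →ₗ[ℂ] B := hatAct H Q γ L hat ∘ₗ ρ

/-- `L ◁ p_ρ`. -/
def baseElt : G ⊗[ℂ] B := rightAct H p₁ (leg lam p₁ (p₂ ∘ₗ γ)) L (Q.right.pElt H)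

/-- `φ_ρ⁻¹ (Δ ⊗ id)(t) φ_λ⁻¹` for `t = L ◁ p_ρ`. -/
def fusedElt (i j : G →ₗ[ℂ] R) (b : B →ₗ[ℂ] R) : R :=
  (b ∘ₗ hatLeft H Q γ L hat ◇ i ◇ j) Q.right.φInv * (leg Δ i j ◇ b) (baseElt H Q γ L)
    * (i ◇ j ◇ b ∘ₗ γ) Q.left.φInv

/-- The product `T¹³ L²³` for the intertwiner `T = hatElt`. -/
def hatProd : G ⊗[ℂ] (G ⊗[ℂ] B) :=
  rightAct₃ H q₂ q₁ (leg lam q₂ (q₃ ∘ₗ γ))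
    ((leg ρ (q₃ ∘ₗ hatLeft H Q γ L hat) q₁ ◇ q₂) (Q.right.qElt H)
      * fusedElt H Q γ L hat q₁ q₂ q₃) Q.φInv

/-- The intertwiner classified by `L`. -/
def hatElt : G ⊗[ℂ] B := hat.lTensor G (hatProd H Q γ L hat)

variable {H Q γ L hat} [IsMul γ] (i j : G →ₗ[ℂ] R) (b : B →ₗ[ℂ] R) [IsMul i] [IsMul j] [Comm i j]
  [IsMul b] [Unital b] [Comm i b] [Comm j b]

theorem mulPair_rightAct [Unital i] (w : M ⊗[ℂ] G) :
    (i ◇ b) (rightAct H p₁ (leg lam p₁ (p₂ ∘ₗ γ)) L w)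
      = rightAct H i (leg lam i (b ∘ₗ γ)) ((i ◇ b) L) w := by
  rw [map_rightAct, comp_leg, mulPair_comp_tensorOne, ← LinearMap.comp_assoc,
    mulPair_comp_oneTensor]

theorem mulPair_baseElt [Unital i] : (i ◇ b) (baseElt H Q γ L)
      = rightAct H i (leg lam i (b ∘ₗ γ)) ((i ◇ b) L) (Q.right.pElt H) :=
  mulPair_rightAct i b _

theorem mulPair_baseElt_mul_one : (i ◇ b) (baseElt H Q γ L) * leg lam i (b ∘ₗ γ) 1
    = (i ◇ b) (baseElt H Q γ L) := by
  have : baseElt H Q γ L * leg lam p₁ (p₂ ∘ₗ γ) 1 = baseElt H Q γ L :=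
    rightAct_pElt_mul_one H Q.right p₁ _ L
  rw [leg_apply, mulPair_eq_lTensor] at this
  have := congrArg (i ◇ b) this
  rwa [IsMul.map_mul, mulPair_lTensor] at this

variable (h : Hat (oneTensor G B) hat L (γ 1))
include h

theorem Hat.hatAct_mul (w : M ⊗[ℂ] G) :
    p₂ (hatAct H Q γ L hat w) * L = rightAct H p₁ (leg lam p₁ (p₂ ∘ₗ γ)) L w := by
  rw [hatAct, LinearMap.comp_apply, h.hat_mul]
  refine rightAct_mul_of_forall H _ _ (fun c => ?_) _ _
  rw [leg_apply]
  exact mulPair_mul_snd_one p₁ (p₂ ∘ₗ γ) _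

/-- Move the first factor inside `hat` by left linearity; there it multiplies `L`, giving `L ◁ w`,
and the action law for `◁` finishes. Composed with `ρ` this gives the multiplicative map `hatLeft`.
-/
theorem Hat.isMul_hatAct : IsMul (hatAct H Q γ L hat) := by
  constructor
  intro w w'
  conv_rhs => rw [hatAct, LinearMap.comp_apply, LinearMap.comp_apply, h.mul_hat]
  have := h.hatAct_mul (H := H) (Q := Q) w
  rw [hatAct, LinearMap.comp_apply] at this
  rw [mul_rightAct _ _ _ (fun a => Comm.commute (f := p₁) (g := p₂) a _), this,
    rightAct_rightAct]
  rfl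

theorem Hat.isMul_hatLeft : IsMul (hatLeft H Q γ L hat) :=
  have := h.isMul_hatAct (H := H) (Q := Q)
  inferInstanceAs (IsMul (hatAct H Q γ L hat ∘ₗ ρ))

theorem Hat.hatLeft_mul [Unital i] (m : M) : b (hatLeft H Q γ L hat m) * (i ◇ b) L
      = rightAct H i (leg lam i (b ∘ₗ γ)) ((i ◇ b) L) (Q.right.rho m) := by
  rw [← mulPair_rightAct, ← linearMap_apply, ← h.hatAct_mul, IsMul.map_mul,
    oneTensor_apply, mulPair_tmul, Unital.map_one, one_mul]
  rfl

/-- `hatLeft` was defined so that `hatLeft(m) L = L ◁ ρ(m)`. Hence `t = L ◁ p_ρ` intertwines, from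
the original `γ` to the new action `hatLeft`. -/
theorem Hat.intertwines_baseElt :
    Intertwines Q γ (hatLeft H Q γ L hat) (baseElt H Q γ L) := by
  have := h.isMul_hatLeft (H := H) (Q := Q)
  rw [intertwines_iff]
  refine rightAct_pElt_mul H Q.right p₁ (p₂ ∘ₗ hatLeft H Q γ L hat) _ fun m => ?_
  have := h.hatLeft_mul (H := H) (Q := Q) p₁ p₂ m
  rwa [pos2_mulPair] at this

theorem Hat.one_mul_mulPair_baseElt :
    leg ρ (b ∘ₗ hatLeft H Q γ L hat) i 1 * (i ◇ b) (baseElt H Q γ L)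
      = (i ◇ b) (baseElt H Q γ L) := by
  rw [← h.intertwines_baseElt.mulPair i b, mulPair_baseElt_mul_one]

/-- Three intertwiners in a row: `φ_λ⁻¹`, then `t` with the coproduct in its first leg, then
`φ_ρ⁻¹`. This is what allows `q_ρ` to be applied to the fused element in `hatProd`. -/
theorem Hat.fusedElt_mul (m : M) :
    fusedElt H Q γ L hat i j b * leg lam i (leg lam j (b ∘ₗ γ)) m
      = leg ρ (leg ρ (b ∘ₗ hatLeft H Q γ L hat) i) j m * fusedElt H Q γ L hat i j b := by
  have := h.isMul_hatLeft (H := H) (Q := Q)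
  rw [fusedElt, mul_assoc, ← (Q.left.reassoc i j (b ∘ₗ γ)).inv_comm m, ← mul_assoc, mul_assoc _ _ (leg _ _ _ m),
    h.intertwines_baseElt.mulPair (leg Δ i j) b m, ← mul_assoc, ← mul_assoc, ← mul_assoc,
    (Q.right.reassoc i j (b ∘ₗ hatLeft H Q γ L hat)).inv_comm m]

theorem Hat.one_mul_fusedElt :
    leg ρ (leg ρ (b ∘ₗ hatLeft H Q γ L hat) i) j 1 * fusedElt H Q γ L hat i j b
      = fusedElt H Q γ L hat i j b := by
  have := h.isMul_hatLeft (H := H) (Q := Q)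
  rw [fusedElt, ← mul_assoc, ← mul_assoc, 
    (Q.right.reassoc i j (b ∘ₗ hatLeft H Q γ L hat)).one_mul_inv]

/-- `hat` divides by `L` up to `γ 1`, and `hatProd` absorbs `γ 1` because the acting algebra enters
from the right through `γ`. -/
theorem Hat.hatElt_mul : (q₁ ◇ q₃) (hatElt H Q γ L hat) * (q₂ ◇ q₃) L = hatProd H Q γ L hat := by
  have h1 := (h.lTensor G).hat_mul (hatProd H Q γ L hat)
  have h2 : ∀ x : G ⊗[ℂ] B, (q₁ ◇ q₃) x = (oneTensor G B).lTensor G x := fun x => by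
    rw [mulPair_eq_lTensor]
  have h3 : (q₂ ◇ q₃) L = 1 ⊗ₜ L := by
    rw [← mulPair_comp _ IsMul.map_mul, pos2_mulPair]; rfl
  rw [h2, h3]
  refine h1.trans ?_
  refine rightAct_mul_of_forall H _ _ (fun c => ?_) _ _
  induction c with
  | zero => simp
  | add x y hx hy => simp only [add_mul, map_add, hx, hy]
  | tmul a m =>
    rw [mulPair_tmul, leg_apply, mul_assoc]
    congr 1
    exact mulPair_mul_snd_one q₂ (q₃ ∘ₗ γ) _

end Classify

end


/-! ### Fusing the constructed intertwiner with `t` -/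

section

variable {G : Type u} [Ring G] [Algebra ℂ G] {M : Type v} [Ring M] [Algebra ℂ M]
  {B : Type*} [Ring B] [Algebra ℂ B] {R : Type w} [Ring R] [Algebra ℂ R]

section Classify

variable {H : WeakQuasiHopfAlgebra G} {Q : QuasiCommutingPair H.toWeakQuasiBialgebra M}
  {γ : M →ₗ[ℂ] B} {L : G ⊗[ℂ] B} {hat : G ⊗[ℂ] B →ₗ[ℂ] B}

local notation "Δ" => (H.Δ : G →ₗ[ℂ] G ⊗[ℂ] G)
local notation "lam" => (Q.left.lam : M →ₗ[ℂ] G ⊗[ℂ] M)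
local notation "ρ" => (Q.right.rho : M →ₗ[ℂ] M ⊗[ℂ] G)
local notation "p₁" => tensorOne G B
local notation "p₂" => oneTensor G B
local notation "q₁" => tensorOne G (G ⊗[ℂ] B)
local notation "q₂" => oneTensor G (G ⊗[ℂ] B) ∘ₗ tensorOne G B
local notation "q₃" => oneTensor G (G ⊗[ℂ] B) ∘ₗ oneTensor G B

variable (Q) in
theorem QuasiCommutingPair.reassoc_id : Reassoc (splitFst G lam ∘ₗ ρ) (LinearMap.lTensor G ρ ∘ₗ lam)
    Q.φ Q.φInv := by
  have h := Q.reassoc (tensorOne G (M ⊗[ℂ] G)) (oneTensor G (M ⊗[ℂ] G) ∘ₗ oneTensor M G)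
    (oneTensor G (M ⊗[ℂ] G) ∘ₗ tensorOne M G)
  rw [pos3_mulPair, pos3_mulPair] at h
  convert h using 1
  · ext m
    rw [leg_apply, ← mulPair_splitFst, pos3_mulPair]; rfl
  · ext m
    rw [leg_apply, leg, ← mulPair_lTensor, pos3_mulPair]; rfl

variable (i j : G →ₗ[ℂ] R) (b : B →ₗ[ℂ] R) [IsMul i] [IsMul j] [Comm i j] [IsMul b]
  [Comm i b] [Comm j b]

theorem mulPair_fusedElt : (i ◇ j ◇ b) (fusedElt H Q γ L hat q₁ q₂ q₃)
    = fusedElt H Q γ L hat i j b := by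
  have h1 : fusedElt H Q γ L hat q₁ q₂ q₃
      = LinearMap.lTensor G (LinearMap.lTensor G (hatLeft H Q γ L hat))
        (TensorProduct.assoc ℂ G G M (TensorProduct.comm ℂ M (G ⊗[ℂ] G) Q.right.φInv))
      * splitFst B Δ (baseElt H Q γ L)
      * LinearMap.lTensor G (LinearMap.lTensor G γ) Q.left.φInv := by
    rw [fusedElt, ← mulPair_assoc_comm q₁ q₂ q₃, ← mulPair_splitFst,
      ← mulPair_lTensor_lTensor q₁ q₂ q₃,
      pos3_mulPair, pos3_mulPair, pos3_mulPair]
  rw [h1, IsMul.map_mul, IsMul.map_mul, mulPair_assoc_comm, mulPair_splitFst,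
    mulPair_lTensor_lTensor, fusedElt]

variable [IsMul γ] (h : Hat (oneTensor G B) hat L (γ 1))
include h

theorem Hat.hatProd_eq : hatProd H Q γ L hat
    = rightAct₃ H q₂ q₁ (leg lam q₂ (q₃ ∘ₗ γ))
    ((leg ρ (q₃ ∘ₗ hatLeft H Q γ L hat) q₁ ◇ q₂) (Q.right.qElt H)
      * fusedElt H Q γ L hat q₁ q₂ q₃) Q.φInv := rfl

/-- The product of `T` with `L` is the `φ_{λρ}⁻¹`-twist of `q_ρ` times the fused element. By
`composite_of_eq` the composite with `t` is that element acted on by `p_ρ`, and `p_ρ` undoes `q_ρ`.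
-/
theorem Hat.fuse_hatElt : fuse Q (hatLeft H Q γ L hat) (hatElt H Q γ L hat) (baseElt H Q γ L)
    = fusedElt H Q γ L hat q₁ q₂ q₃ := by
  have := h.isMul_hatLeft (H := H) (Q := Q)
  rw [← pos3_mulPair (fuse _ _ _ _), mulPair_fuse, mulPair_baseElt,
    composite_of_eq H Q q₂ q₁ (q₃ ∘ₗ hatLeft H Q γ L hat) (leg lam q₂ (q₃ ∘ₗ γ))
      (h.hatLeft_mul q₂ q₃) (fun a => Comm.commute (f := q₁) (g := q₂ ◇ q₃) a L)
      (fun a => Comm.commute (f := q₂) (g := q₁ ◇ q₃) a _) h.hatElt_mul]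
  exact rightAct_qElt_mul_pElt H Q.right q₂ (leg ρ (q₃ ∘ₗ hatLeft H Q γ L hat) q₁) _
    (h.fusedElt_mul q₁ q₂ q₃) (h.one_mul_fusedElt q₁ q₂ q₃)

theorem Hat.mulPair_fuse_hatElt :
    (i ◇ b) (hatElt H Q γ L hat) * (i ◇ b ∘ₗ hatLeft H Q γ L hat ◇ j) Q.φInv
      * (j ◇ b) (baseElt H Q γ L) = fusedElt H Q γ L hat i j b := by
  have := h.isMul_hatLeft (H := H) (Q := Q)
  rw [← mulPair_fuse, h.fuse_hatElt, mulPair_fusedElt]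

theorem Hat.hatLeft_mul_hat (m : M) :
    hatLeft H Q γ L hat m * hat L = hatLeft H Q γ L hat m := by
  refine h.hat_mul_hat (rightAct_mul_of_forall H _ _ (fun c => ?_) _ _)
  rw [leg_apply]
  exact mulPair_mul_snd_one p₁ (p₂ ∘ₗ γ) _

theorem Hat.hatElt_mul_hat :
    hatElt H Q γ L hat * p₂ (hat L) = hatElt H Q γ L hat := by
  have h1 := (h.lTensor G).hat_mul (hatProd H Q γ L hat)
  have h2 := h.hatElt_mul (H := H) (Q := Q)
  rw [mulPair_eq_lTensor, ← mulPair_comp _ IsMul.map_mul, pos2_mulPair] at h2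
  refine (h.lTensor G).hat_mul_hat (h1.symm.trans h2)

/-- The right side is shared with `leg_mul_hatElt`: after multiplication by `L`, the two sides of
the intertwining relation both become an action of `(id ⊗ ρ)(λ(m))` on `hatProd`. -/
theorem Hat.hatElt_mul_leg (m : M) :
    (q₁ ◇ q₃) (hatElt H Q γ L hat) * leg lam q₁ (q₃ ∘ₗ hatLeft H Q γ L hat) m * (q₂ ◇ q₃) L
      = rightAct₃ H q₂ q₁ (leg lam q₂ (q₃ ∘ₗ γ)) (hatProd H Q γ L hat)
        (LinearMap.lTensor G ρ (Q.left.lam m)) := by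
  have h1 : ∀ y, rightAct₃ H q₂ q₁ (leg lam q₂ (q₃ ∘ₗ γ)) ((q₂ ◇ q₃) L) (LinearMap.lTensor G ρ y)
      = (q₁ ◇ q₃ ∘ₗ hatLeft H Q γ L hat) y * (q₂ ◇ q₃) L := by
    intro y
    induction y with
    | zero => simp
    | add x y hx hy => simp only [add_mul, map_add, hx, hy]
    | tmul a m =>
      rw [LinearMap.lTensor_tmul, linearMap_apply, ← mul_rightAct_eq_rightAct₃ H q₂ q₁ _
        (fun a => Comm.commute (f := q₁) (g := q₂ ◇ q₃) a L), ← h.hatLeft_mul q₂ q₃, 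
        mulPair_tmul, mul_assoc]
      rfl
  rw [mul_assoc, leg_apply, ← h1, mul_rightAct₃ _ _ _ _
    (fun a => Comm.commute (f := q₂) (g := q₁ ◇ q₃) a _), h.hatElt_mul]
  rfl

/-- Here `φ_{λρ}⁻¹` exchanges `(id ⊗ ρ)λ` with `(λ ⊗ id)ρ`; the module relation for `q_ρ` times the
fused element then produces `ρ(m)` on the left. -/
theorem Hat.leg_mul_hatElt (m : M) :
    leg ρ (q₃ ∘ₗ hatLeft H Q γ L hat) q₁ m * (q₁ ◇ q₃) (hatElt H Q γ L hat) * (q₂ ◇ q₃) L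
      = rightAct₃ H q₂ q₁ (leg lam q₂ (q₃ ∘ₗ γ)) (hatProd H Q γ L hat)
        (LinearMap.lTensor G ρ (Q.left.lam m)) := by
  have := h.isMul_hatLeft (H := H) (Q := Q)
  have h1 := Q.reassoc_id.inv_comm m
  simp only [LinearMap.comp_apply, linearMap_apply] at h1
  rw [mul_assoc, h.hatElt_mul, h.hatProd_eq, rightAct₃_rightAct₃, ← h1,
    ← rightAct₃_rightAct₃, rightAct₃_splitFst, mul_rightAct₃ _ _ _ _
    (fun a => Comm.commute (f := q₂) (g := leg ρ (q₃ ∘ₗ hatLeft H Q γ L hat) q₁) a m)]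
  refine congrArg (fun Z => rightAct₃ H q₂ q₁ (leg lam q₂ (q₃ ∘ₗ γ)) Z Q.φInv) ?_
  exact mul_qElt_mul H Q.right q₂ _ _ (h.fusedElt_mul q₁ q₂ q₃) m

end Classify

end


/-! ### The intertwining relation, and coherence composed with `t` -/

section

variable {G : Type u} [Ring G] [Algebra ℂ G] {M : Type v} [Ring M] [Algebra ℂ M]
  {B : Type*} [Ring B] [Algebra ℂ B] {R : Type w} [Ring R] [Algebra ℂ R]

section Chain

variable {S : Type*} [Ring S]

/-- Associativity of fusion, abstracted to a ring. Rebracketing by the left pentagon lets `Tj` fuse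
with `tk` first and `Ti` with the result, which leaves `t` with `(id ⊗ Δ)Δ` in its first leg. The
reassociator of `G` changes this to `(Δ ⊗ id)Δ`, so the pair `Ti`, `Tj` fuses with `tk` as one
intertwiner would through `Δ`. -/
theorem coherence_chain {φρ Ti φi φlam φΔ tk φl2 φjk φr φi2 Tj ρjk tΔ lamjk lamk ρlam φiΔ ρρ ρiΔ tΔΔ
    lamiΔ ρΔk φH φHInv lamΔk tΔk : S}
    (e1 : φlam * φΔ = φl2 * φjk * φr) (e2 : φr * tk = tk * lamk)
    (e3 : Tj * φl2 = φi2 * Tj) (e4 : Tj * φjk * tk = ρjk * tΔ * lamjk)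
    (e5 : φi * φi2 * ρjk = ρlam * φiΔ) (e6 : Ti * ρlam = ρρ * Ti)
    (e7 : Ti * φiΔ * tΔ = ρiΔ * tΔΔ * lamiΔ) (e8 : φρ * ρρ * ρiΔ = ρΔk * φHInv)
    (e9 : lamiΔ * lamjk * lamk = φH * lamΔk) (e10 : φHInv * tΔΔ * φH = tΔk) :
    φρ * (Ti * φi * Tj) * φlam * φΔ * tk = ρΔk * tΔk * lamΔk := by
  calc φρ * (Ti * φi * Tj) * φlam * φΔ * tk
      = φρ * Ti * φi * Tj * (φlam * φΔ) * tk := by simp only [mul_assoc]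
    _ = φρ * Ti * φi * (Tj * φl2) * φjk * (φr * tk) := by rw [e1]; simp only [mul_assoc]
    _ = φρ * Ti * φi * φi2 * (Tj * φjk * tk) * lamk := by rw [e2, e3]; simp only [mul_assoc]
    _ = φρ * Ti * (φi * φi2 * ρjk) * tΔ * lamjk * lamk := by rw [e4]; simp only [mul_assoc]
    _ = φρ * (Ti * ρlam) * φiΔ * tΔ * lamjk * lamk := by rw [e5]; simp only [mul_assoc]
    _ = φρ * ρρ * (Ti * φiΔ * tΔ) * lamjk * lamk := by rw [e6]; simp only [mul_assoc]
    _ = (φρ * ρρ * ρiΔ) * tΔΔ * (lamiΔ * lamjk * lamk) := by rw [e7]; simp only [mul_assoc]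
    _ = ρΔk * (φHInv * tΔΔ * φH) * lamΔk := by rw [e8, e9]; simp only [mul_assoc]
    _ = ρΔk * tΔk * lamΔk := by rw [e10]

end Chain

section Classify

variable {H : WeakQuasiHopfAlgebra G} {Q : QuasiCommutingPair H.toWeakQuasiBialgebra M}
  {γ : M →ₗ[ℂ] B} {L : G ⊗[ℂ] B} {hat : G ⊗[ℂ] B →ₗ[ℂ] B}

local notation "Δ" => (H.Δ : G →ₗ[ℂ] G ⊗[ℂ] G)
local notation "lam" => (Q.left.lam : M →ₗ[ℂ] G ⊗[ℂ] M)
local notation "ρ" => (Q.right.rho : M →ₗ[ℂ] M ⊗[ℂ] G)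
local notation "p₁" => tensorOne G B
local notation "p₂" => oneTensor G B
local notation "q₁" => tensorOne G (G ⊗[ℂ] B)
local notation "q₂" => oneTensor G (G ⊗[ℂ] B) ∘ₗ tensorOne G B
local notation "q₃" => oneTensor G (G ⊗[ℂ] B) ∘ₗ oneTensor G B
local notation "s₁" => pos₁ G G G B
local notation "s₂" => pos₂ G G G B
local notation "s₃" => pos₃ G G G B
local notation "s₄" => pos₄ G G G B

theorem mulPair_mul_of_forall {V W : Type*} [AddCommGroup V] [Module ℂ V] [AddCommGroup W]
    [Module ℂ W] (f : V →ₗ[ℂ] R) {g : W →ₗ[ℂ] R} {x : R} (hg : ∀ c, g c * x = g c)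
    (y : V ⊗[ℂ] W) : (f ◇ g) y * x = (f ◇ g) y := by
  induction y with
  | zero => simp
  | add y z hy hz => simp only [map_add, add_mul, hy, hz]
  | tmul a c => rw [mulPair_tmul, mul_assoc, hg]

variable [IsMul γ] (h : Hat (oneTensor G B) hat L (γ 1))
include h

theorem Hat.eq_of_mul₂ {X X' : G ⊗[ℂ] B} (hX : X * p₂ (hat L) = X) (hX' : X' * p₂ (hat L) = X')
    (he : (q₁ ◇ q₃) X * (q₂ ◇ q₃) L = (q₁ ◇ q₃) X' * (q₂ ◇ q₃) L) : X = X' := by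
  simp only [mulPair_eq_lTensor] at he
  rw [← mulPair_comp _ IsMul.map_mul, pos2_mulPair] at he
  exact (h.lTensor G).eq_of_mul hX hX' he

/-- `L` is put into a fresh third copy of `G`, so that the two existing copies are untouched and the
division by `L` takes place in the factor `B` only. -/
theorem Hat.eq_of_mul₃ {X X' : G ⊗[ℂ] (G ⊗[ℂ] B)} (hX : X * q₃ (hat L) = X)
    (hX' : X' * q₃ (hat L) = X')
    (he : (s₁ ◇ s₂ ◇ s₄) X * (s₃ ◇ s₄) L = (s₁ ◇ s₂ ◇ s₄) X' * (s₃ ◇ s₄) L) : X = X' := by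
  have h1 : ∀ x, (s₁ ◇ s₂ ◇ s₄) x
      = LinearMap.lTensor G (LinearMap.lTensor G (oneTensor G B)) x := fun x => by
    rw [← pos_mulPair G G G B (LinearMap.lTensor G _ x), mulPair_lTensor_lTensor,
      mulPair_comp_oneTensor]
  have h2 := mulPair_comp (oneTensor G (G ⊗[ℂ] (G ⊗[ℂ] B)) ∘ₗ oneTensor G (G ⊗[ℂ] B))
    IsMul.map_mul p₁ p₂ L
  rw [pos2_mulPair] at h2
  rw [h1, h1] at he
  change _ * ((oneTensor G (G ⊗[ℂ] (G ⊗[ℂ] B)) ∘ₗ oneTensor G (G ⊗[ℂ] B)) ∘ₗ p₁ ◇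
    (oneTensor G (G ⊗[ℂ] (G ⊗[ℂ] B)) ∘ₗ oneTensor G (G ⊗[ℂ] B)) ∘ₗ p₂) L = _ *
    ((oneTensor G (G ⊗[ℂ] (G ⊗[ℂ] B)) ∘ₗ oneTensor G (G ⊗[ℂ] B)) ∘ₗ p₁ ◇
    (oneTensor G (G ⊗[ℂ] (G ⊗[ℂ] B)) ∘ₗ oneTensor G (G ⊗[ℂ] B)) ∘ₗ p₂) L at he
  rw [← h2] at he
  exact ((h.lTensor G).lTensor G).eq_of_mul hX hX' he

theorem Hat.lTensor_hatLeft_mul (y : G ⊗[ℂ] M) :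
    LinearMap.lTensor G (hatLeft H Q γ L hat) y * p₂ (hat L)
      = LinearMap.lTensor G (hatLeft H Q γ L hat) y := by
  rw [← mulPair_eq_lTensor]
  refine mulPair_mul_of_forall _ (fun c => ?_) _
  rw [LinearMap.comp_apply, ← IsMul.map_mul, h.hatLeft_mul_hat]

/-- Both sides absorb `hat L`, so it suffices to multiply by `L`, where they agree by
`hatElt_mul_leg` and `leg_mul_hatElt`. -/
theorem Hat.intertwines_hatElt :
    Intertwines Q (hatLeft H Q γ L hat) (hatLeft H Q γ L hat) (hatElt H Q γ L hat) := by
  intro m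
  refine h.eq_of_mul₂ ?_ ?_ ?_
  · rw [mul_assoc, h.lTensor_hatLeft_mul]
  · rw [mul_assoc, h.hatElt_mul_hat]
  · rw [IsMul.map_mul, IsMul.map_mul, mulPair_lTensor, mulPair_comm, mulPair_rTensor]
    exact (h.hatElt_mul_leg m).trans (h.leg_mul_hatElt m).symm

theorem Hat.hatElt_mul_one : hatElt H Q γ L hat
    * LinearMap.lTensor G (hatLeft H Q γ L hat) (Q.left.lam 1) = hatElt H Q γ L hat := by
  refine h.eq_of_mul₂ ?_ h.hatElt_mul_hat ?_
  · rw [mul_assoc, h.lTensor_hatLeft_mul]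
  · rw [IsMul.map_mul, mulPair_lTensor, h.hatElt_mul]
    refine (h.hatElt_mul_leg 1).trans ?_
    have h1 := Q.reassoc_id.inv_mul_one
    simp only [LinearMap.comp_apply, linearMap_apply] at h1
    rw [h.hatProd_eq, rightAct₃_rightAct₃, h1]

theorem Hat.one_mul_hatElt : TensorProduct.comm ℂ B G
    ((hatLeft H Q γ L hat).rTensor G (Q.right.rho 1)) * hatElt H Q γ L hat
      = hatElt H Q γ L hat := by
  rw [← h.intertwines_hatElt, h.hatElt_mul_one]

variable (i j : G →ₗ[ℂ] R) (b : B →ₗ[ℂ] R) [IsMul i] [IsMul j] [Comm i j] [IsMul b]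
  [Comm i b] [Comm j b]

theorem Hat.mulPair_one_mul_hatElt : leg ρ (b ∘ₗ hatLeft H Q γ L hat) i 1
    * (i ◇ b) (hatElt H Q γ L hat) = (i ◇ b) (hatElt H Q γ L hat) := by
  have := congrArg (i ◇ b) (h.one_mul_hatElt (H := H) (Q := Q))
  rwa [IsMul.map_mul, mulPair_comm, mulPair_rTensor] at this

theorem Hat.mulPair_hatElt_mul_one : (i ◇ b) (hatElt H Q γ L hat)
    * leg lam i (b ∘ₗ hatLeft H Q γ L hat) 1 = (i ◇ b) (hatElt H Q γ L hat) := by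
  have := congrArg (i ◇ b) (h.hatElt_mul_one (H := H) (Q := Q))
  rwa [IsMul.map_mul, mulPair_lTensor] at this

/-- The left side is the composite of the coherence expression for `T` with `t`. Each hypothesis of
`coherence_chain` is a solved pentagon, an intertwining relation, or the fusion rule for `T` and
`t`. -/
theorem Hat.coherence (k : G →ₗ[ℂ] R) [IsMul k] [Comm i k] [Comm j k] [Comm k b] [Unital i]
    [Unital k] : (b ∘ₗ hatLeft H Q γ L hat ◇ i ◇ j) Q.right.φ
      * ((i ◇ b) (hatElt H Q γ L hat) * (i ◇ b ∘ₗ hatLeft H Q γ L hat ◇ j) Q.φInv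
        * (j ◇ b) (hatElt H Q γ L hat)) * (i ◇ j ◇ b ∘ₗ hatLeft H Q γ L hat) Q.left.φ
      * (leg Δ i j ◇ b ∘ₗ hatLeft H Q γ L hat ◇ k) Q.φInv * (k ◇ b) (baseElt H Q γ L)
      = fusedElt H Q γ L hat (leg Δ i j) k b := by
  have := h.isMul_hatLeft (H := H) (Q := Q)
  have hc : ∀ x, ∀ y, Commute ((k ◇ b) x) (i y) := fun x y => Comm.commute (f := k ◇ b) (g := i) x y
  have hc' : ∀ x, ∀ y, Commute ((k ◇ b) x) (j y) :=
    fun x y => Comm.commute (f := k ◇ b) (g := j) x y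
  refine coherence_chain (Q.pentagon_left_solve i j k (b ∘ₗ hatLeft H Q γ L hat))
    (mul_mulPair_snd (mul_mulPair_snd (h.intertwines_baseElt.mulPair k b) j (hc' _)) i
      (hc _) _).symm
    (mul_mulPair_snd (mul_mulPair_fst (h.intertwines_hatElt.mulPair j b) k
      (Comm.commute (f := j ◇ b) (g := k) _)) i (Comm.commute (f := j ◇ b) (g := i) _) _)
    (h.mulPair_fuse_hatElt j k b) (Q.pentagon_right_inv i j k _)
    (mul_mulPair_fst (h.intertwines_hatElt.mulPair i b) (j ◇ k)
      (Comm.commute (f := i ◇ b) (g := j ◇ k) _) _)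
    (h.mulPair_fuse_hatElt i (leg Δ j k) b) (Q.right.pentagon_inv i j k _)
    (Q.left.pentagon_inv i j k _) ?_
  -- The last hypothesis of the chain: `φ` conjugates `(id ⊗ Δ)Δ` to `(Δ ⊗ id)Δ` in the first leg of
  -- `t`.
  rw [mul_assoc, ← mul_mulPair_fst (H.reassoc i j k).comm b
    (Comm.commute (f := i ◇ j ◇ k) (g := b) _), ← mul_assoc, (H.reassoc i j k).inv_mul,
    fst_one_mul_mulPair]

end Classify

end


/-! ### Normality and coherence of the constructed intertwiner -/

section

variable {G : Type u} [Ring G] [Algebra ℂ G] {M : Type v} [Ring M] [Algebra ℂ M]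
  {B : Type*} [Ring B] [Algebra ℂ B] {R : Type w} [Ring R] [Algebra ℂ R]

section Counit

variable {H : WeakQuasiBialgebra G} (Q : QuasiCommutingPair H M) (k : G →ₗ[ℂ] R) [IsMul k]
  [Unital k] (g : M →ₗ[ℂ] R) [IsMul g] [Comm k g]

theorem QuasiCommutingPair.mulPair_counit_left_inv :
    (counitLeg H R ◇ g ◇ k) Q.φInv = leg (Q.right.rho : M →ₗ[ℂ] M ⊗[ℂ] G) g k 1 := by
  have h := Q.reassoc (counitLeg H R) k g
  simpa using h.inv_eq_one (by simp [Q.mulPair_counit_left k g])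

theorem QuasiCommutingPair.mulPair_counit_right_inv :
    (k ◇ g ◇ counitLeg H R) Q.φInv = leg (Q.left.lam : M →ₗ[ℂ] G ⊗[ℂ] M) k g 1 := by
  have h := Q.reassoc k (counitLeg H R) g
  simpa using h.inv_eq_one (by simp [Q.mulPair_counit_right k g])

end Counit

section Fuse

variable {H : WeakQuasiBialgebra G} {Q : QuasiCommutingPair H M} {γ γ' : M →ₗ[ℂ] B}
  {T t : G ⊗[ℂ] B} (hT : Intertwines Q γ γ T) [IsMul γ]

local notation "lam" => (Q.left.lam : M →ₗ[ℂ] G ⊗[ℂ] M)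
local notation "ρ" => (Q.right.rho : M →ₗ[ℂ] M ⊗[ℂ] G)
variable (i j : G →ₗ[ℂ] R) (b : B →ₗ[ℂ] R) [IsMul i] [IsMul j] [Comm i j] [IsMul b]
  [Comm i b] [Comm j b]
include hT

theorem Intertwines.mul_leg (m : M) : (i ◇ b) T * leg ρ (leg lam i (b ∘ₗ γ)) j m
    = leg ρ (leg ρ (b ∘ₗ γ) i) j m * (i ◇ b) T :=
  mul_mulPair_fst (hT.mulPair i b) j (Comm.commute (f := i ◇ b) (g := j) _) _

theorem Intertwines.one_mul_fuse (t : G ⊗[ℂ] B) : leg ρ (leg ρ (b ∘ₗ γ) i) j 1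
      * ((i ◇ b) T * (i ◇ b ∘ₗ γ ◇ j) Q.φInv * (j ◇ b) t)
    = (i ◇ b) T * (i ◇ b ∘ₗ γ ◇ j) Q.φInv * (j ◇ b) t := by
  rw [← mul_assoc, ← mul_assoc, ← hT.mul_leg i j b, mul_assoc ((i ◇ b) T),
    (Q.reassoc i j (b ∘ₗ γ)).one_mul_inv]

theorem Intertwines.fuse_mul (ht : Intertwines Q γ' γ t) (m : M) :
    (i ◇ b) T * (i ◇ b ∘ₗ γ ◇ j) Q.φInv * (j ◇ b) t * leg lam i (leg lam j (b ∘ₗ γ')) m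
      = leg ρ (leg ρ (b ∘ₗ γ) i) j m
        * ((i ◇ b) T * (i ◇ b ∘ₗ γ ◇ j) Q.φInv * (j ◇ b) t) := by
  have h1 : (j ◇ b) t * leg lam i (leg lam j (b ∘ₗ γ')) m
      = leg lam i (leg ρ (b ∘ₗ γ) j) m * (j ◇ b) t :=
    mul_mulPair_snd (ht.mulPair j b) i (Comm.commute (f := j ◇ b) (g := i) _) _
  rw [mul_assoc, h1, ← mul_assoc, mul_assoc ((i ◇ b) T), ← (Q.reassoc i j (b ∘ₗ γ)).inv_comm,
    ← mul_assoc, hT.mul_leg]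
  simp only [mul_assoc]

end Fuse

section Classify

variable {H : WeakQuasiHopfAlgebra G} {Q : QuasiCommutingPair H.toWeakQuasiBialgebra M}
  {γ : M →ₗ[ℂ] B} {L : G ⊗[ℂ] B} {hat : G ⊗[ℂ] B →ₗ[ℂ] B}

local notation "Δ" => (H.Δ : G →ₗ[ℂ] G ⊗[ℂ] G)
local notation "lam" => (Q.left.lam : M →ₗ[ℂ] G ⊗[ℂ] M)
local notation "ρ" => (Q.right.rho : M →ₗ[ℂ] M ⊗[ℂ] G)
local notation "p₁" => tensorOne G B
local notation "p₂" => oneTensor G B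
local notation "q₁" => tensorOne G (G ⊗[ℂ] B)
local notation "q₂" => oneTensor G (G ⊗[ℂ] B) ∘ₗ tensorOne G B
local notation "q₃" => oneTensor G (G ⊗[ℂ] B) ∘ₗ oneTensor G B
local notation "s₁" => pos₁ G G G B
local notation "s₂" => pos₂ G G G B
local notation "s₃" => pos₃ G G G B
local notation "s₄" => pos₄ G G G B

variable [IsMul γ] (h : Hat (oneTensor G B) hat L (γ 1))
include h

/-- Intertwiners with equal composites with `baseElt` agree on `L`. -/
theorem Hat.mul_eq_of_composite (k j : G →ₗ[ℂ] R) (b : B →ₗ[ℂ] R) [IsMul k] [IsMul j] [Unital j]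
    [Comm k j] [IsMul b] [Unital b] [Comm k b] [Comm j b] (l : M →ₗ[ℂ] R) [IsMul l] [Comm j l]
    {U U' : R} (hj : ∀ a, Commute (j a) U) (hj' : ∀ a, Commute (j a) U')
    (hU : ∀ m, U * leg lam k (b ∘ₗ hatLeft H Q γ L hat) m = l m * U)
    (hU' : ∀ m, U' * leg lam k (b ∘ₗ hatLeft H Q γ L hat) m = l m * U')
    (h1 : l 1 * U = U) (h1' : l 1 * U' = U')
    (he : U * (k ◇ b ∘ₗ hatLeft H Q γ L hat ◇ j) Q.φInv * (j ◇ b) (baseElt H Q γ L)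
      = U' * (k ◇ b ∘ₗ hatLeft H Q γ L hat ◇ j) Q.φInv * (j ◇ b) (baseElt H Q γ L)) :
    U * (j ◇ b) L = U' * (j ◇ b) L := by
  have := h.isMul_hatLeft (H := H) (Q := Q)
  have hk : ∀ a, Commute (k a) ((j ◇ b) L) := fun a => Comm.commute (f := k) (g := j ◇ b) a L
  rw [mulPair_baseElt] at he
  rw [recover_of_composite H Q j k _ _ (h.hatLeft_mul j b) hk hj hU h1,
    recover_of_composite H Q j k _ _ (h.hatLeft_mul j b) hk hj' hU' h1', he]

/-- With `ε` in the first leg, the fusion rule says that the composite of `(ε ⊗ id)(T)` with `t` is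
`t` itself. The composite of `hatLeft 1` with `t` is `t` as well, and composites determine products
with `L`. -/
theorem Hat.evalFst_hatElt :
    evalFst B H.ε.toLinearMap (hatElt H Q γ L hat) = hatLeft H Q γ L hat 1 := by
  have := h.isMul_hatLeft (H := H) (Q := Q)
  have hc := counitLeg_mulPair H.toWeakQuasiBialgebra (oneTensor G B) (hatElt H Q γ L hat)
  refine h.eq_of_mul ?_ (h.hatLeft_mul_hat 1) ?_
  · have h1 := congrArg (counitLeg H.toWeakQuasiBialgebra B ◇ LinearMap.id)
      (h.hatElt_mul_hat (H := H) (Q := Q))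
    rw [IsMul.map_mul, oneTensor_apply, mulPair_tmul, Unital.map_one, one_mul,
      counitLeg_mulPair] at h1
    exact h1
  · rw [← hc]
    have h2 := Q.mulPair_counit_left_inv p₁ (p₂ ∘ₗ hatLeft H Q γ L hat)
    -- The counit takes the place of the leg `k`; both candidates then intertwine `hatLeft` with
    -- itself.
    have h3 := h.mul_eq_of_composite (H := H) (Q := Q)
      (counitLeg H.toWeakQuasiBialgebra (G ⊗[ℂ] B)) p₁ p₂ (p₂ ∘ₗ hatLeft H Q γ L hat)
      (U := (counitLeg H.toWeakQuasiBialgebra (G ⊗[ℂ] B) ◇ p₂) (hatElt H Q γ L hat))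
      (U' := p₂ (hatLeft H Q γ L hat 1))
      (fun a => by rw [hc]; exact Comm.commute (f := p₁) (g := p₂) a _)
      (fun a => Comm.commute (f := p₁) (g := p₂) a _)
      (fun m => by
        have := h.intertwines_hatElt.mulPair (H := H.toWeakQuasiBialgebra) (Q := Q)
          (counitLeg H.toWeakQuasiBialgebra (G ⊗[ℂ] B)) p₂ m
        rwa [Q.right.leg_counitLeg] at this)
      (fun m => by
        rw [Q.left.leg_counitLeg, LinearMap.comp_apply, ← IsMul.map_mul, ← IsMul.map_mul,
          ← IsMul.map_mul, ← IsMul.map_mul, one_mul, mul_one])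
      (by
        have := h.mulPair_one_mul_hatElt (H := H) (Q := Q)
          (counitLeg H.toWeakQuasiBialgebra (G ⊗[ℂ] B)) p₂
        rwa [Q.right.leg_counitLeg] at this)
      (by rw [LinearMap.comp_apply, ← IsMul.map_mul, ← IsMul.map_mul, one_mul])
      (by
        rw [h.mulPair_fuse_hatElt _ p₁ p₂, fusedElt,
          Q.right.mulPair_counit_mid_inv p₁ (p₂ ∘ₗ hatLeft H Q γ L hat),
          Q.left.mulPair_counit_left_inv p₁ (p₂ ∘ₗ γ), leg_counitLeg_left, h2,
          h.one_mul_mulPair_baseElt p₁ p₂, mulPair_baseElt_mul_one p₁ p₂, leg_apply,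
          ← LinearMap.comp_apply p₂, fst_one_mul_mulPair, ← leg_apply,
          h.one_mul_mulPair_baseElt p₁ p₂])
    rwa [pos2_mulPair] at h3

/-- Both sides intertwine the same maps, so they may be compared through their composites with `t`
in a third leg. Both composites are the fused element with the coproduct in its first leg: on the
left by `coherence`, on the right by the fusion rule. -/
theorem Hat.coherent_hatElt : LinearMap.lTensor G (LinearMap.lTensor G (hatLeft H Q γ L hat))
        (TensorProduct.assoc ℂ G G M (TensorProduct.comm ℂ M (G ⊗[ℂ] G) Q.right.φ))
      * fuse Q (hatLeft H Q γ L hat) (hatElt H Q γ L hat) (hatElt H Q γ L hat)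
      * LinearMap.lTensor G (LinearMap.lTensor G (hatLeft H Q γ L hat)) Q.left.φ
    = splitFst B Δ (hatElt H Q γ L hat) := by
  have := h.isMul_hatLeft (H := H) (Q := Q)
  have hT := h.intertwines_hatElt (H := H) (Q := Q)
  refine h.eq_of_mul₃ ?_ ?_ ?_
  · rw [mul_assoc]
    congr 1
    rw [← pos3_mulPair (LinearMap.lTensor G (LinearMap.lTensor G _) _), mulPair_lTensor_lTensor]
    refine mulPair_mul_of_forall _ (mulPair_mul_of_forall _ fun c => ?_) _
    rw [LinearMap.comp_apply, ← IsMul.map_mul, h.hatLeft_mul_hat]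
  · rw [← pos3_mulPair (splitFst B Δ (hatElt H Q γ L hat)), mulPair_splitFst]
    have h1 := congrArg (leg Δ q₁ q₂ ◇ q₃) (h.hatElt_mul_hat (H := H) (Q := Q))
    rwa [IsMul.map_mul, oneTensor_apply, mulPair_tmul, ← mul_assoc, mulPair_mul_fst_one] at h1
  · rw [IsMul.map_mul, IsMul.map_mul, mulPair_assoc_comm, mulPair_fuse, mulPair_lTensor_lTensor,
      mulPair_splitFst]
    refine h.mul_eq_of_composite (H := H) (Q := Q) (leg Δ s₁ s₂) s₃ s₄
      (leg ρ (s₄ ∘ₗ hatLeft H Q γ L hat) (leg Δ s₁ s₂)) (fun a => ?_)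
      (fun a => Comm.commute (f := s₃) (g := leg Δ s₁ s₂ ◇ s₄) a _) (fun m => ?_)
      (hT.mulPair _ _) ?_ (h.mulPair_one_mul_hatElt _ _) ?_
    · exact ((Comm.commute (f := s₃) (g := s₄ ∘ₗ hatLeft H Q γ L hat ◇ s₁ ◇ s₂) a _).mul_right
        (((Comm.commute (f := s₃) (g := s₁ ◇ s₄) a _).mul_right
        (Comm.commute (f := s₃) (g := s₁ ◇ s₄ ∘ₗ hatLeft H Q γ L hat ◇ s₂) a _)).mul_right
        (Comm.commute (f := s₃) (g := s₂ ◇ s₄) a _))).mul_right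
        (Comm.commute (f := s₃) (g := s₁ ◇ s₂ ◇ s₄ ∘ₗ hatLeft H Q γ L hat) a _)
    · rw [mul_assoc, (Q.left.reassoc s₁ s₂ _).comm, ← mul_assoc, mul_assoc _ _ (leg _ _ _ m),
        hT.fuse_mul s₁ s₂ s₄ hT, ← mul_assoc, (Q.right.reassoc s₁ s₂ _).comm]
      simp only [mul_assoc]
    · rw [← mul_assoc, ← mul_assoc, (Q.right.reassoc s₁ s₂ _).one_mul]
    · rw [h.coherence s₁ s₂ s₄ s₃, h.mulPair_fuse_hatElt (leg Δ s₁ s₂) s₃ s₄]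

end Classify

end


/-! ### Counits of the antipode data and the base vector -/

section

variable {G : Type u} [Ring G] [Algebra ℂ G] {M : Type v} [Ring M] [Algebra ℂ M]
  {B : Type w} [Ring B] [Algebra ℂ B]

section Counit

variable (H : WeakQuasiHopfAlgebra G)

/-- Applying `ε` to `∑ X β S(Y) α Z = 1` exhibits `1` as a multiple of `ε(α) ε(β)`. -/
theorem counit_α_mul_β : H.ε H.α * H.ε H.β ≠ 0 := by
  have h1 : ∀ x, ∃ c : ℂ, H.ε (antiRL H x) = c * (H.ε H.α * H.ε H.β) := by
    intro x
    induction x with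
    | zero => exact ⟨0, by simp⟩
    | add x y hx hy =>
      obtain ⟨c, hc⟩ := hx
      obtain ⟨d, hd⟩ := hy
      exact ⟨c + d, by simp only [map_add, hc, hd, add_mul]⟩
    | tmul a x =>
      induction x with
      | zero => exact ⟨0, by simp⟩
      | add x y hx hy =>
        obtain ⟨c, hc⟩ := hx
        obtain ⟨d, hd⟩ := hy
        exact ⟨c + d, by simp only [TensorProduct.tmul_add, map_add, hc, hd, add_mul]⟩
      | tmul b c => exact ⟨H.ε a * H.ε (H.antipode b) * H.ε c, by simp; ring⟩
  intro h
  obtain ⟨c, hc⟩ := h1 H.φ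
  simp [h] at hc

/-- Apply `ε` to `S(a₁) α a₂ = ε(a) α` and cancel `ε(α)`, which is nonzero. -/
theorem counit_antipode (a : G) : H.ε (H.antipode a) = H.ε a := by
  have h1 : ∀ x, H.ε (antiL H x) = H.ε H.α * H.ε (H.antipode (evalSnd G H.ε.toLinearMap x)) := by
    intro x
    induction x with
    | zero => simp
    | add x y hx hy => simp only [map_add, hx, hy, mul_add]
    | tmul b c => simp [evalSnd]; ring
  have h2 := h1 (H.Δ a)
  rw [H.counit_right, antiL_comul, map_smul, smul_eq_mul, mul_comm] at h2
  exact (mul_left_cancel₀ (left_ne_zero_of_mul (counit_α_mul_β H)) h2).symm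

theorem counit_antipodeInv (a : G) : H.ε (H.antipodeInv a) = H.ε a := by
  rw [← counit_antipode, antipode_antipodeInv]

theorem RightCoaction.evalSnd_pElt (P : RightCoaction H.toWeakQuasiBialgebra M) :
    evalSnd M H.ε.toLinearMap (P.pElt H) = H.ε H.β • 1 := by
  have h1 : ∀ x, evalSnd M H.ε.toLinearMap (LinearMap.lTensor M (antiR H) x)
      = H.ε H.β • evalSnd M H.ε.toLinearMap
        (LinearMap.lTensor M (evalSnd G H.ε.toLinearMap) x) := by
    intro x
    induction x with
    | zero => simp
    | add x y hx hy => simp only [map_add, hx, hy, smul_add]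
    | tmul a x =>
      induction x with
      | zero => simp
      | add x y hx hy => simp only [TensorProduct.tmul_add, map_add, hx, hy, smul_add]
      | tmul b c => simp [evalSnd, counit_antipode, smul_smul]; ring_nf
  rw [pElt, h1, P.lTensor_counit_right_φInv, P.counit]

end Counit

section Classify

variable {H : WeakQuasiHopfAlgebra G} {Q : QuasiCommutingPair H.toWeakQuasiBialgebra M}
  {γ : M →ₗ[ℂ] B} {L : G ⊗[ℂ] B} {hat : G ⊗[ℂ] B →ₗ[ℂ] B}

local notation "Δ" => (H.Δ : G →ₗ[ℂ] G ⊗[ℂ] G)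
local notation "lam" => (Q.left.lam : M →ₗ[ℂ] G ⊗[ℂ] M)
local notation "ρ" => (Q.right.rho : M →ₗ[ℂ] M ⊗[ℂ] G)
local notation "p₁" => tensorOne G B
local notation "p₂" => oneTensor G B

variable [IsMul γ] (h : Hat (oneTensor G B) hat L (γ 1))

/-- `hatLeft` as a homomorphism of algebras. -/
def Hat.hom : M →ₙₐ[ℂ] B where
  __ := hatLeft H Q γ L hat
  map_mul' := (h.isMul_hatLeft (H := H) (Q := Q)).map_mul
  map_zero' := (hatLeft H Q γ L hat).map_zero

theorem Hat.coe_hom : (h.hom (H := H) (Q := Q) : M →ₗ[ℂ] B) = hatLeft H Q γ L hat := rfl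

theorem Hat.isIntertwiner : IsIntertwiner Q (h.hom (H := H) (Q := Q)) (hatElt H Q γ L hat) where
  normal := h.evalFst_hatElt
  intertwines := h.intertwines_hatElt
  mul_left_one := h.hatElt_mul_one
  right_one_mul := h.one_mul_hatElt
  coherent := by
    have := h.coherent_hatElt (H := H) (Q := Q)
    rw [fuse] at this
    simp only [← mul_assoc] at this ⊢
    exact this

variable (H Q γ L) in
/-- `(ε ⊗ id)(t)` for `t = L ◁ p_ρ`. -/
def baseVec : B := evalFst B H.ε.toLinearMap (baseElt H Q γ L)

theorem counitLeg_baseElt : (counitLeg H.toWeakQuasiBialgebra (G ⊗[ℂ] B) ◇ p₂) (baseElt H Q γ L)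
    = p₂ (baseVec H Q γ L) := counitLeg_mulPair _ _ _

/-- Under the counit leg the action of `p_ρ` reduces to `(id ⊗ ε)(p_ρ) = ε(β) 1`, because `ε ∘ S⁻¹ =
ε`. The formula shows that the base vector is not degenerate. -/
theorem baseVec_eq : baseVec H Q γ L
    = H.ε H.β • (evalFst B H.ε.toLinearMap L * γ 1) := by
  have h1 : baseVec H Q γ L = (counitLeg H.toWeakQuasiBialgebra B ◇ LinearMap.id)
    (baseElt H Q γ L) :=
    (counitLeg_mulPair H.toWeakQuasiBialgebra (R := B) LinearMap.id _).symm
  have h2 : ∀ (Z : B) w, rightAct H (counitLeg H.toWeakQuasiBialgebra B) γ Z w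
      = Z * γ (evalSnd M H.ε.toLinearMap w) := by
    intro Z w
    induction w with
    | zero => simp
    | add x y hx hy => simp only [map_add, hx, hy, mul_add]
    | tmul b c => simp [evalSnd, counit_antipodeInv]
  rw [h1, mulPair_baseElt, LinearMap.id_comp, Q.left.leg_counitLeg, h2, Q.right.evalSnd_pElt,
    counitLeg_mulPair, map_smul, mul_smul_comm]
  rfl

include h

theorem Hat.hatLeft_mul_baseVec (m : M) :
    hatLeft H Q γ L hat m * baseVec H Q γ L = baseVec H Q γ L * γ m := by
  have := h.isMul_hatLeft (H := H) (Q := Q)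
  have h1 := (h.intertwines_baseElt (H := H) (Q := Q)).mulPair
    (counitLeg H.toWeakQuasiBialgebra B) LinearMap.id m
  simp only [Q.left.leg_counitLeg, Q.right.leg_counitLeg, counitLeg_mulPair] at h1
  exact h1.symm

/-- The fusion rule for `T` and `t` with `ε` in the second leg, where all three reassociators become
idempotents that `T` and `t` absorb. -/
theorem Hat.hatElt_mul_baseVec :
    hatElt H Q γ L hat * p₂ (baseVec H Q γ L) = baseElt H Q γ L := by
  have := h.isMul_hatLeft (H := H) (Q := Q)
  have h1 := h.mulPair_fuse_hatElt (H := H) (Q := Q) p₁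
    (counitLeg H.toWeakQuasiBialgebra (G ⊗[ℂ] B)) p₂
  rw [Q.mulPair_counit_right_inv p₁ (p₂ ∘ₗ hatLeft H Q γ L hat), fusedElt,
    Q.right.mulPair_counit_right_inv p₁ (p₂ ∘ₗ hatLeft H Q γ L hat),
    Q.left.mulPair_counit_mid_inv p₁ (p₂ ∘ₗ γ), leg_counitLeg_right, 
    h.one_mul_mulPair_baseElt p₁ p₂, mulPair_baseElt_mul_one p₁ p₂,
    h.mulPair_hatElt_mul_one p₁ p₂, pos2_mulPair, pos2_mulPair, counitLeg_baseElt] at h1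
  exact h1

/-- The decisive evaluation: `q_ρ T`, the element computing `μ_L`, takes the base vector back to the
free element `L`, up to the idempotent `hatLeft 1`. -/
theorem Hat.qElt_mul_hatElt_mul_baseVec :
    (p₂ ∘ₗ hatLeft H Q γ L hat ◇ p₁) (Q.right.qElt H) * hatElt H Q γ L hat
      * p₂ (baseVec H Q γ L) = p₂ (hatLeft H Q γ L hat 1) * L := by
  have := h.isMul_hatLeft (H := H) (Q := Q)
  rw [mul_assoc, h.hatElt_mul_baseVec]
  refine qElt_mul_rightAct_pElt H Q.right p₁ _ _ (fun m => ?_)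
  have := h.hatLeft_mul (H := H) (Q := Q) p₁ p₂ m
  rwa [pos2_mulPair] at this

end Classify

end


/-! ### Slices, the coproduct of the dual, and `P_L` -/

section

section Slices

variable {V W : Type*} [AddCommGroup V] [Module ℂ V] [AddCommGroup W] [Module ℂ W]

@[simp] theorem evalFst_tmul (f : V →ₗ[ℂ] ℂ) (v : V) (x : W) :
    evalFst W f (v ⊗ₜ x) = f v • x := by simp [evalFst]
@[simp] theorem evalSnd_tmul (f : W →ₗ[ℂ] ℂ) (v : V) (x : W) :
    evalSnd V f (v ⊗ₜ x) = f x • v := by simp [evalSnd]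
@[simp] theorem sliceFst_apply (x : V ⊗[ℂ] W) (f : Module.Dual ℂ V) :
    sliceFst x f = evalFst W f x := rfl
@[simp] theorem sliceSnd_apply (x : V ⊗[ℂ] W) (f : Module.Dual ℂ W) :
    sliceSnd x f = evalSnd V f x := rfl
@[simp] theorem sliceOuter_tmul (x : V ⊗[ℂ] (W ⊗[ℂ] V)) (f g : Module.Dual ℂ V) :
    sliceOuter x (f ⊗ₜ g) = evalSnd W g (evalFst (W ⊗[ℂ] V) f x) := rfl

theorem evalFst_lTensor {W' : Type*} [AddCommGroup W'] [Module ℂ W'] (f : V →ₗ[ℂ] ℂ)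
    (u : W →ₗ[ℂ] W') (x : V ⊗[ℂ] W) : evalFst W' f (u.lTensor V x) = u (evalFst W f x) := by
  induction x with
  | zero => simp
  | add x y hx hy => simp only [map_add, hx, hy]
  | tmul a c => simp

variable [FiniteDimensional ℂ V]

/-- The tensor with slices `f ↦ Γ f`. -/
def ofSlices (Γ : Module.Dual ℂ V →ₗ[ℂ] W) : V ⊗[ℂ] W :=
  ∑ i, Module.finBasis ℂ V i ⊗ₜ Γ ((Module.finBasis ℂ V).coord i)

@[simp] theorem evalFst_ofSlices (Γ : Module.Dual ℂ V →ₗ[ℂ] W) (f : Module.Dual ℂ V) :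
    evalFst W f (ofSlices Γ) = Γ f := by
  simp only [ofSlices, map_sum, evalFst_tmul, ← map_smul]
  rw [← map_sum]
  congr 1
  exact (Module.finBasis ℂ V).sum_dual_apply_smul_coord f

theorem ofSlices_sliceFst (x : V ⊗[ℂ] W) : ofSlices (sliceFst x) = x := by
  induction x with
  | zero => simp [ofSlices]
  | add x y hx hy =>
    conv_rhs => rw [← hx, ← hy]
    simp [ofSlices, TensorProduct.tmul_add, Finset.sum_add_distrib]
  | tmul a c =>
    simp only [ofSlices, sliceFst_apply, evalFst_tmul, ← TensorProduct.smul_tmul]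
    rw [← TensorProduct.sum_tmul]
    congr 1
    exact (Module.finBasis ℂ V).sum_repr a

theorem eq_of_evalFst {x y : V ⊗[ℂ] W} (h : ∀ f : Module.Dual ℂ V, evalFst W f x = evalFst W f y) :
    x = y := by
  rw [← ofSlices_sliceFst x, ← ofSlices_sliceFst y]
  congr 1
  exact LinearMap.ext h

end Slices

section Dual

variable {G : Type u} [Ring G] [Algebra ℂ G] {M : Type v} [Ring M] [Algebra ℂ M]
  [FiniteDimensional ℂ G] {A : Type w} [Ring A] [Algebra ℂ A]

theorem mulPair_dualComul (ψ : Module.Dual ℂ G) (a b : G) :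
    (Module.Dual.eval ℂ G a ◇ Module.Dual.eval ℂ G b) (dualComul G ψ) = ψ (a * b) := by
  have h : ∀ ω : Module.Dual ℂ G ⊗[ℂ] Module.Dual ℂ G,
      (Module.Dual.eval ℂ G a ◇ Module.Dual.eval ℂ G b) ω
        = TensorProduct.dualDistribEquiv ℂ G G ω (a ⊗ₜ b) := by
    intro ω
    induction ω with
    | zero => simp
    | add x y hx hy => simp only [map_add, hx, hy, LinearMap.add_apply]
    | tmul f g => simp [TensorProduct.dualDistribEquiv, TensorProduct.dualDistribEquivOfBasis]
  rw [h, dualComul, LinearMap.comp_apply, LinearEquiv.coe_coe, LinearEquiv.apply_symm_apply]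
  simp

theorem mulPair_dualComul₂ (ψ : Module.Dual ℂ G) (a b c : G) :
    (Module.Dual.eval ℂ G a ◇ Module.Dual.eval ℂ G b ◇ Module.Dual.eval ℂ G c) (dualComul₂ G ψ)
      = ψ (a * (b * c)) := by
  rw [dualComul₂, LinearMap.comp_apply, mulPair_lTensor, ← mulPair_dualComul]
  congr 2
  ext χ
  exact mulPair_dualComul χ b c

/-- Because `ψ₁(a) ψ₂(c) = ψ(a c)`, the sum in `μ_L` is a single slice of the product `q T`. -/
theorem mul_map_dualComul (f : M →ₗ[ℂ] A) (q : M ⊗[ℂ] G) (T : G ⊗[ℂ] A) (ψ : Module.Dual ℂ G) :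
    LinearMap.mul' ℂ A (TensorProduct.map (f ∘ₗ sliceSnd q) (sliceFst T) (dualComul G ψ))
      = evalFst A ψ ((oneTensor G A ∘ₗ f ◇ tensorOne G A) q * T) := by
  change ((f ∘ₗ sliceSnd q) ◇ sliceFst T) (dualComul G ψ) = _
  induction q with
  | zero =>
    have : sliceSnd (0 : M ⊗[ℂ] G) = 0 := by ext; simp
    simp [this, mulPair]
  | add x y hx hy =>
    have : sliceSnd (x + y) = sliceSnd x + sliceSnd y := by ext; simp
    rw [this, LinearMap.comp_add, mulPair, TensorProduct.map_add_left, LinearMap.comp_add,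
      LinearMap.add_apply, map_add, add_mul, map_add, ← hx, ← hy]
    rfl
  | tmul m a =>
    induction T with
    | zero =>
      have : sliceFst (0 : G ⊗[ℂ] A) = 0 := by ext; simp
      simp [this, mulPair]
    | add x y hx hy =>
      have : sliceFst (x + y) = sliceFst x + sliceFst y := by ext; simp
      rw [this, mulPair, TensorProduct.map_add_right, LinearMap.comp_add,
        LinearMap.add_apply, mul_add, map_add, ← hx, ← hy]
      rfl
    | tmul c x =>
      have h : ∀ ω, ((f ∘ₗ sliceSnd (m ⊗ₜ a)) ◇ sliceFst (c ⊗ₜ x)) ω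
          = (Module.Dual.eval ℂ G a ◇ Module.Dual.eval ℂ G c) ω • (f m * x) := by
        intro ω
        induction ω with
        | zero => simp
        | add x y hx hy => simp only [map_add, hx, hy, add_smul]
        | tmul χ ψ => simp [smul_smul, mul_comm]
      rw [h, mulPair_dualComul]
      simp

end Dual

section Proj

variable {G : Type u} [Ring G] [Algebra ℂ G] {M : Type v} [Ring M] [Algebra ℂ M]
  [FiniteDimensional ℂ G] {A : Type w} [Ring A] [Algebra ℂ A] (H : WeakQuasiHopfAlgebra G)

/-- `ψ ↦ ψ₂ ⊗ (ψ₃ ⊗ id ⊗ Ŝ⁻¹(ψ₁))(X)`, as a function of `ψ₁ ⊗ ψ₂ ⊗ ψ₃`. -/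
def outerSlice (X : G ⊗[ℂ] (M ⊗[ℂ] G)) :
    Module.Dual ℂ G ⊗[ℂ] (Module.Dual ℂ G ⊗[ℂ] Module.Dual ℂ G) →ₗ[ℂ] Module.Dual ℂ G ⊗[ℂ] M :=
  LinearMap.lTensor (Module.Dual ℂ G)
      (sliceOuter X ∘ₗ
        (TensorProduct.comm ℂ (Module.Dual ℂ G) (Module.Dual ℂ G)).toLinearMap ∘ₗ
        LinearMap.rTensor (Module.Dual ℂ G) (dualAntipodeInv H)) ∘ₗ
    (TensorProduct.leftComm ℂ (Module.Dual ℂ G) (Module.Dual ℂ G)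
      (Module.Dual ℂ G)).toLinearMap

theorem projL_tmul (Q : QuasiCommutingPair H.toWeakQuasiBialgebra M) (ψ : Module.Dual ℂ G)
    (m : M) : projL H Q (ψ ⊗ₜ m) = LinearMap.lTensor (Module.Dual ℂ G) (LinearMap.mul' ℂ M)
      (TensorProduct.assoc ℂ (Module.Dual ℂ G) M M
        (outerSlice H Q.deltaLOne (dualComul₂ G ψ) ⊗ₜ m)) := rfl

theorem outerSlice_tmul (X : G ⊗[ℂ] (M ⊗[ℂ] G)) (χ₁ χ₂ χ₃ : Module.Dual ℂ G) :
    outerSlice H X (χ₁ ⊗ₜ (χ₂ ⊗ₜ χ₃))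
      = χ₂ ⊗ₜ evalSnd M (χ₁ ∘ₗ H.antipodeInv) (evalFst (M ⊗[ℂ] G) χ₃ X) := rfl

theorem outerSlice_add (X Y : G ⊗[ℂ] (M ⊗[ℂ] G)) :
    outerSlice H (X + Y) = outerSlice H X + outerSlice H Y := by
  have : sliceOuter (X + Y) = sliceOuter X + sliceOuter Y := by ext; simp
  rw [outerSlice, this, LinearMap.add_comp, LinearMap.lTensor_add, LinearMap.add_comp]
  rfl

theorem outerSlice_zero : outerSlice H (0 : G ⊗[ℂ] (M ⊗[ℂ] G)) = 0 := by
  have : sliceOuter (0 : G ⊗[ℂ] (M ⊗[ℂ] G)) = 0 := by ext; simp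
  rw [outerSlice, this, LinearMap.zero_comp, LinearMap.lTensor_zero, LinearMap.zero_comp]

/-- On pure tensors the three parts of `ψ` reassemble to `ψ(S⁻¹(b) t a)`, which is the coefficient
in the right action on `T`. -/
theorem mulPair_outerSlice (g : M →ₗ[ℂ] A) (T : G ⊗[ℂ] A) (X : G ⊗[ℂ] (M ⊗[ℂ] G))
    (ψ : Module.Dual ℂ G) : (sliceFst T ◇ g) (outerSlice H X (dualComul₂ G ψ))
      = evalFst A ψ (rightAct₃ H (tensorOne G A) (tensorOne G A) (oneTensor G A ∘ₗ g) T X) := by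
  induction X with
  | zero => simp [outerSlice_zero]
  | add x y hx hy => simp only [outerSlice_add, LinearMap.add_apply, map_add, hx, hy]
  | tmul a X =>
    induction X with
    | zero => simp [outerSlice_zero]
    | add x y hx hy =>
      simp only [TensorProduct.tmul_add, outerSlice_add, LinearMap.add_apply, map_add, hx, hy]
    | tmul c b =>
      induction T with
      | zero =>
        have : sliceFst (0 : G ⊗[ℂ] A) = 0 := by ext; simp
        simp [this, mulPair]
      | add x y hx hy =>
        have : sliceFst (x + y) = sliceFst x + sliceFst y := by ext; simp
        rw [rightAct₃_tmul] at hx hy ⊢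
        rw [this, mulPair, TensorProduct.map_add_left, LinearMap.comp_add, LinearMap.add_apply,
          add_mul, mul_add, map_add, ← hx, ← hy]
        rfl
      | tmul t x =>
        have h : ∀ ω, (sliceFst (t ⊗ₜ x) ◇ g) (outerSlice H (a ⊗ₜ (c ⊗ₜ b)) ω)
            = (Module.Dual.eval ℂ G (H.antipodeInv b) ◇ Module.Dual.eval ℂ G t
              ◇ Module.Dual.eval ℂ G a) ω • (x * g c) := by
          intro ω
          induction ω with
          | zero => simp
          | add x y hx hy => simp only [map_add, hx, hy, add_smul]
          | tmul χ ω =>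
            induction ω with
            | zero => simp
            | add x y hx hy => simp only [TensorProduct.tmul_add, map_add, hx, hy, add_smul]
            | tmul χ₂ χ₃ =>
              simp only [outerSlice_tmul, mulPair_tmul, evalFst_tmul, map_smul, evalSnd_tmul,
                sliceFst_apply, LinearMap.comp_apply, Module.Dual.eval_apply, smul_mul_smul_comm,
                smul_smul]
              congr 1
              ring
        rw [h, mulPair_dualComul₂]
        simp

/-- Explains the form of `P_L`: it is dual to the operation `T ↦ T ◁ ρ(1)`, with `M` acting on the
right through `λ`. -/
theorem mulPair_projL (Q : QuasiCommutingPair H.toWeakQuasiBialgebra M) (g : M →ₗ[ℂ] A) [IsMul g]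
    (T : G ⊗[ℂ] A) (y : Module.Dual ℂ G ⊗[ℂ] M) : (sliceFst T ◇ g) (projL H Q y)
      = (sliceFst (rightAct H (tensorOne G A) (leg (Q.left.lam : M →ₗ[ℂ] G ⊗[ℂ] M)
          (tensorOne G A) (oneTensor G A ∘ₗ g)) T (Q.right.rho 1)) ◇ g) y := by
  induction y with
  | zero => simp
  | add x y hx hy => simp only [map_add, hx, hy]
  | tmul ψ m =>
    have h : ∀ n : Module.Dual ℂ G ⊗[ℂ] M, (sliceFst T ◇ g)
        (LinearMap.lTensor (Module.Dual ℂ G) (LinearMap.mul' ℂ M)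
        (TensorProduct.assoc ℂ (Module.Dual ℂ G) M M (n ⊗ₜ m))) = (sliceFst T ◇ g) n * g m := by
      intro n
      induction n with
      | zero => simp
      | add x y hx hy => simp only [TensorProduct.add_tmul, map_add, hx, hy, add_mul]
      | tmul χ c => simp [IsMul.map_mul, mul_assoc]
    rw [projL_tmul, h, mulPair_outerSlice, QuasiCommutingPair.deltaLOne, rightAct₃_splitFst]
    rfl

end Proj

end


/-! ### The representation on `M × (Ĝ ⊗ M)` -/

section

section Slices

variable {V A : Type*} [Ring V] [Algebra ℂ V] [Ring A] [Algebra ℂ A]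

theorem evalFst_mul_oneTensor (f : V →ₗ[ℂ] ℂ) (x : V ⊗[ℂ] A) (a : A) :
    evalFst A f (x * oneTensor V A a) = evalFst A f x * a := by
  induction x with
  | zero => simp
  | add x y hx hy => simp only [map_add, add_mul, hx, hy]
  | tmul c b => simp

theorem evalFst_oneTensor_mul (f : V →ₗ[ℂ] ℂ) (x : V ⊗[ℂ] A) (a : A) :
    evalFst A f (oneTensor V A a * x) = a * evalFst A f x := by
  induction x with
  | zero => simp
  | add x y hx hy => simp only [map_add, mul_add, hx, hy]
  | tmul c b => simp

instance isMul_lTensor {A' : Type*} [Ring A'] [Algebra ℂ A'] (f : A →ₗ[ℂ] A') [IsMul f] :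
    IsMul (f.lTensor V) := by
  rw [← LinearMap.ext (mulPair_eq_lTensor (A := V) f)]
  infer_instance

theorem lTensor_mulPair {A' W : Type*} [Ring A'] [Algebra ℂ A'] [AddCommGroup W] [Module ℂ W]
    (g : A →ₗ[ℂ] A') (f : W →ₗ[ℂ] A) (q : W ⊗[ℂ] V) :
    g.lTensor V ((oneTensor V A ∘ₗ f ◇ tensorOne V A) q)
      = (oneTensor V A' ∘ₗ g ∘ₗ f ◇ tensorOne V A') q := by
  induction q with
  | zero => simp
  | add x y hx hy => simp only [map_add, hx, hy]
  | tmul a c => simp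

end Slices

variable {G : Type u} [Ring G] [Algebra ℂ G] {M : Type v} [Ring M] [Algebra ℂ M]
  [FiniteDimensional ℂ G]

section Rep

variable (G M)

/-- The space of the representation that detects the kernel of `μ_L`. -/
abbrev RepSpace := M × (Module.Dual ℂ G ⊗[ℂ] M)

/-- The algebra of endomorphisms of `RepSpace`. -/
abbrev RepEnd := Module.End ℂ (RepSpace G M)

/-- Left multiplication of `M` on the first summand. -/
def repMul : M →ₗ[ℂ] RepEnd G M where
  toFun m := LinearMap.inl ℂ M _ ∘ₗ LinearMap.mulLeft ℂ m ∘ₗ LinearMap.fst ℂ M _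
  map_add' m n := by ext <;> simp [add_mul]
  map_smul' c m := by ext <;> simp

/-- The maps `(m, n) ↦ (0, ψ ⊗ m)`. -/
def repShift : Module.Dual ℂ G →ₗ[ℂ] RepEnd G M where
  toFun ψ := LinearMap.inr ℂ M _ ∘ₗ TensorProduct.mk ℂ _ M ψ ∘ₗ LinearMap.fst ℂ M _
  map_add' m n := by ext <;> simp
  map_smul' c m := by ext <;> simp

/-- The element with slices `repShift`. -/
def repElt : G ⊗[ℂ] RepEnd G M := ofSlices (repShift G M)

/-- The map `hat y : (m, ψ ⊗ n) ↦ (ψ ⊗ id)(y)(n, 0)`. -/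
def repHat : G ⊗[ℂ] RepEnd G M →ₗ[ℂ] RepEnd G M where
  toFun y := TensorProduct.lift
    (LinearMap.lcomp ℂ (RepSpace G M) (LinearMap.inl ℂ M (Module.Dual ℂ G ⊗[ℂ] M)) ∘ₗ sliceFst y)
      ∘ₗ LinearMap.snd ℂ M _
  map_add' x y := by
    refine LinearMap.prod_ext (LinearMap.ext fun m => ?_) (TensorProduct.ext' fun ψ n => by simp)
    simp only [LinearMap.comp_apply, LinearMap.inl_apply, LinearMap.snd_apply, map_zero,
      LinearMap.add_apply, add_zero]
  map_smul' c x := by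
    refine LinearMap.prod_ext (LinearMap.ext fun m => ?_) (TensorProduct.ext' fun ψ n => by simp)
    simp only [LinearMap.comp_apply, LinearMap.inl_apply, LinearMap.snd_apply, map_zero,
      LinearMap.smul_apply, smul_zero]

variable {G M}

@[simp] theorem repMul_apply (m : M) (x : RepSpace G M) : repMul G M m x = (m * x.1, 0) := rfl
@[simp] theorem repShift_apply (ψ : Module.Dual ℂ G) (x : RepSpace G M) :
    repShift G M ψ x = (0, ψ ⊗ₜ x.1) := rfl
theorem repHat_apply_tmul (y : G ⊗[ℂ] RepEnd G M) (m : M)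
    (ψ : Module.Dual ℂ G) (n : M) :
    repHat G M y (m, ψ ⊗ₜ n) = evalFst _ ψ y (n, 0) := rfl
theorem repHat_apply_inl (y : G ⊗[ℂ] RepEnd G M) (m : M) :
    repHat G M y (m, 0) = 0 :=
  (TensorProduct.lift (LinearMap.lcomp ℂ (RepSpace G M)
    (LinearMap.inl ℂ M (Module.Dual ℂ G ⊗[ℂ] M)) ∘ₗ sliceFst y)).map_zero

instance : IsMul (repMul G M) :=
  ⟨fun x y => by ext <;> simp [mul_assoc]⟩

/-- The second summand is indexed by the slices of `repElt`, so an operator supported there may be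
prescribed freely on each slice; that is `repHat`. -/
theorem hat_repHat : Hat (oneTensor G (RepEnd G M)) (repHat G M)
    (repElt G M) (repMul G M 1) where
  mul_hat x y := by
    refine LinearMap.prod_ext (LinearMap.ext fun m => ?_) (TensorProduct.ext' fun ψ n => ?_)
    · simp [repHat_apply_inl]
    · simp only [LinearMap.comp_apply, LinearMap.inr_apply, Module.End.mul_apply,
        repHat_apply_tmul, evalFst_oneTensor_mul]
  hat_mul y := by
    refine eq_of_evalFst fun ψ => ?_
    rw [repElt, evalFst_mul_oneTensor, evalFst_oneTensor_mul, evalFst_ofSlices]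
    refine LinearMap.ext fun x => ?_
    simp [repHat_apply_tmul]

/-- Applying the operator attached to `y` to `(1, 0)` gives `(0, y)`. -/
theorem repElt_injective : Function.Injective
    (sliceFst (repElt G M) ◇ repMul G M) := by
  have h : ∀ y, (sliceFst (repElt G M) ◇ repMul G M) y (1, 0) = (0, y) := by
    intro y
    induction y with
    | zero => rw [map_zero]; rfl
    | add x y hx hy => simp only [map_add, LinearMap.add_apply, hx, hy]; simp
    | tmul ψ m => simp [repElt]
  intro x y hxy
  have := h x
  rw [hxy, h] at this
  exact (congrArg Prod.snd this).symm

end Rep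

section Kernel

variable (H : WeakQuasiHopfAlgebra G) (Q : QuasiCommutingPair H.toWeakQuasiBialgebra M)

/-- The action of `M` on the second summand. -/
abbrev repLeft : M →ₗ[ℂ] RepEnd G M := hatLeft H Q (repMul G M) (repElt G M) (repHat G M)

/-- The intertwiner with respect to `repLeft`. -/
abbrev repIntertwiner : G ⊗[ℂ] RepEnd G M := hatElt H Q (repMul G M) (repElt G M) (repHat G M)

theorem muL_eq {M₁ : Type*} [Ring M₁] [Algebra ℂ M₁] (ι : M →ₐ[ℂ] M₁)
    (Γ : Module.Dual ℂ G →ₗ[ℂ] M₁) (y : Module.Dual ℂ G ⊗[ℂ] M) :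
    muL ι Γ (qRho H Q) y = (sliceFst ((oneTensor G M₁ ∘ₗ ι.toLinearMap ◇ tensorOne G M₁)
      (Q.right.qElt H) * ofSlices Γ) ◇ ι.toLinearMap) y := by
  induction y with
  | zero => simp
  | add x y hx hy => simp only [map_add, hx, hy]
  | tmul ψ m =>
    have hΓ : sliceFst (ofSlices Γ) = Γ := by ext; simp
    have := mul_map_dualComul ι.toLinearMap (Q.right.qElt H) (ofSlices Γ) ψ
    rw [hΓ] at this
    rw [mulPair_tmul, sliceFst_apply, ← this]
    rfl

/-- `P_L` amounts to `L ↦ L ◁ ρ(1)`, and this is left multiplication of `L` by `repLeft 1`, an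
idempotent. Hence `P_L` is a projection. -/
theorem repElt_projL (y : Module.Dual ℂ G ⊗[ℂ] M) :
    (sliceFst (repElt G M) ◇ repMul G M) (projL H Q y)
      = repLeft H Q 1 * (sliceFst (repElt G M) ◇ repMul G M) y := by
  have h := (hat_repHat (G := G) (M := M)).hatLeft_mul (H := H) (Q := Q)
    (tensorOne G (RepEnd G M)) (oneTensor G (RepEnd G M)) 1
  rw [pos2_mulPair] at h
  rw [mulPair_projL, ← h]
  induction y with
  | zero => simp
  | add x y hx hy => simp only [map_add, hx, hy, mul_add]
  | tmul ψ m => rw [mulPair_tmul, mulPair_tmul, sliceFst_apply, evalFst_oneTensor_mul, mul_assoc,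
      sliceFst_apply]

theorem projL_comp_projL : projL H Q ∘ₗ projL H Q = projL H Q := by
  have := (hat_repHat (G := G) (M := M)).isMul_hatLeft (H := H) (Q := Q)
  refine LinearMap.ext fun y => repElt_injective ?_
  rw [LinearMap.comp_apply, repElt_projL, repElt_projL, ← mul_assoc, ← IsMul.map_mul, one_mul]

variable {H Q} {M₁ : Type*} [Ring M₁] [Algebra ℂ M₁] {ι : M →ₐ[ℂ] M₁}
  {Γ : Module.Dual ℂ G →ₗ[ℂ] M₁} (g : M₁ →ₙₐ[ℂ] RepEnd G M)
  (hι : ∀ m, g (ι m) = repLeft H Q m)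
include hι

/-- The action of `m` on the base vector is the base vector times left multiplication by `m`. By
`baseVec_eq` it sends `(1, 0)` to `ε(β)` times `ε ⊗ m`, and evaluating `ε` at `1` returns `m`. -/
theorem injective_of_rep : Function.Injective ι := by
  have hr := (hat_repHat (G := G) (M := M))
  refine (injective_iff_map_eq_zero ι).2 fun m hm => ?_
  have h1 := hr.hatLeft_mul_baseVec (H := H) (Q := Q) m
  rw [← hι, hm, map_zero, zero_mul, baseVec_eq, smul_mul_assoc, mul_assoc, ← IsMul.map_mul,
    one_mul] at h1
  have h2 := (smul_eq_zero.1 h1.symm).resolve_left (right_ne_zero_of_mul (counit_α_mul_β H))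
  have h3 : (sliceFst (repElt G M) ◇ repMul G M) (H.ε.toLinearMap ⊗ₜ m) = 0 := h2
  have h4 := repElt_injective (h3.trans (map_zero _).symm)
  have h5 := congrArg (evalFst M (Module.Dual.eval ℂ G 1)) h4
  simpa using h5

/-- Since `μ_L` is given by slices of `q_ρ T`, `qElt_mul_hatElt_mul_baseVec` computes its action on
the base vector: `L` preceded by `repLeft 1`, which is `P_L`. -/
theorem map_muL_mul_baseVec (hΓ : ∀ ψ, g (Γ ψ) = evalFst (RepEnd G M) ψ (repIntertwiner H Q))
    (y : Module.Dual ℂ G ⊗[ℂ] M) :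
    g (muL ι Γ (qRho H Q) y) * baseVec H Q (repMul G M) (repElt G M)
      = (sliceFst (repElt G M) ◇ repMul G M) (projL H Q y) := by
  have hr := (hat_repHat (G := G) (M := M))
  have hT : LinearMap.lTensor G (g : M₁ →ₗ[ℂ] RepEnd G M) (ofSlices Γ)
      = repIntertwiner H Q :=
    eq_of_evalFst fun ψ => by rw [evalFst_lTensor, evalFst_ofSlices, ← hΓ]; rfl
  have hg : (g : M₁ →ₗ[ℂ] RepEnd G M) ∘ₗ ι.toLinearMap = repLeft H Q := LinearMap.ext hι
  rw [repElt_projL, muL_eq]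
  induction y with
  | zero => simp
  | add x y hx hy => simp only [map_add, add_mul, mul_add, hx, hy]
  | tmul ψ m =>
    rw [mulPair_tmul, mulPair_tmul, map_mul, ← linearMap_apply g, ← linearMap_apply g,
      sliceFst_apply, ← evalFst_lTensor, IsMul.map_mul, lTensor_mulPair, hT, hg, mul_assoc,
      AlgHom.toLinearMap_apply, linearMap_apply, hι, hr.hatLeft_mul_baseVec, ← mul_assoc,
      ← mul_assoc, ← evalFst_mul_oneTensor, hr.qElt_mul_hatElt_mul_baseVec,
      evalFst_oneTensor_mul]
    rfl

end Kernel

end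


/-! ### Surjectivity of `μ_L` -/

section

variable {G : Type u} [Ring G] [Algebra ℂ G] {M : Type v} [Ring M] [Algebra ℂ M]
  {A : Type w} [Ring A] [Algebra ℂ A] {R : Type*} [Ring R] [Algebra ℂ R]

section Coherent

variable {H : WeakQuasiBialgebra G} {Q : QuasiCommutingPair H M} {γ : M →ₙₐ[ℂ] A} {T : G ⊗[ℂ] A}

/-- Multiply coherence by `φ_ρ⁻¹` and `φ_λ⁻¹`; the idempotents created are absorbed because the
fused product is again an intertwiner. -/
theorem IsIntertwiner.fuse_eq (hT : IsIntertwiner Q γ T) (i j : G →ₗ[ℂ] R) (b : A →ₗ[ℂ] R)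
    [IsMul i] [IsMul j] [IsMul b] [Comm i j] [Comm i b] [Comm j b] :
    (i ◇ b) T * (i ◇ b ∘ₗ (γ : M →ₗ[ℂ] A) ◇ j) Q.φInv * (j ◇ b) T
      = (b ∘ₗ (γ : M →ₗ[ℂ] A) ◇ i ◇ j) Q.right.φInv
        * (leg (H.Δ : G →ₗ[ℂ] G ⊗[ℂ] G) i j ◇ b) T
        * (i ◇ j ◇ b ∘ₗ (γ : M →ₗ[ℂ] A)) Q.left.φInv := by
  have h0 : Intertwines Q (γ : M →ₗ[ℂ] A) (γ : M →ₗ[ℂ] A) T := hT.intertwines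
  have h1 := congrArg (i ◇ j ◇ b) hT.coherent
  have h2 := mulPair_fuse Q i j b (γ : M →ₗ[ℂ] A) T T
  rw [fuse] at h2
  rw [mul_assoc (_ * _) _ ((1 : G) ⊗ₜ[ℂ] T), mul_assoc _ _ (_ * ((1 : G) ⊗ₜ[ℂ] T)), ← mul_assoc _ _ ((1 : G) ⊗ₜ[ℂ] T),
    IsMul.map_mul, IsMul.map_mul, h2, mulPair_assoc_comm, mulPair_lTensor_lTensor,
    mulPair_splitFst] at h1
  rw [← h1]
  simp only [← mul_assoc]
  rw [(Q.right.reassoc i j (b ∘ₗ (γ : M →ₗ[ℂ] A))).inv_mul, mul_assoc _ _ ((i ◇ j ◇ b ∘ₗ _) _),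
    (Q.left.reassoc i j (b ∘ₗ (γ : M →ₗ[ℂ] A))).mul_inv]
  have h3 := h0.fuse_mul i j b h0 1
  have h4 := h0.one_mul_fuse i j b T
  simp only [← mul_assoc] at h3 h4
  rw [h4, h3, h4]

end Coherent

section Closure

/-- The tensors all of whose slices lie in `U`. -/
def slicesIn (V : Type*) [AddCommGroup V] [Module ℂ V] {W : Type*} [AddCommGroup W] [Module ℂ W]
    (U : Submodule ℂ W) : Submodule ℂ (V ⊗[ℂ] W) where
  carrier := {x | ∀ f : Module.Dual ℂ V, evalFst W f x ∈ U}
  add_mem' hx hy f := by rw [map_add]; exact U.add_mem (hx f) (hy f)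
  zero_mem' f := by rw [map_zero]; exact U.zero_mem
  smul_mem' c x hx f := by rw [map_smul]; exact U.smul_mem c (hx f)

variable {U : Submodule ℂ A}

theorem tensorOne_mul_mem_slicesIn (a : G) : ∀ x ∈ slicesIn G U,
    tensorOne G A a * x ∈ slicesIn G U := by
  intro x hx f
  have : evalFst A f (tensorOne G A a * x) = evalFst A (f ∘ₗ LinearMap.mulLeft ℂ a) x := by
    clear hx
    induction x with
    | zero => simp
    | add x y hx hy => simp only [map_add, mul_add, hx, hy]
    | tmul c b => simp
  rw [this]
  exact hx _

theorem mul_tensorOne_mem_slicesIn (a : G) : ∀ x ∈ slicesIn G U,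
    x * tensorOne G A a ∈ slicesIn G U := by
  intro x hx f
  have : evalFst A f (x * tensorOne G A a) = evalFst A (f ∘ₗ LinearMap.mulRight ℂ a) x := by
    clear hx
    induction x with
    | zero => simp
    | add x y hx hy => simp only [map_add, add_mul, hx, hy]
    | tmul c b => simp
  rw [this]
  exact hx _

theorem oneTensor_mul_mem_slicesIn {a : A} (ha : ∀ x ∈ U, a * x ∈ U) : ∀ x ∈ slicesIn G U,
    oneTensor G A a * x ∈ slicesIn G U := fun x hx f => by
  rw [evalFst_oneTensor_mul]; exact ha _ (hx f)

theorem mul_oneTensor_mem_slicesIn {a : A} (ha : ∀ x ∈ U, x * a ∈ U) : ∀ x ∈ slicesIn G U,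
    x * oneTensor G A a ∈ slicesIn G U := fun x hx f => by
  rw [evalFst_mul_oneTensor]; exact ha _ (hx f)

theorem splitFst_mem_slicesIn (u : G →ₗ[ℂ] G ⊗[ℂ] G) {x : G ⊗[ℂ] A} (hx : x ∈ slicesIn G U) :
    splitFst A u x ∈ slicesIn G (slicesIn G U) := by
  intro f f'
  have : evalFst A f' (evalFst (G ⊗[ℂ] A) f (splitFst A u x))
      = evalFst A (leg u f f') x := by
    clear hx
    induction x with
    | zero => simp
    | add x y hx hy => simp only [map_add, hx, hy]
    | tmul c b =>
      have : ∀ w : G ⊗[ℂ] G, evalFst A f' (evalFst (G ⊗[ℂ] A) f (TensorProduct.assoc ℂ G G A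
          (w ⊗ₜ b))) = (f ◇ f') w • b := by
        intro w
        induction w with
        | zero => simp
        | add x y hx hy => simp only [TensorProduct.add_tmul, map_add, hx, hy, add_smul]
        | tmul c d => simp [smul_smul]
      rw [evalFst_tmul]
      exact this (u c)
  rw [this]
  exact hx _

theorem mulPair_mul_mem {V W : Type*} [AddCommGroup V] [Module ℂ V] [AddCommGroup W] [Module ℂ W]
    {S : Submodule ℂ R} {f : V →ₗ[ℂ] R} {g : W →ₗ[ℂ] R} (hf : ∀ a, ∀ x ∈ S, f a * x ∈ S)
    (hg : ∀ a, ∀ x ∈ S, g a * x ∈ S) (y : V ⊗[ℂ] W) : ∀ x ∈ S, (f ◇ g) y * x ∈ S := by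
  intro x hx
  induction y with
  | zero => simp
  | add y z hy hz => rw [map_add, add_mul]; exact S.add_mem hy hz
  | tmul a c => rw [mulPair_tmul, mul_assoc]; exact hf _ _ (hg _ _ hx)

theorem mul_mulPair_mem {V W : Type*} [AddCommGroup V] [Module ℂ V] [AddCommGroup W] [Module ℂ W]
    {S : Submodule ℂ R} {f : V →ₗ[ℂ] R} {g : W →ₗ[ℂ] R} (hf : ∀ a, ∀ x ∈ S, x * f a ∈ S)
    (hg : ∀ a, ∀ x ∈ S, x * g a ∈ S) (y : V ⊗[ℂ] W) : ∀ x ∈ S, x * (f ◇ g) y ∈ S := by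
  intro x hx
  induction y with
  | zero => simp
  | add y z hy hz => rw [map_add, mul_add]; exact S.add_mem hy hz
  | tmul a c => rw [mulPair_tmul, ← mul_assoc]; exact hg _ _ (hf _ _ hx)

theorem rightAct_mem (H : WeakQuasiHopfAlgebra G) {C : Type*} [Ring C] [Algebra ℂ C]
    {S : Submodule ℂ R} {j : G →ₗ[ℂ] R} {r : C →ₗ[ℂ] R} (hj : ∀ a, ∀ x ∈ S, j a * x ∈ S)
    (hr : ∀ a, ∀ x ∈ S, x * r a ∈ S) {Z : R} (hZ : Z ∈ S) (w : C ⊗[ℂ] G) :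
    rightAct H j r Z w ∈ S := by
  induction w with
  | zero => simp
  | add y z hy hz => rw [map_add]; exact S.add_mem hy hz
  | tmul a c => exact hj _ _ (hr _ _ hZ)

theorem rightAct₃_mem (H : WeakQuasiHopfAlgebra G) {C : Type*} [Ring C] [Algebra ℂ C]
    {S : Submodule ℂ R} {j k : G →ₗ[ℂ] R} {r : C →ₗ[ℂ] R} (hj : ∀ a, ∀ x ∈ S, j a * x ∈ S)
    (hk : ∀ a, ∀ x ∈ S, x * k a ∈ S) (hr : ∀ a, ∀ x ∈ S, x * r a ∈ S) {Z : R} (hZ : Z ∈ S)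
    (w : G ⊗[ℂ] (C ⊗[ℂ] G)) : rightAct₃ H j k r Z w ∈ S :=
  rightAct_mem H hj (mul_mulPair_mem hk hr) hZ _

theorem evalFst_evalFst_mul (f f' : Module.Dual ℂ G) (x y : G ⊗[ℂ] A) :
    evalFst A f' (evalFst (G ⊗[ℂ] A) f ((tensorOne G (G ⊗[ℂ] A)
        ◇ oneTensor G (G ⊗[ℂ] A) ∘ₗ oneTensor G A) x
      * (oneTensor G (G ⊗[ℂ] A) ∘ₗ tensorOne G A ◇ oneTensor G (G ⊗[ℂ] A) ∘ₗ oneTensor G A) y))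
      = evalFst A f x * evalFst A f' y := by
  induction x with
  | zero => simp
  | add x x' hx hy => simp only [map_add, add_mul, hx, hy]
  | tmul a c =>
    induction y with
    | zero => simp
    | add x x' hx hy => simp only [map_add, mul_add, hx, hy]
    | tmul a' c' => simp; rw [smul_comm]

end Closure

section Surjective

variable {H : WeakQuasiHopfAlgebra G} {Q : QuasiCommutingPair H.toWeakQuasiBialgebra M}
  [FiniteDimensional ℂ G] {ι : M →ₐ[ℂ] A} {Γ : Module.Dual ℂ G →ₗ[ℂ] A}
  (hT : IsIntertwiner Q (ι : M →ₙₐ[ℂ] A) (ofSlices Γ))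

local notation "Δ" => (H.Δ : G →ₗ[ℂ] G ⊗[ℂ] G)
local notation "lam" => (Q.left.lam : M →ₗ[ℂ] G ⊗[ℂ] M)
local notation "ρ" => (Q.right.rho : M →ₗ[ℂ] M ⊗[ℂ] G)
local notation "p₁" => tensorOne G A
local notation "p₂" => oneTensor G A
local notation "q₁" => tensorOne G (G ⊗[ℂ] A)
local notation "q₂" => oneTensor G (G ⊗[ℂ] A) ∘ₗ tensorOne G A
local notation "q₃" => oneTensor G (G ⊗[ℂ] A) ∘ₗ oneTensor G A

variable (Q ι Γ) in
/-- The element `q_ρ T`, whose slices are `(id ⊗ ψ₁)(q_ρ) Γ(ψ₂)`. -/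
def leftElt : G ⊗[ℂ] A := (p₂ ∘ₗ ι.toLinearMap ◇ p₁) (Q.right.qElt H) * ofSlices Γ

include hT

theorem IsIntertwiner.mul_leg (m : M) : ofSlices Γ * leg lam p₁ (p₂ ∘ₗ ι.toLinearMap) m
    = leg ρ (p₂ ∘ₗ ι.toLinearMap) p₁ m * ofSlices Γ := by
  have := Intertwines.mulPair (γ := ι.toLinearMap) (γ' := ι.toLinearMap) p₁ p₂ hT.intertwines m
  rwa [pos2_mulPair] at this

theorem IsIntertwiner.one_mul : leg ρ (p₂ ∘ₗ ι.toLinearMap) p₁ 1 * ofSlices Γ = ofSlices Γ := by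
  rw [leg_apply, mulPair_eq_comm_rTensor]
  exact hT.right_one_mul

theorem IsIntertwiner.mul_leftElt (m : M) : p₂ (ι m) * leftElt Q ι Γ
    = rightAct H p₁ (leg lam p₁ (p₂ ∘ₗ ι.toLinearMap)) (leftElt Q ι Γ) (Q.right.rho m) :=
  mul_qElt_mul H Q.right p₁ (p₂ ∘ₗ ι.toLinearMap) _ hT.mul_leg m

theorem IsIntertwiner.rightAct_leftElt :
    rightAct H p₁ (leg lam p₁ (p₂ ∘ₗ ι.toLinearMap)) (leftElt Q ι Γ) (Q.right.pElt H)
      = ofSlices Γ :=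
  rightAct_qElt_mul_pElt H Q.right p₁ (p₂ ∘ₗ ι.toLinearMap) _ hT.mul_leg hT.one_mul

/-- The relation `m L = L ◁ ρ(m)` at `m = 1`, where `ι` is unital, gives `L = L ◁ ρ(1)`. -/
theorem IsIntertwiner.muL_comp_projL :
    muL ι Γ (qRho H Q) ∘ₗ projL H Q = muL ι Γ (qRho H Q) := by
  refine LinearMap.ext fun y => ?_
  rw [LinearMap.comp_apply, muL_eq, muL_eq, mulPair_projL]
  have := hT.mul_leftElt 1
  rw [map_one, Unital.map_one, _root_.one_mul] at this
  rw [leftElt] at this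
  rw [← this]

omit hT in
theorem muL_tmul (ψ : Module.Dual ℂ G) (m : M) :
    muL ι Γ (qRho H Q) (ψ ⊗ₜ m) = evalFst A ψ (leftElt Q ι Γ) * ι m := by
  rw [muL_eq]; rfl

local notation "Ran" => LinearMap.range (muL ι Γ (qRho H Q))

omit hT in
theorem range_muL_induction {P : A → Prop} (h0 : P 0) (hadd : ∀ x y, P x → P y → P (x + y))
    (h : ∀ ψ m, P (evalFst A ψ (leftElt Q ι Γ) * ι m)) : ∀ x ∈ Ran, P x := by
  rintro _ ⟨y, rfl⟩
  induction y with
  | zero => rwa [map_zero]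
  | add x y hx hy => rw [map_add]; exact hadd _ _ hx hy
  | tmul ψ m => rw [muL_tmul]; exact h ψ m

omit hT in
theorem leftElt_mem_slicesIn : leftElt Q ι Γ ∈ slicesIn G Ran := fun ψ =>
  ⟨ψ ⊗ₜ 1, by rw [muL_tmul, map_one, _root_.mul_one]⟩

omit hT in
theorem range_muL_mul (m : M) : ∀ x ∈ Ran, x * ι m ∈ Ran := by
  refine range_muL_induction ?_ ?_ fun ψ n => ?_
  · rw [zero_mul]; exact Submodule.zero_mem _
  · intro x y hx hy; rw [add_mul]; exact Submodule.add_mem _ hx hy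
  · exact ⟨ψ ⊗ₜ (n * m), by rw [muL_tmul, map_mul, mul_assoc]⟩

omit hT in
theorem rightAct_leftElt_mem (w : M ⊗[ℂ] G) : rightAct H p₁ (leg lam p₁ (p₂ ∘ₗ ι.toLinearMap))
    (leftElt Q ι Γ) w ∈ slicesIn G Ran := by
  have h1 : ∀ n, ∀ x ∈ slicesIn G Ran, x * (p₂ ∘ₗ ι.toLinearMap) n ∈ slicesIn G Ran :=
    fun n => mul_oneTensor_mem_slicesIn (range_muL_mul (H := H) (Q := Q) (Γ := Γ) n)
  have h2 := mul_tensorOne_mem_slicesIn (G := G) (U := Ran)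
  have h3 := tensorOne_mul_mem_slicesIn (G := G) (U := Ran)
  have h4 := leftElt_mem_slicesIn (H := H) (Q := Q) (ι := ι) (Γ := Γ)
  exact rightAct_mem H (j := p₁) (r := leg lam p₁ (p₂ ∘ₗ ι.toLinearMap)) h3
    (fun m => mul_mulPair_mem (f := p₁) (g := p₂ ∘ₗ ι.toLinearMap) h2 h1 (Q.left.lam m)) h4 w

/-- `ι m` times a slice of `L` is a slice of `L ◁ ρ(m)`. Multiplying by `G` on either side only
changes the functional, and elements of `M` arrive on the right, where the range is stable. -/
theorem IsIntertwiner.mul_range_muL (m : M) : ∀ x ∈ Ran, ι m * x ∈ Ran := by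
  refine range_muL_induction ?_ ?_ fun ψ n => ?_
  · rw [mul_zero]; exact Submodule.zero_mem _
  · intro x y hx hy; rw [mul_add]; exact Submodule.add_mem _ hx hy
  · rw [← mul_assoc, ← evalFst_oneTensor_mul, hT.mul_leftElt]
    exact range_muL_mul n _ (rightAct_leftElt_mem _ ψ)

theorem IsIntertwiner.ofSlices_mem_slicesIn : ofSlices Γ ∈ slicesIn G Ran := by
  rw [← hT.rightAct_leftElt]
  exact rightAct_leftElt_mem _

/-- The straightening rule: a product with two factors `T` is rewritten with a single one.
`recover_of_composite` expresses it through the composite of `T` with `L ◁ p_ρ = T`, which coherence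
turns into one copy of `T` under the coproduct. -/
theorem IsIntertwiner.slice_mul_leftElt_eq : (q₁ ◇ q₃) (ofSlices Γ) * (q₂ ◇ q₃) (leftElt Q ι Γ)
    = rightAct₃ H q₂ q₁ (leg lam q₂ (q₃ ∘ₗ ι.toLinearMap))
      ((leg ρ (q₃ ∘ₗ ι.toLinearMap) q₁ ◇ q₂) (Q.right.qElt H)
        * ((q₃ ∘ₗ ι.toLinearMap ◇ q₁ ◇ q₂) Q.right.φInv
          * (leg Δ q₁ q₂ ◇ q₃) (ofSlices Γ)
          * (q₁ ◇ q₂ ◇ q₃ ∘ₗ ι.toLinearMap) Q.left.φInv)) Q.φInv := by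
  have hI : Intertwines Q ι.toLinearMap ι.toLinearMap (ofSlices Γ) := hT.intertwines
  have h1 : ∀ (i : G →ₗ[ℂ] G ⊗[ℂ] (G ⊗[ℂ] A)) [IsMul i] [Comm i q₃],
      leg ρ (q₃ ∘ₗ ι.toLinearMap) i 1 * (i ◇ q₃) (ofSlices Γ) = (i ◇ q₃) (ofSlices Γ) := by
    intro i _ _
    have := congrArg (i ◇ q₃) hT.right_one_mul
    rwa [IsMul.map_mul, mulPair_comm, mulPair_rTensor] at this
  have h2 := fun m => hI.mulPair q₂ q₃ m
  have hL : (q₂ ◇ q₃) (leftElt Q ι Γ)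
      = (q₃ ∘ₗ ι.toLinearMap ◇ q₂) (Q.right.qElt H) * (q₂ ◇ q₃) (ofSlices Γ) := by
    rw [leftElt, IsMul.map_mul, mulPair_comp (q₂ ◇ q₃) IsMul.map_mul,
      mulPair_comp_tensorOne, ← LinearMap.comp_assoc, mulPair_comp_oneTensor]
  have h3 := recover_of_composite H Q q₂ q₁ (q₃ ∘ₗ ι.toLinearMap)
    (leg lam q₂ (q₃ ∘ₗ ι.toLinearMap)) (L := (q₂ ◇ q₃) (leftElt Q ι Γ))
    (T := (q₁ ◇ q₃) (ofSlices Γ)) (l := leg ρ (q₃ ∘ₗ ι.toLinearMap) q₁)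
    (by rw [hL]; exact mul_qElt_mul H Q.right q₂ (q₃ ∘ₗ ι.toLinearMap) _ h2)
    (fun a => commute_mulPair (fun x => Comm.commute a x) (fun x => Comm.commute a x) _)
    (fun a => commute_mulPair (fun x => Comm.commute a x) (fun x => Comm.commute a x) _)
    (fun m => hI.mulPair q₁ q₃ m) (h1 q₁)
  have h4 : rightAct H q₂ (leg lam q₂ (q₃ ∘ₗ ι.toLinearMap)) ((q₂ ◇ q₃) (leftElt Q ι Γ))
      (Q.right.pElt H) = (q₂ ◇ q₃) (ofSlices Γ) := by
    rw [hL]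
    exact rightAct_qElt_mul_pElt H Q.right q₂ (q₃ ∘ₗ ι.toLinearMap) _ h2 (h1 q₂)
  rw [h3, h4]
  congr 2
  exact congrArg _ (hT.fuse_eq q₁ q₂ q₃)

theorem IsIntertwiner.slice_mul_leftElt_mem :
    (q₁ ◇ q₃) (ofSlices Γ) * (q₂ ◇ q₃) (leftElt Q ι Γ) ∈ slicesIn G (slicesIn G Ran) := by
  rw [hT.slice_mul_leftElt_eq]
  have l1 := fun a => tensorOne_mul_mem_slicesIn (G := G) (U := slicesIn G Ran) a
  have r1 := fun a => mul_tensorOne_mem_slicesIn (G := G) (U := slicesIn G Ran) a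
  have l2 : ∀ a, ∀ x ∈ slicesIn G (slicesIn G Ran), q₂ a * x ∈ slicesIn G (slicesIn G Ran) :=
    fun a => oneTensor_mul_mem_slicesIn (tensorOne_mul_mem_slicesIn a)
  have r2 : ∀ a, ∀ x ∈ slicesIn G (slicesIn G Ran), x * q₂ a ∈ slicesIn G (slicesIn G Ran) :=
    fun a => mul_oneTensor_mem_slicesIn (mul_tensorOne_mem_slicesIn a)
  have l3 : ∀ m, ∀ x ∈ slicesIn G (slicesIn G Ran),
      (q₃ ∘ₗ ι.toLinearMap) m * x ∈ slicesIn G (slicesIn G Ran) :=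
    fun m => oneTensor_mul_mem_slicesIn (oneTensor_mul_mem_slicesIn (hT.mul_range_muL m))
  have r3 : ∀ m, ∀ x ∈ slicesIn G (slicesIn G Ran),
      x * (q₃ ∘ₗ ι.toLinearMap) m ∈ slicesIn G (slicesIn G Ran) :=
    fun m => mul_oneTensor_mem_slicesIn (mul_oneTensor_mem_slicesIn (range_muL_mul m))
  refine rightAct₃_mem H (j := q₂) (k := q₁) (r := leg lam q₂ (q₃ ∘ₗ ι.toLinearMap)) l2 r1
    (fun m => mul_mulPair_mem (f := q₂) (g := q₃ ∘ₗ ι.toLinearMap) r2 r3 (Q.left.lam m)) ?_ _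
  refine mulPair_mul_mem (f := leg ρ (q₃ ∘ₗ ι.toLinearMap) q₁) (g := q₂)
    (fun m => mulPair_mul_mem (f := q₃ ∘ₗ ι.toLinearMap) (g := q₁) l3 l1 (Q.right.rho m)) l2 _ _ ?_
  refine mul_mulPair_mem (f := q₁) (g := q₂ ◇ q₃ ∘ₗ ι.toLinearMap) r1
    (mul_mulPair_mem (f := q₂) (g := q₃ ∘ₗ ι.toLinearMap) r2 r3) _ _ ?_
  refine mulPair_mul_mem (f := q₃ ∘ₗ ι.toLinearMap) (g := q₁ ◇ q₂) l3
    (mulPair_mul_mem (f := q₁) (g := q₂) l1 l2) _ _ ?_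
  rw [← mulPair_splitFst]
  have := splitFst_mem_slicesIn Δ hT.ofSlices_mem_slicesIn
  rwa [pos3_mulPair]

theorem IsIntertwiner.slices_mul_range_muL (ψ : Module.Dual ℂ G) : ∀ x ∈ Ran, Γ ψ * x ∈ Ran := by
  refine range_muL_induction ?_ ?_ fun χ n => ?_
  · rw [mul_zero]; exact Submodule.zero_mem _
  · intro x y hx hy; rw [mul_add]; exact Submodule.add_mem _ hx hy
  · rw [← mul_assoc, ← evalFst_ofSlices Γ ψ, ← evalFst_evalFst_mul]
    exact range_muL_mul n _ (hT.slice_mul_leftElt_mem ψ χ)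

/-- The range is stable under left multiplication by the generators, so it is a left ideal. It
contains `1`, which is the `ε`-slice of `T`. -/
theorem IsIntertwiner.surjective_muL
    (hgen : Algebra.adjoin ℂ (Set.range ι ∪ Set.range Γ) = ⊤) :
    Function.Surjective (muL ι Γ (qRho H Q)) := by
  have h1 : ∀ a : A, ∀ x ∈ Ran, a * x ∈ Ran := by
    intro a
    have ha : a ∈ Algebra.adjoin ℂ (Set.range ι ∪ Set.range Γ) := by rw [hgen]; trivial
    induction ha using Algebra.adjoin_induction with
    | mem a ha =>
      rcases ha with ⟨m, rfl⟩ | ⟨ψ, rfl⟩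
      · exact hT.mul_range_muL m
      · exact hT.slices_mul_range_muL ψ
    | algebraMap c => intro x hx; rw [← Algebra.smul_def]; exact Submodule.smul_mem _ c hx
    | add a b _ _ ha hb =>
      intro x hx; rw [add_mul]; exact Submodule.add_mem _ (ha x hx) (hb x hx)
    | mul a b _ _ ha hb => intro x hx; rw [mul_assoc]; exact ha _ (hb x hx)
  have h2 : (1 : A) ∈ Ran := by
    have := hT.ofSlices_mem_slicesIn H.ε.toLinearMap
    rw [hT.normal] at this
    rw [show (ι : M →ₙₐ[ℂ] A) 1 = 1 from map_one ι] at this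
    exact this
  exact fun a => LinearMap.mem_range.1 (by simpa only [_root_.mul_one] using h1 a 1 h2)

end Surjective

end


/-! ### Functoriality of intertwiners, and the extension by generators and relations -/

section

variable {G : Type u} [Ring G] [Algebra ℂ G] {M : Type v} [Ring M] [Algebra ℂ M]
  {A : Type w} [Ring A] [Algebra ℂ A] {A' : Type*} [Ring A'] [Algebra ℂ A']

section Natural

variable {H : WeakQuasiBialgebra G} (Q : QuasiCommutingPair H M)

/-- `T λ_γ(m)`. -/
def mulLeft (γ : M →ₗ[ℂ] A) (T : G ⊗[ℂ] A) (m : M) : G ⊗[ℂ] A :=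
  T * γ.lTensor G (Q.left.lam m)

/-- `ρ_γ^op(m) T`. -/
def rightMul (γ : M →ₗ[ℂ] A) (T : G ⊗[ℂ] A) (m : M) : G ⊗[ℂ] A :=
  TensorProduct.comm ℂ A G (γ.rTensor G (Q.right.rho m)) * T

/-- The left hand side of the coherence condition. -/
def cohere (γ : M →ₗ[ℂ] A) (T : G ⊗[ℂ] A) : G ⊗[ℂ] (G ⊗[ℂ] A) :=
  LinearMap.lTensor G (γ.lTensor G)
      (TensorProduct.assoc ℂ G G M (TensorProduct.comm ℂ M (G ⊗[ℂ] G) Q.right.φ))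
    * LinearMap.lTensor G (TensorProduct.mk ℂ G A 1) T
    * LinearMap.lTensor G (γ.lTensor G)
      (LinearMap.lTensor G (TensorProduct.comm ℂ M G).toLinearMap Q.φInv)
    * ((1 : G) ⊗ₜ[ℂ] T)
    * LinearMap.lTensor G (γ.lTensor G) Q.left.φ

theorem isIntertwiner_iff {γ : M →ₙₐ[ℂ] A} {T : G ⊗[ℂ] A} : IsIntertwiner Q γ T ↔
    evalFst A H.ε.toLinearMap T = γ 1 ∧
    (∀ m, mulLeft Q (γ : M →ₗ[ℂ] A) T m = rightMul Q (γ : M →ₗ[ℂ] A) T m) ∧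
    mulLeft Q (γ : M →ₗ[ℂ] A) T 1 = T ∧ rightMul Q (γ : M →ₗ[ℂ] A) T 1 = T ∧
    cohere Q (γ : M →ₗ[ℂ] A) T = splitFst A (H.Δ : G →ₗ[ℂ] G ⊗[ℂ] G) T :=
  ⟨fun h => ⟨h.1, h.2, h.3, h.4, h.5⟩, fun h => ⟨h.1, h.2.1, h.2.2.1, h.2.2.2.1, h.2.2.2.2⟩⟩

variable (γ : M →ₗ[ℂ] A) (T : G ⊗[ℂ] A) (g : A →ₗ[ℂ] A')

theorem lTensor_rTensor_comm (x : M ⊗[ℂ] G) :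
    g.lTensor G (TensorProduct.comm ℂ A G (γ.rTensor G x))
      = TensorProduct.comm ℂ A' G ((g ∘ₗ γ).rTensor G x) := by
  induction x with
  | zero => simp
  | add x y hx hy => simp only [map_add, hx, hy]
  | tmul a c => simp

theorem lTensor_lTensor_splitFst (u : G →ₗ[ℂ] G ⊗[ℂ] G) (x : G ⊗[ℂ] A) :
    LinearMap.lTensor G (g.lTensor G) (splitFst A u x) = splitFst A' u (g.lTensor G x) := by
  induction x with
  | zero => simp
  | add x y hx hy => simp only [map_add, hx, hy]
  | tmul a c =>
    have : ∀ w : G ⊗[ℂ] G, LinearMap.lTensor G (g.lTensor G)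
        (TensorProduct.assoc ℂ G G A (w ⊗ₜ c)) = TensorProduct.assoc ℂ G G A' (w ⊗ₜ g c) := by
      intro w
      induction w with
      | zero => simp
      | add x y hx hy => simp only [TensorProduct.add_tmul, map_add, hx, hy]
      | tmul a b => simp
    exact this (u a)

theorem lTensor_lTensor_lTensor (x : G ⊗[ℂ] (G ⊗[ℂ] M)) :
    LinearMap.lTensor G (g.lTensor G) (LinearMap.lTensor G (γ.lTensor G) x)
      = LinearMap.lTensor G ((g ∘ₗ γ).lTensor G) x := by
  rw [← LinearMap.comp_apply, ← LinearMap.lTensor_comp, ← LinearMap.lTensor_comp]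

theorem lTensor_lTensor_mk : LinearMap.lTensor G (g.lTensor G)
    (LinearMap.lTensor G (TensorProduct.mk ℂ G A 1) T)
      = LinearMap.lTensor G (TensorProduct.mk ℂ G A' 1) (g.lTensor G T) := by
  rw [← LinearMap.comp_apply, ← LinearMap.comp_apply, ← LinearMap.lTensor_comp,
    ← LinearMap.lTensor_comp]
  rfl

variable [IsMul g]

theorem lTensor_mulLeft (m : M) :
    g.lTensor G (mulLeft Q γ T m) = mulLeft Q (g ∘ₗ γ) (g.lTensor G T) m := by
  rw [mulLeft, IsMul.map_mul, ← LinearMap.comp_apply (g.lTensor G), ← LinearMap.lTensor_comp,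
    mulLeft]

theorem lTensor_rightMul (m : M) :
    g.lTensor G (rightMul Q γ T m) = rightMul Q (g ∘ₗ γ) (g.lTensor G T) m := by
  rw [rightMul, IsMul.map_mul, lTensor_rTensor_comm, rightMul]

theorem lTensor_cohere : LinearMap.lTensor G (g.lTensor G) (cohere Q γ T)
    = cohere Q (g ∘ₗ γ) (g.lTensor G T) := by
  rw [cohere]
  simp only [IsMul.map_mul (f := LinearMap.lTensor G (g.lTensor G)), lTensor_lTensor_lTensor,
    lTensor_lTensor_mk, LinearMap.lTensor_tmul]
  rfl

variable {Q}

theorem IsIntertwiner.map {γ : M →ₙₐ[ℂ] A} {T : G ⊗[ℂ] A} (h : IsIntertwiner Q γ T)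
    (g : A →ₙₐ[ℂ] A') {γ' : M →ₙₐ[ℂ] A'} (hγ : ∀ m, g (γ m) = γ' m) :
    IsIntertwiner Q γ' (LinearMap.lTensor G (g : A →ₗ[ℂ] A') T) := by
  have hc : (γ' : M →ₗ[ℂ] A') = (g : A →ₗ[ℂ] A') ∘ₗ (γ : M →ₗ[ℂ] A) :=
    LinearMap.ext fun m => (hγ m).symm
  rw [isIntertwiner_iff] at h ⊢
  obtain ⟨h1, h2, h3, h4, h5⟩ := h
  rw [hc]
  refine ⟨?_, fun m => ?_, ?_, ?_, ?_⟩
  · rw [evalFst_lTensor, h1]; exact hγ 1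
  · rw [← lTensor_mulLeft, ← lTensor_rightMul, h2]
  · rw [← lTensor_mulLeft, h3]
  · rw [← lTensor_rightMul, h4]
  · rw [← lTensor_cohere, h5, lTensor_lTensor_splitFst]

variable [FiniteDimensional ℂ G]

theorem lTensor_injective_of {W W' : Type*} [AddCommGroup W] [Module ℂ W] [AddCommGroup W']
    [Module ℂ W'] {g : W →ₗ[ℂ] W'} (hg : Function.Injective g) :
    Function.Injective (g.lTensor G) := fun x y h => eq_of_evalFst fun f => hg <| by
  rw [← evalFst_lTensor, ← evalFst_lTensor, h]

/-- Each condition is natural in the target algebra, and an injective `g` stays injective after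
tensoring with copies of `G`, as tensors are determined by their slices. -/
theorem IsIntertwiner.of_map {γ : M →ₙₐ[ℂ] A} {T : G ⊗[ℂ] A} (g : A →ₙₐ[ℂ] A')
    (hg : Function.Injective g) {γ' : M →ₙₐ[ℂ] A'} (hγ : ∀ m, g (γ m) = γ' m)
    (h : IsIntertwiner Q γ' (LinearMap.lTensor G (g : A →ₗ[ℂ] A') T)) : IsIntertwiner Q γ T := by
  have hc : (γ' : M →ₗ[ℂ] A') = (g : A →ₗ[ℂ] A') ∘ₗ (γ : M →ₗ[ℂ] A) :=
    LinearMap.ext fun m => (hγ m).symm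
  have hl : Function.Injective (LinearMap.lTensor G (g : A →ₗ[ℂ] A')) :=
    lTensor_injective_of (g := (g : A →ₗ[ℂ] A')) hg
  have hll := lTensor_injective_of (G := G) hl
  rw [isIntertwiner_iff] at h ⊢
  obtain ⟨h1, h2, h3, h4, h5⟩ := h
  rw [hc] at h2 h3 h4 h5
  refine ⟨hg ?_, fun m => hl ?_, hl ?_, hl ?_, hll ?_⟩
  · rw [← linearMap_apply g, ← evalFst_lTensor, h1, hγ]
  · rw [lTensor_mulLeft, lTensor_rightMul, h2]
  · rw [lTensor_mulLeft, h3]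
  · rw [lTensor_rightMul, h4]
  · rw [lTensor_cohere, h5, lTensor_lTensor_splitFst]

end Natural

section Construction

variable [FiniteDimensional ℂ G] {H : WeakQuasiBialgebra G} (Q : QuasiCommutingPair H M)

variable (G M) in
/-- The free algebra on `M` and the dual of `G`. -/
abbrev FreeExt := TensorAlgebra ℂ (M × Module.Dual ℂ G)

variable (G M) in
/-- The embedding of `M` into the free algebra. -/
def freeLeft : M →ₗ[ℂ] FreeExt G M := TensorAlgebra.ι ℂ ∘ₗ LinearMap.inl ℂ M _

variable (G M) in
/-- The element of `G ⊗ FreeExt` whose slices are the generators from the dual of `G`. -/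
def freeElt : G ⊗[ℂ] FreeExt G M := ofSlices (TensorAlgebra.ι ℂ ∘ₗ LinearMap.inr ℂ M _)

/-- The relations of the universal extension. -/
inductive ExtRel : FreeExt G M → FreeExt G M → Prop
  | mul (m n : M) : ExtRel (freeLeft G M (m * n)) (freeLeft G M m * freeLeft G M n)
  | one : ExtRel (freeLeft G M 1) 1
  | normal : ExtRel (evalFst _ H.ε.toLinearMap (freeElt G M)) (freeLeft G M 1)
  -- Equations in `G ⊗ FreeExt` and `G ⊗ G ⊗ FreeExt` are imposed slice by slice; nothing is lost
  -- since `G` is finite dimensional.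
  | intertwines (m : M) (f : Module.Dual ℂ G) :
    ExtRel (evalFst _ f (mulLeft Q (freeLeft G M) (freeElt G M) m))
      (evalFst _ f (rightMul Q (freeLeft G M) (freeElt G M) m))
  | mul_left_one (f : Module.Dual ℂ G) :
    ExtRel (evalFst _ f (mulLeft Q (freeLeft G M) (freeElt G M) 1)) (evalFst _ f (freeElt G M))
  | right_one_mul (f : Module.Dual ℂ G) :
    ExtRel (evalFst _ f (rightMul Q (freeLeft G M) (freeElt G M) 1)) (evalFst _ f (freeElt G M))
  | coherent (f f' : Module.Dual ℂ G) :
    ExtRel (evalFst _ f' (evalFst _ f (cohere Q (freeLeft G M) (freeElt G M))))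
      (evalFst _ f' (evalFst _ f
        (splitFst _ (H.Δ : G →ₗ[ℂ] G ⊗[ℂ] G) (freeElt G M))))

/-- The universal extension of `M`. -/
abbrev UnivExt := RingQuot (ExtRel Q)

/-- The inclusion of `M` into the universal extension. -/
def univLeft : M →ₐ[ℂ] UnivExt Q :=
  AlgHom.ofLinearMap ((RingQuot.mkAlgHom ℂ (ExtRel Q)).toLinearMap ∘ₗ freeLeft G M)
    ((RingQuot.mkAlgHom_rel ℂ (.one (Q := Q))).trans (map_one _))
    (fun m n => (RingQuot.mkAlgHom_rel ℂ (.mul (Q := Q) m n)).trans (map_mul _ _ _))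

/-- The generators of the universal extension from the dual of `G`. -/
def univSlices : Module.Dual ℂ G →ₗ[ℂ] UnivExt Q :=
  (RingQuot.mkAlgHom ℂ (ExtRel Q)).toLinearMap ∘ₗ TensorAlgebra.ι ℂ ∘ₗ LinearMap.inr ℂ M _

theorem lTensor_freeElt : LinearMap.lTensor G (RingQuot.mkAlgHom ℂ (ExtRel Q)).toLinearMap
    (freeElt G M) = ofSlices (univSlices Q) :=
  eq_of_evalFst fun f => by rw [evalFst_lTensor, freeElt, evalFst_ofSlices, evalFst_ofSlices]; rfl

theorem isIntertwiner_univSlices :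
    IsIntertwiner Q (univLeft Q : M →ₙₐ[ℂ] UnivExt Q) (ofSlices (univSlices Q)) := by
  rw [isIntertwiner_iff]
  have hc : ((univLeft Q : M →ₙₐ[ℂ] UnivExt Q) : M →ₗ[ℂ] UnivExt Q)
      = (RingQuot.mkAlgHom ℂ (ExtRel Q)).toLinearMap ∘ₗ freeLeft G M := rfl
  rw [← lTensor_freeElt, hc]
  refine ⟨?_, fun m => eq_of_evalFst fun f => ?_, eq_of_evalFst fun f => ?_,
    eq_of_evalFst fun f => ?_, eq_of_evalFst fun f => eq_of_evalFst fun f' => ?_⟩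
  · rw [evalFst_lTensor]; exact RingQuot.mkAlgHom_rel ℂ .normal
  · rw [← lTensor_mulLeft, ← lTensor_rightMul, evalFst_lTensor, evalFst_lTensor]
    exact RingQuot.mkAlgHom_rel ℂ (.intertwines m f)
  · rw [← lTensor_mulLeft, evalFst_lTensor, evalFst_lTensor]
    exact RingQuot.mkAlgHom_rel ℂ (.mul_left_one f)
  · rw [← lTensor_rightMul, evalFst_lTensor, evalFst_lTensor]
    exact RingQuot.mkAlgHom_rel ℂ (.right_one_mul f)
  · rw [← lTensor_cohere, ← lTensor_lTensor_splitFst]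
    simp only [evalFst_lTensor]
    exact RingQuot.mkAlgHom_rel ℂ (.coherent f f')

theorem adjoin_univ : Algebra.adjoin ℂ (Set.range (univLeft Q) ∪ Set.range (univSlices Q)) = ⊤ := by
  refine eq_top_iff.2 fun x _ => ?_
  obtain ⟨x, rfl⟩ := RingQuot.mkAlgHom_surjective ℂ (ExtRel Q) x
  induction x using TensorAlgebra.induction with
  | algebraMap c => rw [AlgHom.commutes]; exact Subalgebra.algebraMap_mem _ c
  | ι p =>
    have : RingQuot.mkAlgHom ℂ (ExtRel Q) (TensorAlgebra.ι ℂ p)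
        = univLeft Q p.1 + univSlices Q p.2 := by
      rw [← Prod.fst_add_snd p]
      change _ = RingQuot.mkAlgHom ℂ (ExtRel Q) (TensorAlgebra.ι ℂ _)
        + RingQuot.mkAlgHom ℂ (ExtRel Q) (TensorAlgebra.ι ℂ _)
      rw [← map_add, ← map_add]
      simp
    rw [this]
    exact Subalgebra.add_mem _ (Algebra.subset_adjoin (.inl ⟨_, rfl⟩))
      (Algebra.subset_adjoin (.inr ⟨_, rfl⟩))
  | mul a b ha hb => rw [map_mul]; exact Subalgebra.mul_mem _ (ha trivial) (hb trivial)
  | add a b ha hb => rw [map_add]; exact Subalgebra.add_mem _ (ha trivial) (hb trivial)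

theorem exists_univ_lift (γ : M →ₐ[ℂ] A) (T : G ⊗[ℂ] A)
    (hT : IsIntertwiner Q (γ : M →ₙₐ[ℂ] A) T) :
    ∃ g : UnivExt Q →ₐ[ℂ] A,
      (∀ m, g (univLeft Q m) = γ m) ∧ ∀ ψ, g (univSlices Q ψ) = evalFst A ψ T := by
  rw [isIntertwiner_iff] at hT
  obtain ⟨h1, h2, h3, h4, h5⟩ := hT
  let F : FreeExt G M →ₐ[ℂ] A := TensorAlgebra.lift ℂ (γ.toLinearMap.coprod (sliceFst T))
  have hF : F.toLinearMap ∘ₗ freeLeft G M = γ.toLinearMap := by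
    ext m; simpa [F, freeLeft] using (sliceFst T).map_zero
  have hFm (m : M) : F (freeLeft G M m) = γ m := LinearMap.congr_fun hF m
  have hFs (ψ : Module.Dual ℂ G) : F (TensorAlgebra.ι ℂ (0, ψ)) = evalFst A ψ T := by simp [F]
  have hFT : LinearMap.lTensor G F.toLinearMap (freeElt G M) = T :=
    eq_of_evalFst fun f => by
      rw [evalFst_lTensor, freeElt, evalFst_ofSlices]; exact hFs f
  have hγ : ((γ : M →ₙₐ[ℂ] A) : M →ₗ[ℂ] A) = γ.toLinearMap := rfl
  rw [hγ] at h2 h3 h4 h5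
  have key : ∀ ⦃x y⦄, ExtRel Q x y → F x = F y := by
    intro x y h
    induction h with
    | mul m n => rw [map_mul F, hFm, hFm, hFm, map_mul]
    | one => rw [hFm, map_one, map_one]
    | normal =>
      rw [hFm, ← AlgHom.toLinearMap_apply, ← evalFst_lTensor, hFT]; exact h1
    | intertwines m f =>
      rw [← AlgHom.toLinearMap_apply, ← AlgHom.toLinearMap_apply, ← evalFst_lTensor,
        ← evalFst_lTensor, lTensor_mulLeft, lTensor_rightMul, hFT, hF, h2]
    | mul_left_one f =>
      rw [← AlgHom.toLinearMap_apply, ← AlgHom.toLinearMap_apply, ← evalFst_lTensor,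
        ← evalFst_lTensor, lTensor_mulLeft, hFT, hF, h3]
    | right_one_mul f =>
      rw [← AlgHom.toLinearMap_apply, ← AlgHom.toLinearMap_apply, ← evalFst_lTensor,
        ← evalFst_lTensor, lTensor_rightMul, hFT, hF, h4]
    | coherent f f' =>
      have := congrArg (fun z => evalFst A f' (evalFst (G ⊗[ℂ] A) f z)) h5
      rw [← hF, ← hFT, ← lTensor_cohere, ← lTensor_lTensor_splitFst] at this
      simpa only [evalFst_lTensor, AlgHom.toLinearMap_apply] using this
  refine ⟨RingQuot.liftAlgHom ℂ ⟨F, key⟩, fun m => ?_, fun ψ => ?_⟩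
  · rw [← hFm]; exact RingQuot.liftAlgHom_mkAlgHom_apply ℂ F key _
  · rw [← hFs]; exact RingQuot.liftAlgHom_mkAlgHom_apply ℂ F key _

theorem eq_of_eqOn_generators {A₁ A₂ : Type*} [Ring A₁] [Algebra ℂ A₁] [Ring A₂] [Algebra ℂ A₂]
    {ι : M →ₐ[ℂ] A₁} {Γ : Module.Dual ℂ G →ₗ[ℂ] A₁}
    (hgen : Algebra.adjoin ℂ (Set.range ι ∪ Set.range Γ) = ⊤) {g g' : A₁ →ₙₐ[ℂ] A₂}
    (h : ∀ m, g (ι m) = g' (ι m)) (h' : ∀ ψ, g (Γ ψ) = g' (Γ ψ)) : g = g' := by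
  ext x
  have hx : x ∈ Algebra.adjoin ℂ (Set.range ι ∪ Set.range Γ) := by rw [hgen]; trivial
  induction hx using Algebra.adjoin_induction with
  | mem a ha =>
    rcases ha with ⟨m, rfl⟩ | ⟨ψ, rfl⟩
    · exact h m
    · exact h' ψ
  | algebraMap c => rw [Algebra.algebraMap_eq_smul_one, map_smul, map_smul, ← map_one ι, h]
  | add a b _ _ ha hb => rw [map_add, map_add, ha, hb]
  | mul a b _ _ ha hb => rw [map_mul, map_mul, ha, hb]

theorem algHom_ext_of_generators {A₁ A₂ : Type*} [Ring A₁] [Algebra ℂ A₁] [Ring A₂] [Algebra ℂ A₂]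
    {ι : M →ₐ[ℂ] A₁} {Γ : Module.Dual ℂ G →ₗ[ℂ] A₁}
    (hgen : Algebra.adjoin ℂ (Set.range ι ∪ Set.range Γ) = ⊤) {g g' : A₁ →ₐ[ℂ] A₂}
    (h : ∀ m, g (ι m) = g' (ι m)) (h' : ∀ ψ, g (Γ ψ) = g' (Γ ψ)) : g = g' :=
  AlgHom.ext_of_adjoin_eq_top hgen (by rintro _ (⟨m, rfl⟩ | ⟨ψ, rfl⟩); exacts [h m, h' ψ])

end Construction

section Corner

variable {e : A} (he : IsIdempotentElem e)

instance cornerModule : Module ℂ he.Corner where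
  smul c x := ⟨c • x.1, by
    obtain ⟨y, hy⟩ := x.2
    exact ⟨c • y, by rw [← hy]; simp⟩⟩
  one_smul x := Subtype.ext (one_smul ℂ x.1)
  mul_smul c d x := Subtype.ext (mul_smul c d x.1)
  smul_zero c := Subtype.ext (smul_zero c)
  smul_add c x y := Subtype.ext (smul_add c x.1 y.1)
  add_smul c d x := Subtype.ext (add_smul c d x.1)
  zero_smul x := Subtype.ext (zero_smul ℂ x.1)

instance cornerAlgebra : Algebra ℂ he.Corner :=
  Algebra.ofModule (fun c x y => Subtype.ext (smul_mul_assoc c x.1 y.1))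
    (fun c x y => Subtype.ext (mul_smul_comm c x.1 y.1))

/-- The inclusion of a corner. -/
def cornerIncl : he.Corner →ₙₐ[ℂ] A where
  toFun x := x.1
  map_smul' _ _ := rfl
  map_zero' := rfl
  map_add' _ _ := rfl
  map_mul' _ _ := rfl

theorem cornerIncl_injective : Function.Injective (cornerIncl he) := Subtype.val_injective

/-- A linear map with values in a corner. -/
def cornerLift {V : Type*} [AddCommGroup V] [Module ℂ V] (f : V →ₗ[ℂ] A)
    (hf : ∀ v, e * f v = f v ∧ f v * e = f v) : V →ₗ[ℂ] he.Corner where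
  toFun v := ⟨f v, (Subsemigroup.mem_corner_iff he).2 (hf v)⟩
  map_add' _ _ := Subtype.ext (map_add f _ _)
  map_smul' _ _ := Subtype.ext (map_smul f _ _)

variable [FiniteDimensional ℂ G] {H : WeakQuasiBialgebra G} {Q : QuasiCommutingPair H M}

theorem IsIntertwiner.one_mul_slice {γ : M →ₙₐ[ℂ] A} {T : G ⊗[ℂ] A} (hT : IsIntertwiner Q γ T)
    (ψ : Module.Dual ℂ G) : γ 1 * evalFst A ψ T = evalFst A ψ T := by
  have : ∀ x : M ⊗[ℂ] G, oneTensor G A (γ 1)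
      * TensorProduct.comm ℂ A G (LinearMap.rTensor G (γ : M →ₗ[ℂ] A) x)
      = TensorProduct.comm ℂ A G (LinearMap.rTensor G (γ : M →ₗ[ℂ] A) x) := by
    intro x
    induction x with
    | zero => simp
    | add x y hx hy => simp only [map_add, mul_add, hx, hy]
    | tmul m a => simp [← map_mul]
  rw [← evalFst_oneTensor_mul, ← hT.right_one_mul, ← mul_assoc, this]

theorem IsIntertwiner.slice_mul_one {γ : M →ₙₐ[ℂ] A} {T : G ⊗[ℂ] A} (hT : IsIntertwiner Q γ T)
    (ψ : Module.Dual ℂ G) : evalFst A ψ T * γ 1 = evalFst A ψ T := by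
  have : ∀ x : G ⊗[ℂ] M, LinearMap.lTensor G (γ : M →ₗ[ℂ] A) x * oneTensor G A (γ 1)
      = LinearMap.lTensor G (γ : M →ₗ[ℂ] A) x := by
    intro x
    induction x with
    | zero => simp
    | add x y hx hy => simp only [map_add, add_mul, hx, hy]
    | tmul m a => simp [← map_mul]
  rw [← evalFst_mul_oneTensor, ← hT.mul_left_one, mul_assoc, this]

/-- The image of `γ` and the slices of `T` lie in the corner cut out by the idempotent `γ 1`. There
`γ` is unital, the unital lifting applies, and the result is included back into `A`. -/
theorem exists_univ_lift_nonUnital (γ : M →ₙₐ[ℂ] A) (T : G ⊗[ℂ] A) (hT : IsIntertwiner Q γ T) :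
    ∃ g : UnivExt Q →ₙₐ[ℂ] A,
      (∀ m, g (univLeft Q m) = γ m) ∧ ∀ ψ, g (univSlices Q ψ) = evalFst A ψ T := by
  have he : IsIdempotentElem (γ 1) := by rw [IsIdempotentElem, ← map_mul, mul_one]
  let γ' : M →ₐ[ℂ] he.Corner := AlgHom.ofLinearMap
    (cornerLift he (γ : M →ₗ[ℂ] A) (fun m => by
      simp only [linearMap_apply]; rw [← map_mul, ← map_mul, one_mul, mul_one]; exact ⟨rfl, rfl⟩))
    rfl (fun m n => Subtype.ext (map_mul γ m n))
  let T' : G ⊗[ℂ] he.Corner := ofSlices (cornerLift he (sliceFst T)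
    fun ψ => ⟨hT.one_mul_slice ψ, hT.slice_mul_one ψ⟩)
  have hT' : LinearMap.lTensor G (cornerIncl he : he.Corner →ₗ[ℂ] A) T' = T :=
    eq_of_evalFst fun ψ => by
      rw [evalFst_lTensor, evalFst_ofSlices]; rfl
  have hI : IsIntertwiner Q (γ' : M →ₙₐ[ℂ] he.Corner) T' := by
    refine IsIntertwiner.of_map (cornerIncl he) (cornerIncl_injective he) (γ' := γ)
      (fun m => rfl) ?_
    rw [hT']; exact hT
  obtain ⟨g, hg, hg'⟩ := exists_univ_lift Q γ' T' hI
  refine ⟨(cornerIncl he).comp (g : UnivExt Q →ₙₐ[ℂ] he.Corner), fun m => ?_, fun ψ => ?_⟩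
  · exact congrArg Subtype.val (hg m)
  · refine (congrArg Subtype.val (hg' ψ)).trans ?_
    rw [evalFst_ofSlices]; rfl

end Corner

section Universal

variable [FiniteDimensional ℂ G] {H : WeakQuasiBialgebra G} (Q : QuasiCommutingPair H M)

theorem hasNonUnitalCorrespondence_univ :
    HasNonUnitalCorrespondence.{u, v, w} Q (univLeft Q) (univSlices Q) := by
  intro A _ _ γ
  refine ⟨fun T hT => ?_, fun g hg => ?_⟩
  · obtain ⟨g, hg, hg'⟩ := exists_univ_lift_nonUnital γ T hT
    refine ⟨g, ⟨hg, hg'⟩, fun f hf => eq_of_eqOn_generators (adjoin_univ Q) (fun m => ?_) fun ψ => ?_⟩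
    · rw [hg, hf.1]
    · rw [hg', hf.2]
  · have h : ∀ ψ, g (univSlices Q ψ)
        = evalFst A ψ (LinearMap.lTensor G (g : UnivExt Q →ₗ[ℂ] A) (ofSlices (univSlices Q))) :=
      fun ψ => by rw [evalFst_lTensor, evalFst_ofSlices]; rfl
    refine ⟨_, ⟨(isIntertwiner_univSlices Q).map g hg, h⟩, fun T hT => eq_of_evalFst fun ψ => ?_⟩
    rw [← h, hT.2]

theorem isUniversalExtension_univ (hinj : Function.Injective (univLeft Q)) :
    IsUniversalExtension.{u, v, w} Q (univLeft Q) (univSlices Q) where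
  injective := hinj
  generated := adjoin_univ Q
  exists_extension A _ _ γ T hT := by
    obtain ⟨g, hg, hg'⟩ := exists_univ_lift Q γ T hT
    exact ⟨g, ⟨hg, hg'⟩, fun f hf => algHom_ext_of_generators (adjoin_univ Q)
      (fun m => (hf.1 m).trans (hg m).symm) fun ψ => (hf.2 ψ).trans (hg' ψ).symm⟩
  exists_intertwiner A _ _ γ g hg :=
    (hasNonUnitalCorrespondence_univ Q A (γ : M →ₙₐ[ℂ] A)).2 (g : UnivExt Q →ₙₐ[ℂ] A) hg

end Universal

end


/-! ### Uniqueness, the kernel of `μ_L`, and projections -/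

section

variable {G : Type u} [Ring G] [Algebra ℂ G] {M : Type v} [Ring M] [Algebra ℂ M]
  [FiniteDimensional ℂ G]

section Unique

variable {H : WeakQuasiBialgebra G} (Q : QuasiCommutingPair H M)

theorem exists_hom_to_univ {M₂ : Type (max u v w)} [Ring M₂] [Algebra ℂ M₂] {ι₂ : M →ₐ[ℂ] M₂}
    {Γ₂ : Module.Dual ℂ G →ₗ[ℂ] M₂} (h : IsUniversalExtension.{u, v, max u v w} Q ι₂ Γ₂) :
    ∃ g : M₂ →ₐ[ℂ] UnivExt Q, (∀ m, g (ι₂ m) = univLeft Q m) ∧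
      ∀ ψ, g (Γ₂ ψ) = univSlices Q ψ := by
  -- The universal property of `M₂` only tests algebras in the universe `max u v w`, while the
  -- constructed extension lives in `max u v`.
  let e : ULift.{max u v w} (UnivExt Q) ≃ₐ[ℂ] UnivExt Q := ULift.algEquiv
  let up : UnivExt Q →ₐ[ℂ] ULift.{max u v w} (UnivExt Q) := e.symm.toAlgHom
  have hup := (isIntertwiner_univSlices Q).map
    (up : UnivExt Q →ₙₐ[ℂ] ULift.{max u v w} (UnivExt Q))
    (γ' := ((up.comp (univLeft Q) : M →ₐ[ℂ] ULift.{max u v w} (UnivExt Q)) :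
      M →ₙₐ[ℂ] ULift.{max u v w} (UnivExt Q))) fun _ => rfl
  obtain ⟨g, ⟨hg, hg'⟩, -⟩ := h.exists_extension _ (up.comp (univLeft Q)) _ hup
  refine ⟨e.toAlgHom.comp g, fun m => congrArg ULift.down (hg m), fun ψ => ?_⟩
  have : g (Γ₂ ψ) = up (univSlices Q ψ) := by
    rw [hg', evalFst_lTensor, evalFst_ofSlices]; rfl
  exact congrArg ULift.down this

theorem existsUnique_equiv_univ {M₂ : Type (max u v w)} [Ring M₂] [Algebra ℂ M₂] {ι₂ : M →ₐ[ℂ] M₂}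
    {Γ₂ : Module.Dual ℂ G →ₗ[ℂ] M₂} (h : IsUniversalExtension.{u, v, max u v w} Q ι₂ Γ₂) :
    ∃! f : UnivExt Q ≃ₐ[ℂ] M₂,
      (∀ m, f (univLeft Q m) = ι₂ m) ∧ ∀ ψ, Γ₂ ψ = f (univSlices Q ψ) := by
  obtain ⟨T₂, ⟨hT₂, hΓ₂⟩, -⟩ := h.exists_intertwiner M₂ ι₂ (AlgHom.id ℂ M₂) fun _ => rfl
  obtain ⟨f, hf, hf'⟩ := exists_univ_lift Q ι₂ T₂ hT₂
  obtain ⟨g, hg, hg'⟩ := exists_hom_to_univ Q h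
  have hfΓ : ∀ ψ, f (univSlices Q ψ) = Γ₂ ψ := fun ψ => (hf' ψ).trans (hΓ₂ ψ).symm
  have h1 : g.comp f = AlgHom.id ℂ (UnivExt Q) := algHom_ext_of_generators (adjoin_univ Q)
    (fun m => (congrArg g (hf m)).trans (hg m)) (fun ψ => (congrArg g (hfΓ ψ)).trans (hg' ψ))
  have h2 : f.comp g = AlgHom.id ℂ M₂ := algHom_ext_of_generators h.generated
    (fun m => (congrArg f (hg m)).trans (hf m)) (fun ψ => (congrArg f (hg' ψ)).trans (hfΓ ψ))
  refine ⟨AlgEquiv.ofAlgHom f g h2 h1, ⟨hf, fun ψ => (hfΓ ψ).symm⟩, fun e he => ?_⟩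
  have h3 : (e : UnivExt Q →ₐ[ℂ] M₂) = f := algHom_ext_of_generators (adjoin_univ Q)
    (fun m => (he.1 m).trans (hf m).symm) (fun ψ => (he.2 ψ).symm.trans (hfΓ ψ).symm)
  exact AlgEquiv.ext fun x => DFunLike.congr_fun h3 x

end Unique

section Projection

theorem bijective_domRestrict_range {V W : Type*} [AddCommGroup V] [Module ℂ V] [AddCommGroup W]
    [Module ℂ W] {f : V →ₗ[ℂ] W} {p : V →ₗ[ℂ] V} (hp : p ∘ₗ p = p) (hf : Function.Surjective f)
    (hk : LinearMap.ker f = LinearMap.ker p) :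
    Function.Bijective (f.domRestrict (LinearMap.range p)) := by
  have hpp : ∀ x, p (p x) = p x := LinearMap.congr_fun hp
  have hfp : ∀ x, f (p x) = f x := fun x => by
    rw [← sub_eq_zero, ← map_sub, ← LinearMap.mem_ker, hk, LinearMap.mem_ker, map_sub, hpp,
      sub_self]
  refine ⟨(injective_iff_map_eq_zero _).2 ?_, fun y => ?_⟩
  · rintro ⟨_, x, rfl⟩ hx
    have : p x ∈ LinearMap.ker f := hx
    rw [hk, LinearMap.mem_ker, hpp] at this
    exact Subtype.ext this
  · obtain ⟨x, rfl⟩ := hf y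
    exact ⟨⟨p x, x, rfl⟩, hfp x⟩

variable {H : WeakQuasiHopfAlgebra G} {Q : QuasiCommutingPair H.toWeakQuasiBialgebra M}
  {M₁ : Type*} [Ring M₁] [Algebra ℂ M₁] {ι : M →ₐ[ℂ] M₁} {Γ : Module.Dual ℂ G →ₗ[ℂ] M₁}

/-- One inclusion comes from the representation: acting on the base vector, `μ_L y` determines `P_L
y`. The other is `μ_L ∘ P_L = μ_L`. -/
theorem IsIntertwiner.ker_muL (hT : IsIntertwiner Q (ι : M →ₙₐ[ℂ] M₁) (ofSlices Γ))
    {g : M₁ →ₙₐ[ℂ] RepEnd G M} (hι : ∀ m, g (ι m) = repLeft H Q m)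
    (hΓ : ∀ ψ, g (Γ ψ) = evalFst (RepEnd G M) ψ (repIntertwiner H Q)) :
    LinearMap.ker (muL ι Γ (qRho H Q)) = LinearMap.ker (projL H Q) := by
  ext y
  rw [LinearMap.mem_ker, LinearMap.mem_ker]
  constructor
  · intro hy
    have := map_muL_mul_baseVec g hι hΓ y
    rw [hy, map_zero, zero_mul] at this
    exact repElt_injective (this.symm.trans (map_zero _).symm)
  · intro hy
    rw [← hT.muL_comp_projL, LinearMap.comp_apply, hy, map_zero]

variable (H Q)

theorem exists_univ_rep : ∃ g : UnivExt Q →ₙₐ[ℂ] RepEnd G M,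
    (∀ m, g (univLeft Q m) = repLeft H Q m) ∧
      ∀ ψ, g (univSlices Q ψ) = evalFst (RepEnd G M) ψ (repIntertwiner H Q) :=
  exists_univ_lift_nonUnital ((hat_repHat (G := G) (M := M)).hom (H := H) (Q := Q))
    (repIntertwiner H Q) (hat_repHat (G := G) (M := M)).isIntertwiner

theorem univLeft_injective : Function.Injective (univLeft Q) :=
  let ⟨g, hg, _⟩ := exists_univ_rep H Q
  injective_of_rep g hg

theorem surjective_muL_univ :
    Function.Surjective (muL (univLeft Q) (univSlices Q) (qRho H Q)) :=
  (isIntertwiner_univSlices Q).surjective_muL (adjoin_univ Q)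

theorem ker_muL_univ : LinearMap.ker (muL (univLeft Q) (univSlices Q) (qRho H Q))
    = LinearMap.ker (projL H Q) :=
  let ⟨_, hg, hg'⟩ := exists_univ_rep H Q
  (isIntertwiner_univSlices Q).ker_muL hg hg'

end Projection

end


/-! ### Opposite algebras with reversed legs -/

section

section Anti

/-- A linear map that reverses products. -/
class IsAnti {A B : Type*} [Ring A] [Algebra ℂ A] [Ring B] [Algebra ℂ B] (f : A →ₗ[ℂ] B) :
    Prop where
  map_mul : ∀ x y, f (x * y) = f y * f x

variable {A B C D A' B' C' : Type*} [Ring A] [Algebra ℂ A] [Ring B] [Algebra ℂ B]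
  [Ring C] [Algebra ℂ C] [Ring D] [Algebra ℂ D] [Ring A'] [Algebra ℂ A'] [Ring B'] [Algebra ℂ B']
  [Ring C'] [Algebra ℂ C']

/-- The opposite algebra, as a type synonym with few instances. -/
def Opp (A : Type*) : Type _ := Aᵐᵒᵖ

instance : Ring (Opp A) := inferInstanceAs (Ring Aᵐᵒᵖ)
instance : Algebra ℂ (Opp A) := inferInstanceAs (Algebra ℂ Aᵐᵒᵖ)

variable (A) in
/-- The identity as a map to the opposite algebra. -/
def opL : A →ₗ[ℂ] Opp A := (MulOpposite.opLinearEquiv ℂ : A ≃ₗ[ℂ] Aᵐᵒᵖ).toLinearMap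

variable (A) in
/-- The identity as a map from the opposite algebra. -/
def unopL : Opp A →ₗ[ℂ] A := (MulOpposite.opLinearEquiv ℂ : A ≃ₗ[ℂ] Aᵐᵒᵖ).symm.toLinearMap

@[simp] theorem opL_unopL (a : Opp A) : opL A (unopL A a) = a := rfl
@[simp] theorem unopL_opL (a : A) : unopL A (opL A a) = a := rfl
@[simp] theorem opL_one : opL A 1 = 1 := rfl
@[simp] theorem unopL_one : unopL A 1 = 1 := rfl

instance : IsAnti (opL A) := ⟨fun _ _ => rfl⟩
instance : IsAnti (unopL A) := ⟨fun _ _ => rfl⟩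

instance isAnti_map (f : A →ₗ[ℂ] A') (g : B →ₗ[ℂ] B') [IsAnti f] [IsAnti g] :
    IsAnti (TensorProduct.map f g) where
  map_mul x y := by
    induction x with
    | zero => simp
    | add x z hx hz => simp only [add_mul, mul_add, map_add, hx, hz]
    | tmul a c =>
      induction y with
      | zero => simp
      | add x z hx hz => simp only [add_mul, mul_add, map_add, hx, hz]
      | tmul a' c' => simp [IsAnti.map_mul]

instance isAnti_comp (f : B →ₗ[ℂ] C) (g : A →ₗ[ℂ] B) [IsMul f] [IsAnti g] : IsAnti (f ∘ₗ g) :=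
  ⟨fun x y => by simp [IsAnti.map_mul, IsMul.map_mul]⟩

instance isMul_comm : IsMul (TensorProduct.comm ℂ A B).toLinearMap :=
  ⟨map_mul (Algebra.TensorProduct.comm ℂ A B)⟩
instance isMul_assoc : IsMul (TensorProduct.assoc ℂ A B C).toLinearMap :=
  ⟨map_mul (Algebra.TensorProduct.assoc ℂ ℂ ℂ A B C)⟩

variable (A B C D)

/-- `a ⊗ b ↦ b ⊗ a`, to the opposite algebras. -/
def flip₂ : A ⊗[ℂ] B →ₗ[ℂ] Opp B ⊗[ℂ] Opp A :=
  (TensorProduct.comm ℂ (Opp A) (Opp B)).toLinearMap ∘ₗ TensorProduct.map (opL A) (opL B)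

/-- `a ⊗ b ⊗ c ↦ c ⊗ b ⊗ a`, to the opposite algebras. -/
def flip₃ : A ⊗[ℂ] (B ⊗[ℂ] C) →ₗ[ℂ] Opp C ⊗[ℂ] (Opp B ⊗[ℂ] Opp A) :=
  (TensorProduct.assoc ℂ (Opp C) (Opp B) (Opp A)).toLinearMap ∘ₗ
    (TensorProduct.comm ℂ (Opp A) (Opp C ⊗[ℂ] Opp B)).toLinearMap ∘ₗ
      TensorProduct.map (opL A) (flip₂ B C)

/-- `a ⊗ b ⊗ c ⊗ d ↦ d ⊗ c ⊗ b ⊗ a`, to the opposite algebras. -/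
def flip₄ : A ⊗[ℂ] (B ⊗[ℂ] (C ⊗[ℂ] D)) →ₗ[ℂ] Opp D ⊗[ℂ] (Opp C ⊗[ℂ] (Opp B ⊗[ℂ] Opp A)) :=
  LinearMap.lTensor (Opp D) (TensorProduct.assoc ℂ (Opp C) (Opp B) (Opp A)).toLinearMap ∘ₗ
    (TensorProduct.assoc ℂ (Opp D) (Opp C ⊗[ℂ] Opp B) (Opp A)).toLinearMap ∘ₗ
      (TensorProduct.comm ℂ (Opp A) (Opp D ⊗[ℂ] (Opp C ⊗[ℂ] Opp B))).toLinearMap ∘ₗ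
        TensorProduct.map (opL A) (flip₃ B C D)

instance : IsAnti (flip₂ A B) := by unfold flip₂; infer_instance
instance : IsAnti (flip₃ A B C) := by unfold flip₃; infer_instance
instance : IsAnti (flip₄ A B C D) := by unfold flip₄; infer_instance

variable {A B C D}

@[simp] theorem flip₂_tmul (a : A) (b : B) : flip₂ A B (a ⊗ₜ b) = opL B b ⊗ₜ opL A a := rfl
@[simp] theorem flip₃_tmul (a : A) (b : B) (c : C) :
    flip₃ A B C (a ⊗ₜ (b ⊗ₜ c)) = opL C c ⊗ₜ (opL B b ⊗ₜ opL A a) := rfl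
@[simp] theorem flip₄_tmul (a : A) (b : B) (c : C) (d : D) :
    flip₄ A B C D (a ⊗ₜ (b ⊗ₜ (c ⊗ₜ d))) = opL D d ⊗ₜ (opL C c ⊗ₜ (opL B b ⊗ₜ opL A a)) := rfl

/-- The opposite of a map with values in a tensor product. -/
def opComul (u : A →ₗ[ℂ] B ⊗[ℂ] C) : Opp A →ₗ[ℂ] Opp C ⊗[ℂ] Opp B := flip₂ B C ∘ₗ u ∘ₗ unopL A

@[simp] theorem opComul_op (u : A →ₗ[ℂ] B ⊗[ℂ] C) (a : A) :
    opComul u (opL A a) = flip₂ B C (u a) := rfl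

/-- The opposite of a multiplicative map with values in a tensor product. -/
def opComulHom (u : A →ₙₐ[ℂ] B ⊗[ℂ] C) : Opp A →ₙₐ[ℂ] Opp C ⊗[ℂ] Opp B where
  toFun x := opComul (u : A →ₗ[ℂ] B ⊗[ℂ] C) x
  map_smul' c x := map_smul _ c x
  map_zero' := map_zero _
  map_add' x y := map_add _ x y
  map_mul' x y := by
    change flip₂ B C (u (unopL A y * unopL A x)) = _
    rw [map_mul, IsAnti.map_mul]
    rfl

theorem opComulHom_apply (u : A →ₙₐ[ℂ] B ⊗[ℂ] C) (x : Opp A) :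
    opComulHom u x = flip₂ B C (u (unopL A x)) := rfl

theorem coe_opComulHom (u : A →ₙₐ[ℂ] B ⊗[ℂ] C) :
    ((opComulHom u : Opp A →ₙₐ[ℂ] Opp C ⊗[ℂ] Opp B) : Opp A →ₗ[ℂ] Opp C ⊗[ℂ] Opp B)
      = opComul (u : A →ₗ[ℂ] B ⊗[ℂ] C) := rfl

theorem IsQuasiInverse.anti {x y p q : A} (h : IsQuasiInverse x y p q) (f : A →ₗ[ℂ] B) [IsAnti f] :
    IsQuasiInverse (f x) (f y) (f q) (f p) where
  mul_eq := by rw [← IsAnti.map_mul, h.mul_eq']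
  mul_eq' := by rw [← IsAnti.map_mul, h.mul_eq]
  mul_mul_eq := by rw [← IsAnti.map_mul, ← IsAnti.map_mul, ← mul_assoc, h.mul_mul_eq]
  mul_mul_eq' := by rw [← IsAnti.map_mul, ← IsAnti.map_mul, ← mul_assoc, h.mul_mul_eq']

theorem flip₃_lTensor (u : D →ₗ[ℂ] B ⊗[ℂ] C) (x : A ⊗[ℂ] D) :
    flip₃ A B C (u.lTensor A x) = splitFst (Opp A) (opComul u) (flip₂ A D x) := by
  induction x with
  | zero => simp
  | add x y hx hy => simp only [map_add, hx, hy]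
  | tmul a d => rfl

theorem flip₃_splitFst (u : D →ₗ[ℂ] A ⊗[ℂ] B) (x : D ⊗[ℂ] C) :
    flip₃ A B C (splitFst C u x) = LinearMap.lTensor (Opp C) (opComul u) (flip₂ D C x) := by
  have key : ∀ (w : A ⊗[ℂ] B) (c : C), flip₃ A B C (TensorProduct.assoc ℂ A B C (w ⊗ₜ c))
      = opL C c ⊗ₜ flip₂ A B w := by
    intro w c
    induction w with
    | zero => simp
    | add x y hx hy => simp only [TensorProduct.add_tmul, TensorProduct.tmul_add, map_add, hx, hy]
    | tmul a b => rfl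
  induction x with
  | zero => simp
  | add x y hx hy => simp only [map_add, hx, hy]
  | tmul d c => exact key (u d) c

variable {V : Type*} [Ring V] [Algebra ℂ V]

theorem flip₄_lTensor_lTensor (u : V →ₗ[ℂ] C ⊗[ℂ] D) (x : A ⊗[ℂ] (B ⊗[ℂ] V)) :
    flip₄ A B C D (LinearMap.lTensor A (u.lTensor B) x)
      = splitFst (Opp B ⊗[ℂ] Opp A) (opComul u) (flip₃ A B V x) := by
  have key : ∀ (w : C ⊗[ℂ] D) (a : A) (b : B), flip₄ A B C D (a ⊗ₜ (b ⊗ₜ w))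
      = TensorProduct.assoc ℂ (Opp D) (Opp C) (Opp B ⊗[ℂ] Opp A)
        (flip₂ C D w ⊗ₜ (opL B b ⊗ₜ opL A a)) := by
    intro w a b
    induction w with
    | zero => simp
    | add x y hx hy => simp only [TensorProduct.add_tmul, TensorProduct.tmul_add, map_add, hx, hy]
    | tmul a b => rfl
  induction x with
  | zero => simp
  | add x y hx hy => simp only [map_add, hx, hy]
  | tmul a x =>
    induction x with
    | zero => simp
    | add x y hx hy => simp only [TensorProduct.tmul_add, map_add, hx, hy]
    | tmul b v => exact key (u v) a b

theorem flip₄_lTensor_splitFst (u : V →ₗ[ℂ] B ⊗[ℂ] C) (x : A ⊗[ℂ] (V ⊗[ℂ] D)) :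
    flip₄ A B C D (LinearMap.lTensor A (splitFst D u) x)
      = LinearMap.lTensor (Opp D) (splitFst (Opp A) (opComul u)) (flip₃ A V D x) := by
  have key : ∀ (w : B ⊗[ℂ] C) (a : A) (d : D),
      flip₄ A B C D (a ⊗ₜ TensorProduct.assoc ℂ B C D (w ⊗ₜ d))
      = opL D d ⊗ₜ TensorProduct.assoc ℂ (Opp C) (Opp B) (Opp A)
        (flip₂ B C w ⊗ₜ opL A a) := by
    intro w a d
    induction w with
    | zero => simp
    | add x y hx hy => simp only [TensorProduct.add_tmul, TensorProduct.tmul_add, map_add, hx, hy]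
    | tmul a b => rfl
  induction x with
  | zero => simp
  | add x y hx hy => simp only [map_add, hx, hy]
  | tmul a x =>
    induction x with
    | zero => simp
    | add x y hx hy => simp only [TensorProduct.tmul_add, map_add, hx, hy]
    | tmul v d => exact key (u v) a d

theorem flip₄_splitFst (u : V →ₗ[ℂ] A ⊗[ℂ] B) (x : V ⊗[ℂ] (C ⊗[ℂ] D)) :
    flip₄ A B C D (splitFst (C ⊗[ℂ] D) u x)
      = LinearMap.lTensor (Opp D) (LinearMap.lTensor (Opp C) (opComul u)) (flip₃ V C D x) := by
  have key : ∀ (w : A ⊗[ℂ] B) (c : C) (d : D),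
      flip₄ A B C D (TensorProduct.assoc ℂ A B (C ⊗[ℂ] D) (w ⊗ₜ (c ⊗ₜ d)))
      = opL D d ⊗ₜ (opL C c ⊗ₜ flip₂ A B w) := by
    intro w a d
    induction w with
    | zero => simp
    | add x y hx hy => simp only [TensorProduct.add_tmul, TensorProduct.tmul_add, map_add, hx, hy]
    | tmul a b => rfl
  induction x with
  | zero => simp
  | add x y hx hy => simp only [map_add, hx, hy]
  | tmul v x =>
    induction x with
    | zero => simp
    | add x y hx hy => simp only [TensorProduct.tmul_add, map_add, hx, hy]
    | tmul c d => exact key (u v) c d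

theorem flip₄_one_tmul (x : B ⊗[ℂ] (C ⊗[ℂ] D)) : flip₄ A B C D (1 ⊗ₜ x)
    = LinearMap.lTensor (Opp D) (LinearMap.lTensor (Opp C) (tensorOne (Opp B) (Opp A))) (flip₃ B C D x) := by
  induction x with
  | zero => simp
  | add x y hx hy => simp only [TensorProduct.tmul_add, map_add, hx, hy]
  | tmul v x =>
    induction x with
    | zero => simp
    | add x y hx hy => simp only [TensorProduct.tmul_add, map_add, hx, hy]
    | tmul c d => rfl

theorem flip₄_lTensor_tensorOne (x : A ⊗[ℂ] (B ⊗[ℂ] C)) :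
    flip₄ A B C D (LinearMap.lTensor A (LinearMap.lTensor B (tensorOne C D)) x)
      = 1 ⊗ₜ flip₃ A B C x := by
  induction x with
  | zero => simp
  | add x y hx hy => simp only [TensorProduct.tmul_add, map_add, hx, hy]
  | tmul v x =>
    induction x with
    | zero => simp
    | add x y hx hy => simp only [TensorProduct.tmul_add, map_add, hx, hy]
    | tmul c d => rfl

theorem evalFst_flip₂ (f : B →ₗ[ℂ] ℂ) (x : A ⊗[ℂ] B) :
    evalFst (Opp A) (f ∘ₗ unopL B) (flip₂ A B x) = opL A (evalSnd A f x) := by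
  induction x with
  | zero => simp
  | add x y hx hy => simp only [map_add, hx, hy]
  | tmul a b => simp

theorem evalSnd_flip₂ (f : A →ₗ[ℂ] ℂ) (x : A ⊗[ℂ] B) :
    evalSnd (Opp B) (f ∘ₗ unopL A) (flip₂ A B x) = opL B (evalFst B f x) := by
  induction x with
  | zero => simp
  | add x y hx hy => simp only [map_add, hx, hy]
  | tmul a b => simp

theorem lTensor_evalFst_flip₃ (f : B →ₗ[ℂ] ℂ) (x : A ⊗[ℂ] (B ⊗[ℂ] C)) :
    LinearMap.lTensor (Opp C) (evalFst (Opp A) (f ∘ₗ unopL B)) (flip₃ A B C x)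
      = flip₂ A C (LinearMap.lTensor A (evalFst C f) x) := by
  induction x with
  | zero => simp
  | add x y hx hy => simp only [map_add, hx, hy]
  | tmul v x =>
    induction x with
    | zero => simp
    | add x y hx hy => simp only [TensorProduct.tmul_add, map_add, hx, hy]
    | tmul c d => simp

theorem evalFst_flip₃ (f : C →ₗ[ℂ] ℂ) (x : A ⊗[ℂ] (B ⊗[ℂ] C)) :
    evalFst (Opp B ⊗[ℂ] Opp A) (f ∘ₗ unopL C) (flip₃ A B C x)
      = flip₂ A B (LinearMap.lTensor A (evalSnd B f) x) := by
  induction x with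
  | zero => simp
  | add x y hx hy => simp only [map_add, hx, hy]
  | tmul v x =>
    induction x with
    | zero => simp
    | add x y hx hy => simp only [TensorProduct.tmul_add, map_add, hx, hy]
    | tmul c d => simp

theorem lTensor_evalSnd_flip₃ (f : A →ₗ[ℂ] ℂ) (x : A ⊗[ℂ] (B ⊗[ℂ] C)) :
    LinearMap.lTensor (Opp C) (evalSnd (Opp B) (f ∘ₗ unopL A)) (flip₃ A B C x)
      = flip₂ B C (evalFst (B ⊗[ℂ] C) f x) := by
  induction x with
  | zero => simp
  | add x y hx hy => simp only [map_add, hx, hy]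
  | tmul v x =>
    induction x with
    | zero => simp
    | add x y hx hy => simp only [TensorProduct.tmul_add, map_add, hx, hy]
    | tmul c d => simp

end Anti

section Op

variable {G : Type u} [Ring G] [Algebra ℂ G] {M : Type v} [Ring M] [Algebra ℂ M]

/-- The counit on the opposite algebra. -/
def opCounit (ε : G →ₐ[ℂ] ℂ) : Opp G →ₐ[ℂ] ℂ :=
  AlgHom.ofLinearMap (ε.toLinearMap ∘ₗ unopL G) (map_one ε)
    (fun x y => (map_mul ε (unopL G y) (unopL G x)).trans (mul_comm _ _))

theorem toLinearMap_opCounit (ε : G →ₐ[ℂ] ℂ) :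
    (opCounit ε).toLinearMap = ε.toLinearMap ∘ₗ unopL G := rfl

/-- The opposite algebra with the opposite coproduct. -/
def WeakQuasiBialgebra.opp (H : WeakQuasiBialgebra G) : WeakQuasiBialgebra (Opp G) where
  Δ := opComulHom H.Δ
  ε := opCounit H.ε
  -- Reversing products and reversing legs each invert the direction of the reassociator, so `φ`
  -- itself serves, not its quasi-inverse.
  φ := flip₃ G G G H.φ
  φInv := flip₃ G G G H.φInv
  quasi_coassoc a := by
    have := congrArg (flip₃ G G G) (H.quasi_coassoc (unopL G a))
    rw [IsAnti.map_mul, IsAnti.map_mul, flip₃_lTensor, flip₃_splitFst] at this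
    exact this.symm
  quasiInverse := by
    have := H.quasiInverse.anti (flip₃ G G G)
    rw [flip₃_lTensor, flip₃_splitFst] at this
    exact this
  pentagon := by
    have := congrArg (flip₄ G G G G) H.pentagon
    rw [IsAnti.map_mul, IsAnti.map_mul, IsAnti.map_mul, flip₄_lTensor_tensorOne,
      flip₄_lTensor_lTensor, flip₄_splitFst, flip₄_lTensor_splitFst, flip₄_one_tmul,
      ← mul_assoc] at this
    exact this
  counit_left a := by
    rw [toLinearMap_opCounit, opComulHom_apply, evalFst_flip₂, H.counit_right, opL_unopL]
  counit_right a := by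
    rw [toLinearMap_opCounit, opComulHom_apply, evalSnd_flip₂, H.counit_left, opL_unopL]
  counit_φ := by
    rw [toLinearMap_opCounit, lTensor_evalFst_flip₃, H.counit_φ, opComulHom_apply, unopL_one]

theorem WeakQuasiBialgebra.toLinearMap_opp_ε (H : WeakQuasiBialgebra G) :
    H.opp.ε.toLinearMap = H.ε.toLinearMap ∘ₗ unopL G := rfl

variable {H : WeakQuasiBialgebra G}

/-- A right coaction as a left coaction of the opposite. -/
def RightCoaction.opp (P : RightCoaction H M) : LeftCoaction H.opp (Opp M) where
  lam := opComulHom P.rho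
  φ := flip₃ M G G P.φ
  φInv := flip₃ M G G P.φInv
  quasi_coassoc a := by
    have := congrArg (flip₃ M G G) (P.quasi_coassoc (unopL M a))
    rw [IsAnti.map_mul, IsAnti.map_mul, flip₃_lTensor, flip₃_splitFst] at this
    exact this
  quasiInverse := by
    have := P.quasiInverse.anti (flip₃ M G G)
    rw [flip₃_lTensor, flip₃_splitFst] at this
    exact this
  pentagon := by
    have := congrArg (flip₄ M G G G) P.pentagon
    rw [IsAnti.map_mul, IsAnti.map_mul, IsAnti.map_mul, flip₄_lTensor_tensorOne,
      flip₄_lTensor_lTensor, flip₄_splitFst, flip₄_lTensor_splitFst, flip₄_one_tmul,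
      ← mul_assoc] at this
    exact this
  counit a := by
    rw [H.toLinearMap_opp_ε, opComulHom_apply, evalFst_flip₂, P.counit, opL_unopL]
  counit_φ_mid := by
    rw [H.toLinearMap_opp_ε, lTensor_evalFst_flip₃, P.counit_φ_mid, opComulHom_apply, unopL_one]
  counit_φ_left := by
    rw [H.toLinearMap_opp_ε, evalFst_flip₃, P.counit_φ_right, opComulHom_apply, unopL_one]

/-- A left coaction as a right coaction of the opposite. -/
def LeftCoaction.opp (P : LeftCoaction H M) : RightCoaction H.opp (Opp M) where
  rho := opComulHom P.lam
  φ := flip₃ G G M P.φ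
  φInv := flip₃ G G M P.φInv
  quasi_coassoc a := by
    have := congrArg (flip₃ G G M) (P.quasi_coassoc (unopL M a))
    rw [IsAnti.map_mul, IsAnti.map_mul, flip₃_lTensor, flip₃_splitFst] at this
    exact this
  quasiInverse := by
    have := P.quasiInverse.anti (flip₃ G G M)
    rw [flip₃_lTensor, flip₃_splitFst] at this
    exact this
  pentagon := by
    have := congrArg (flip₄ G G G M) P.pentagon
    rw [IsAnti.map_mul, IsAnti.map_mul, IsAnti.map_mul, flip₄_lTensor_tensorOne,
      flip₄_lTensor_lTensor, flip₄_splitFst, flip₄_lTensor_splitFst, flip₄_one_tmul,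
      ← mul_assoc] at this
    exact this
  counit a := by
    rw [H.toLinearMap_opp_ε, opComulHom_apply, evalSnd_flip₂, P.counit, opL_unopL]
  counit_φ_mid := by
    rw [H.toLinearMap_opp_ε, lTensor_evalFst_flip₃, P.counit_φ_mid, opComulHom_apply, unopL_one]
  counit_φ_right := by
    rw [H.toLinearMap_opp_ε, lTensor_evalSnd_flip₃, P.counit_φ_left, opComulHom_apply, unopL_one]

/-- The opposite of a quasi-commuting pair. -/
def QuasiCommutingPair.opp (Q : QuasiCommutingPair H M) : QuasiCommutingPair H.opp (Opp M) where
  left := Q.right.opp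
  right := Q.left.opp
  φ := flip₃ G M G Q.φ
  φInv := flip₃ G M G Q.φInv
  quasi_comm a := by
    have := congrArg (flip₃ G M G) (Q.quasi_comm (unopL M a))
    rw [IsAnti.map_mul, IsAnti.map_mul, flip₃_lTensor, flip₃_splitFst] at this
    exact this.symm
  quasiInverse := by
    have := Q.quasiInverse.anti (flip₃ G M G)
    rw [flip₃_lTensor, flip₃_splitFst] at this
    exact this
  pentagon_left := by
    have := congrArg (flip₄ G M G G) Q.pentagon_right
    rw [IsAnti.map_mul, IsAnti.map_mul, IsAnti.map_mul, flip₄_lTensor_tensorOne,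
      flip₄_lTensor_lTensor, flip₄_splitFst, flip₄_lTensor_splitFst, flip₄_one_tmul,
      ← mul_assoc] at this
    exact this
  pentagon_right := by
    have := congrArg (flip₄ G G M G) Q.pentagon_left
    rw [IsAnti.map_mul, IsAnti.map_mul, IsAnti.map_mul, flip₄_lTensor_tensorOne,
      flip₄_lTensor_lTensor, flip₄_splitFst, flip₄_lTensor_splitFst, flip₄_one_tmul,
      ← mul_assoc] at this
    exact this

end Op

end


/-! ### The mirror image of the antipode and of intertwiners -/

section

variable {G : Type u} [Ring G] [Algebra ℂ G] {M : Type v} [Ring M] [Algebra ℂ M]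

section OppHopf

variable (H : WeakQuasiHopfAlgebra G)

theorem opL_mul_opL {A : Type*} [Ring A] [Algebra ℂ A] (a b : A) :
    opL A a * opL A b = opL A (b * a) := rfl

/-- The antipode on the opposite algebra. -/
def oppAntipode : Opp G ≃ₐ[ℂ] (Opp G)ᵐᵒᵖ := AlgEquiv.op H.S

/-- The antipode on the opposite algebra, as a linear map. -/
def oppAntipodeMap : Opp G →ₗ[ℂ] Opp G :=
  (MulOpposite.opLinearEquiv ℂ).symm.toLinearMap ∘ₗ (oppAntipode H).toLinearMap

theorem oppAntipodeMap_opL (a : G) : oppAntipodeMap H (opL G a) = opL G (H.antipode a) := rfl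

theorem oppAntipodeMap_left (x : G ⊗[ℂ] G) :
    LinearMap.mul' ℂ (Opp G) (TensorProduct.map
      (LinearMap.mulRight ℂ (opL G H.β) ∘ₗ oppAntipodeMap H) LinearMap.id (flip₂ G G x))
    = opL G (LinearMap.mul' ℂ G (TensorProduct.map (LinearMap.mulRight ℂ H.β) H.antipode x)) := by
  induction x with
  | zero => simp
  | add x y hx hy => simp only [map_add, hx, hy]
  | tmul a b => simp [oppAntipodeMap_opL, opL_mul_opL, mul_assoc]

theorem oppAntipodeMap_right (x : G ⊗[ℂ] G) :
    LinearMap.mul' ℂ (Opp G) (TensorProduct.map (LinearMap.mulRight ℂ (opL G H.α))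
      (oppAntipodeMap H) (flip₂ G G x))
    = opL G (LinearMap.mul' ℂ G (TensorProduct.map
      (LinearMap.mulRight ℂ H.α ∘ₗ H.antipode) LinearMap.id x)) := by
  induction x with
  | zero => simp
  | add x y hx hy => simp only [map_add, hx, hy]
  | tmul a b => simp [oppAntipodeMap_opL, opL_mul_opL, mul_assoc]

theorem oppAntipodeMap_φ (x : G ⊗[ℂ] (G ⊗[ℂ] G)) :
    LinearMap.mul' ℂ (Opp G) (TensorProduct.map (LinearMap.mulRight ℂ (opL G H.α))
      (LinearMap.mul' ℂ (Opp G) ∘ₗ TensorProduct.map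
        (LinearMap.mulRight ℂ (opL G H.β) ∘ₗ oppAntipodeMap H) LinearMap.id) (flip₃ G G G x))
    = opL G (LinearMap.mul' ℂ G (TensorProduct.map (LinearMap.mulRight ℂ H.β)
      (LinearMap.mul' ℂ G ∘ₗ TensorProduct.map
        (LinearMap.mulRight ℂ H.α ∘ₗ H.antipode) LinearMap.id) x)) := by
  induction x with
  | zero => simp
  | add x y hx hy => simp only [map_add, hx, hy]
  | tmul a x =>
    induction x with
    | zero => simp
    | add x y hx hy => simp only [TensorProduct.tmul_add, map_add, hx, hy]
    | tmul b c => simp [oppAntipodeMap_opL, opL_mul_opL, mul_assoc]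

theorem oppAntipodeMap_φInv (x : G ⊗[ℂ] (G ⊗[ℂ] G)) :
    LinearMap.mul' ℂ (Opp G) (TensorProduct.map
      (LinearMap.mulRight ℂ (opL G H.β) ∘ₗ oppAntipodeMap H)
      (LinearMap.mul' ℂ (Opp G) ∘ₗ TensorProduct.map (LinearMap.mulRight ℂ (opL G H.α))
        (oppAntipodeMap H)) (flip₃ G G G x))
    = opL G (LinearMap.mul' ℂ G (TensorProduct.map
      (LinearMap.mulRight ℂ H.α ∘ₗ H.antipode)
      (LinearMap.mul' ℂ G ∘ₗ TensorProduct.map (LinearMap.mulRight ℂ H.β) H.antipode) x)) := by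
  induction x with
  | zero => simp
  | add x y hx hy => simp only [map_add, hx, hy]
  | tmul a x =>
    induction x with
    | zero => simp
    | add x y hx hy => simp only [TensorProduct.tmul_add, map_add, hx, hy]
    | tmul b c => simp [oppAntipodeMap_opL, opL_mul_opL, mul_assoc]

/-- The opposite of a weak quasi-Hopf algebra. -/
def WeakQuasiHopfAlgebra.opp : WeakQuasiHopfAlgebra (Opp G) where
  toWeakQuasiBialgebra := H.toWeakQuasiBialgebra.opp
  S := oppAntipode H
  -- The expressions `S(a₁) α a₂` and `a₁ β S(a₂)` are mirror images, so `α` and `β` trade places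
  -- while `S` is kept.
  α := opL G H.β
  β := opL G H.α
  antipode_left a := (oppAntipodeMap_left H _).trans (congrArg (opL G) (H.antipode_right (unopL G a)))
  antipode_right a :=
    (oppAntipodeMap_right H _).trans (congrArg (opL G) (H.antipode_left (unopL G a)))
  antipode_φ := (oppAntipodeMap_φ H _).trans (congrArg (opL G) H.antipode_φ)
  antipode_φInv := (oppAntipodeMap_φInv H _).trans (congrArg (opL G) H.antipode_φInv)

theorem antipodeInv_opp (a : G) : H.opp.antipodeInv (opL G a) = opL G (H.antipodeInv a) := rfl

/-- The mirror of `φ_ρ` is `φ_λ` and the mirror of `α` is `β`, so `S⁻¹(α z) y` turns into `y S⁻¹(x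
β)`. -/
theorem qRho_opp (Q : QuasiCommutingPair H.toWeakQuasiBialgebra M) :
    qRho H.opp Q.opp = flip₂ G M (pLam H Q) := by
  have : ∀ x : G ⊗[ℂ] (G ⊗[ℂ] M), LinearMap.lTensor (Opp M)
      (LinearMap.mul' ℂ (Opp G) ∘ₗ (TensorProduct.comm ℂ (Opp G) (Opp G)).toLinearMap ∘ₗ
        LinearMap.lTensor (Opp G) (H.opp.antipodeInv ∘ₗ LinearMap.mulLeft ℂ (opL G H.β)))
      (flip₃ G G M x)
      = flip₂ G M (LinearMap.rTensor M
        (LinearMap.mul' ℂ G ∘ₗ (TensorProduct.comm ℂ G G).toLinearMap ∘ₗ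
          LinearMap.rTensor G (H.antipodeInv ∘ₗ LinearMap.mulRight ℂ H.β))
        ((TensorProduct.assoc ℂ G G M).symm x)) := by
    intro x
    induction x with
    | zero => simp
    | add x y hx hy => simp only [map_add, hx, hy]
    | tmul a x =>
      induction x with
      | zero => simp
      | add x y hx hy => simp only [TensorProduct.tmul_add, map_add, hx, hy]
      | tmul b c =>
        simp only [flip₃_tmul, LinearMap.lTensor_tmul, LinearMap.comp_apply,
          LinearEquiv.coe_coe, TensorProduct.comm_tmul, LinearMap.mul'_apply,
          LinearMap.mulLeft_apply, LinearMap.mulRight_apply, opL_mul_opL, antipodeInv_opp,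
          TensorProduct.assoc_symm_tmul, LinearMap.rTensor_tmul, flip₂_tmul]
  exact this Q.left.φ

end OppHopf

section Intertwiner

variable {A : Type*} [Ring A] [Algebra ℂ A] {A' : Type*} [Ring A'] [Algebra ℂ A']
  {H : WeakQuasiBialgebra G} {Q : QuasiCommutingPair H M} (θ : A →ₗ[ℂ] A')

variable (G) in
/-- `a ⊗ b ⊗ c ↦ b ⊗ a ⊗ θ c`. -/
def swapOpp : G ⊗[ℂ] (G ⊗[ℂ] A) →ₗ[ℂ] Opp G ⊗[ℂ] (Opp G ⊗[ℂ] A') :=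
  (TensorProduct.leftComm ℂ (Opp G) (Opp G) A').toLinearMap ∘ₗ
    TensorProduct.map (opL G) (TensorProduct.map (opL G) θ)

@[simp] theorem swapOpp_tmul (a b : G) (c : A) :
    swapOpp G θ (a ⊗ₜ (b ⊗ₜ c)) = opL G b ⊗ₜ (opL G a ⊗ₜ θ c) := rfl

instance isMul_leftComm {B C D : Type*} [Ring B] [Algebra ℂ B] [Ring C] [Algebra ℂ C] [Ring D]
    [Algebra ℂ D] : IsMul (TensorProduct.leftComm ℂ B C D).toLinearMap :=
  ⟨map_mul (Algebra.TensorProduct.leftComm ℂ B C D)⟩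

instance [IsAnti θ] : IsAnti (swapOpp G θ) := by unfold swapOpp; infer_instance

theorem map_opL_injective {θ : A →ₗ[ℂ] A'} (hθ : Function.Injective θ) :
    Function.Injective (TensorProduct.map (opL G) θ) :=
  TensorProduct.map_injective_of_flat_flat _ _ (MulOpposite.opLinearEquiv ℂ).injective hθ

theorem swapOpp_injective {θ : A →ₗ[ℂ] A'} (hθ : Function.Injective θ) :
    Function.Injective (swapOpp G θ) :=
  (TensorProduct.leftComm ℂ (Opp G) (Opp G) A').injective.comp
    (map_opL_injective (map_opL_injective hθ))

variable {θ} {γ : M →ₗ[ℂ] A} {γ' : Opp M →ₗ[ℂ] A'} (hγ : ∀ m, γ' (opL M m) = θ (γ m))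

include hγ

theorem lTensor_flip₂ (x : M ⊗[ℂ] G) : γ'.lTensor (Opp G) (flip₂ M G x)
    = TensorProduct.map (opL G) θ (TensorProduct.comm ℂ A G (γ.rTensor G x)) := by
  induction x with
  | zero => simp
  | add x y hx hy => simp only [map_add, hx, hy]
  | tmul m a => simp [hγ]

theorem comm_rTensor_flip₂ (x : G ⊗[ℂ] M) :
    TensorProduct.comm ℂ A' (Opp G) (γ'.rTensor (Opp G) (flip₂ G M x))
    = TensorProduct.map (opL G) θ (γ.lTensor G x) := by
  induction x with
  | zero => simp
  | add x y hx hy => simp only [map_add, hx, hy]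
  | tmul m a => simp [hγ]

theorem swapOpp_left (x : G ⊗[ℂ] (G ⊗[ℂ] M)) :
    LinearMap.lTensor (Opp G) (γ'.lTensor (Opp G)) (TensorProduct.assoc ℂ (Opp G) (Opp G) (Opp M)
      (TensorProduct.comm ℂ (Opp M) (Opp G ⊗[ℂ] Opp G) (flip₃ G G M x)))
    = swapOpp G θ (LinearMap.lTensor G (γ.lTensor G) x) := by
  induction x with
  | zero => simp
  | add x y hx hy => simp only [map_add, hx, hy]
  | tmul a x =>
    induction x with
    | zero => simp
    | add x y hx hy => simp only [TensorProduct.tmul_add, map_add, hx, hy]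
    | tmul b c => simp [hγ]

theorem swapOpp_mid (x : G ⊗[ℂ] (M ⊗[ℂ] G)) :
    LinearMap.lTensor (Opp G) (γ'.lTensor (Opp G)) (LinearMap.lTensor (Opp G)
      (TensorProduct.comm ℂ (Opp M) (Opp G)).toLinearMap (flip₃ G M G x))
    = swapOpp G θ (LinearMap.lTensor G (γ.lTensor G) (LinearMap.lTensor G
      (TensorProduct.comm ℂ M G).toLinearMap x)) := by
  induction x with
  | zero => simp
  | add x y hx hy => simp only [map_add, hx, hy]
  | tmul a x =>
    induction x with
    | zero => simp
    | add x y hx hy => simp only [TensorProduct.tmul_add, map_add, hx, hy]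
    | tmul b c => simp [hγ]

theorem swapOpp_right (x : M ⊗[ℂ] (G ⊗[ℂ] G)) :
    LinearMap.lTensor (Opp G) (γ'.lTensor (Opp G)) (flip₃ M G G x)
    = swapOpp G θ (LinearMap.lTensor G (γ.lTensor G) (TensorProduct.assoc ℂ G G M
      (TensorProduct.comm ℂ M (G ⊗[ℂ] G) x))) := by
  induction x with
  | zero => simp
  | add x y hx hy => simp only [map_add, hx, hy]
  | tmul a x =>
    induction x with
    | zero => simp
    | add x y hx hy => simp only [TensorProduct.tmul_add, map_add, hx, hy]
    | tmul b c => simp [hγ]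

omit hγ

theorem lTensor_mk_map_opL (T : G ⊗[ℂ] A) : LinearMap.lTensor (Opp G)
    (TensorProduct.mk ℂ (Opp G) A' 1) (TensorProduct.map (opL G) θ T)
      = swapOpp G θ (1 ⊗ₜ T) := by
  induction T with
  | zero => simp
  | add x y hx hy => simp only [TensorProduct.tmul_add, map_add, hx, hy]
  | tmul b c => simp

theorem one_tmul_map_opL (T : G ⊗[ℂ] A) : (1 : Opp G) ⊗ₜ TensorProduct.map (opL G) θ T
      = swapOpp G θ (LinearMap.lTensor G (TensorProduct.mk ℂ G A 1) T) := by
  induction T with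
  | zero => simp
  | add x y hx hy => simp only [TensorProduct.tmul_add, map_add, hx, hy]
  | tmul b c => simp

theorem splitFst_map_opL (u : G →ₗ[ℂ] G ⊗[ℂ] G) (T : G ⊗[ℂ] A) :
    splitFst A' (opComul u) (TensorProduct.map (opL G) θ T) = swapOpp G θ (splitFst A u T) := by
  have key : ∀ (w : G ⊗[ℂ] G) (c : A), TensorProduct.assoc ℂ (Opp G) (Opp G) A'
      (flip₂ G G w ⊗ₜ θ c) = swapOpp G θ (TensorProduct.assoc ℂ G G A (w ⊗ₜ c)) := by
    intro w c
    induction w with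
    | zero => simp
    | add x y hx hy => simp only [TensorProduct.add_tmul, map_add, hx, hy]
    | tmul b c => simp
  induction T with
  | zero => simp
  | add x y hx hy => simp only [map_add, hx, hy]
  | tmul b c => exact key (u b) c

theorem evalFst_map_opL (f : G →ₗ[ℂ] ℂ) (T : G ⊗[ℂ] A) :
    evalFst A' (f ∘ₗ unopL G) (TensorProduct.map (opL G) θ T) = θ (evalFst A f T) := by
  induction T with
  | zero => simp
  | add x y hx hy => simp only [map_add, hx, hy]
  | tmul b c => simp

variable [IsAnti θ]
include hγ

theorem mulLeft_opp (T : G ⊗[ℂ] A) (m : M) :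
    mulLeft Q.opp γ' (TensorProduct.map (opL G) θ T) (opL M m)
      = TensorProduct.map (opL G) θ (rightMul Q γ T m) := by
  rw [mulLeft, rightMul, IsAnti.map_mul, ← lTensor_flip₂ hγ]
  rfl

theorem rightMul_opp (T : G ⊗[ℂ] A) (m : M) :
    rightMul Q.opp γ' (TensorProduct.map (opL G) θ T) (opL M m)
      = TensorProduct.map (opL G) θ (mulLeft Q γ T m) := by
  rw [mulLeft, rightMul, IsAnti.map_mul, ← comm_rTensor_flip₂ hγ]
  rfl

omit hγ in
theorem IsAnti.map_mul₅ {B C : Type*} [Ring B] [Algebra ℂ B] [Ring C] [Algebra ℂ C] (f : B →ₗ[ℂ] C)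
    [IsAnti f] (a b c d e : B) : f (a * b * c * d * e) = f e * f d * f c * f b * f a := by
  simp only [IsAnti.map_mul, mul_assoc]

/-- The five factors come in reverse order. `swapOpp` exchanges the two copies of `G`, hence `T¹³`
with `T²³`, and the outer factors match because `φ_ρ` and `φ_λ` are mirror images. -/
theorem cohere_opp (T : G ⊗[ℂ] A) : cohere Q.opp γ' (TensorProduct.map (opL G) θ T)
    = swapOpp G θ (cohere Q γ T) := by
  have h1 := swapOpp_left hγ Q.left.φ
  have h2 := swapOpp_mid hγ Q.φInv
  have h3 := swapOpp_right hγ Q.right.φ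
  have h4 := lTensor_mk_map_opL (θ := θ) T
  have h5 := one_tmul_map_opL (θ := θ) T
  have g1 : Q.opp.right.φ = flip₃ G G M Q.left.φ := rfl
  have g2 : Q.opp.left.φ = flip₃ M G G Q.right.φ := rfl
  have g3 : Q.opp.φInv = flip₃ G M G Q.φInv := rfl
  rw [cohere, cohere, IsAnti.map_mul₅, ← h1, ← h2, ← h3, ← h4, ← h5, ← g1, ← g2, ← g3]

omit hγ

/-- The two sides of the intertwining relation trade places, as do the two unit conditions, while
normality and coherence are each self-dual; injectivity of `θ` gives the equivalence. -/
theorem isIntertwiner_opp_iff (hθ : Function.Injective θ) {γ : M →ₙₐ[ℂ] A}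
    {γ' : Opp M →ₙₐ[ℂ] A'} (hγ : ∀ m, γ' (opL M m) = θ (γ m)) {T : G ⊗[ℂ] A} :
    IsIntertwiner Q.opp γ' (TensorProduct.map (opL G) θ T) ↔ IsIntertwiner Q γ T := by
  have hγ' : ∀ m, (γ' : Opp M →ₗ[ℂ] A') (opL M m) = θ ((γ : M →ₗ[ℂ] A) m) := hγ
  have h1 := map_opL_injective (G := G) hθ
  have h2 := swapOpp_injective (G := G) hθ
  have e1 : γ' 1 = θ (γ 1) := hγ 1
  have e2 : (∀ m, mulLeft Q.opp (γ' : Opp M →ₗ[ℂ] A') (TensorProduct.map (opL G) θ T) m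
        = rightMul Q.opp (γ' : Opp M →ₗ[ℂ] A') (TensorProduct.map (opL G) θ T) m)
      ↔ ∀ m, mulLeft Q (γ : M →ₗ[ℂ] A) T m = rightMul Q (γ : M →ₗ[ℂ] A) T m := by
    constructor
    · intro h m
      have := h (opL M m)
      rw [mulLeft_opp hγ', rightMul_opp hγ'] at this
      exact (h1 this).symm
    · intro h m
      rw [← opL_unopL m, mulLeft_opp hγ', rightMul_opp hγ', h]
  have e3 := mulLeft_opp (Q := Q) hγ' T 1
  have e4 := rightMul_opp (Q := Q) hγ' T 1
  rw [opL_one] at e3 e4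
  have e5 := cohere_opp (Q := Q) hγ' T
  have e6 : splitFst A' (H.opp.Δ : Opp G →ₗ[ℂ] Opp G ⊗[ℂ] Opp G) (TensorProduct.map (opL G) θ T)
      = swapOpp G θ (splitFst A (H.Δ : G →ₗ[ℂ] G ⊗[ℂ] G) T) := splitFst_map_opL _ T
  have e7 : evalFst A' H.opp.ε.toLinearMap (TensorProduct.map (opL G) θ T)
      = θ (evalFst A H.ε.toLinearMap T) := by
    rw [H.toLinearMap_opp_ε, evalFst_map_opL]
  rw [isIntertwiner_iff, isIntertwiner_iff, e2, e3, e4, e5, e6, e7, e1, hθ.eq_iff, h1.eq_iff,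
    h1.eq_iff, h2.eq_iff]
  tauto

end Intertwiner

end


/-! ### Transport of `μ_R` and `P_R` to the mirror side -/

section

variable {G : Type u} [Ring G] [Algebra ℂ G] {M : Type v} [Ring M] [Algebra ℂ M]
  [FiniteDimensional ℂ G]

section Coeff

omit [FiniteDimensional ℂ G] in
/-- `a ⊗ m ⊗ b ↦ F a b • m`. -/
def outerCoeff (F : G →ₗ[ℂ] G →ₗ[ℂ] ℂ) : G ⊗[ℂ] (M ⊗[ℂ] G) →ₗ[ℂ] M :=
  evalFst M (TensorProduct.lift F) ∘ₗ (TensorProduct.assoc ℂ G G M).symm.toLinearMap ∘ₗ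
    LinearMap.lTensor G (TensorProduct.comm ℂ M G).toLinearMap

omit [FiniteDimensional ℂ G] in
@[simp] theorem outerCoeff_tmul (F : G →ₗ[ℂ] G →ₗ[ℂ] ℂ) (a b : G) (m : M) :
    outerCoeff F (a ⊗ₜ (m ⊗ₜ b)) = F a b • m := by simp [outerCoeff]

variable (H : WeakQuasiHopfAlgebra G)

omit [FiniteDimensional ℂ G] in
/-- `(x, z) ↦ ψ(S⁻¹(z) a x)`. -/
def coeffL (ψ : Module.Dual ℂ G) (a : G) : G →ₗ[ℂ] G →ₗ[ℂ] ℂ :=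
  LinearMap.mk₂ ℂ (fun x z => ψ (H.antipodeInv z * (a * x)))
    (fun _ _ _ => by simp [mul_add]) (fun _ _ _ => by simp)
    (fun _ _ _ => by simp [add_mul]) (fun _ _ _ => by simp)

omit [FiniteDimensional ℂ G] in
/-- `(x, z) ↦ ψ(z a S⁻¹(x))`. -/
def coeffR (ψ : Module.Dual ℂ G) (a : G) : G →ₗ[ℂ] G →ₗ[ℂ] ℂ :=
  LinearMap.mk₂ ℂ (fun x z => ψ (z * (a * H.antipodeInv x)))
    (fun _ _ _ => by simp [mul_add]) (fun _ _ _ => by simp)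
    (fun _ _ _ => by simp [add_mul]) (fun _ _ _ => by simp)

omit [FiniteDimensional ℂ G] in
@[simp] theorem coeffL_apply (ψ : Module.Dual ℂ G) (a x z : G) :
    coeffL H ψ a x z = ψ (H.antipodeInv z * (a * x)) := rfl
omit [FiniteDimensional ℂ G] in
@[simp] theorem coeffR_apply (ψ : Module.Dual ℂ G) (a x z : G) :
    coeffR H ψ a x z = ψ (z * (a * H.antipodeInv x)) := rfl

/-- Evaluating the remaining functional at `t` eliminates the dual coproduct, so that `P_L` and
`P_R` can be compared through the plain coefficients `ψ(S⁻¹(z) t x)` and `ψ(z t S⁻¹(x))`. -/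
theorem evalFst_outerSlice (X : G ⊗[ℂ] (M ⊗[ℂ] G)) (ψ : Module.Dual ℂ G) (t : G) :
    evalFst M (Module.Dual.eval ℂ G t) (outerSlice H X (dualComul₂ G ψ))
      = outerCoeff (coeffL H ψ t) X := by
  induction X with
  | zero => simp [outerSlice_zero]
  | add x y hx hy => simp only [outerSlice_add, LinearMap.add_apply, map_add, hx, hy]
  | tmul a X =>
    induction X with
    | zero => simp [outerSlice_zero]
    | add x y hx hy =>
      simp only [TensorProduct.tmul_add, outerSlice_add, LinearMap.add_apply, map_add, hx, hy]
    | tmul c b =>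
      have h : ∀ ω, evalFst M (Module.Dual.eval ℂ G t) (outerSlice H (a ⊗ₜ (c ⊗ₜ b)) ω)
          = (Module.Dual.eval ℂ G (H.antipodeInv b) ◇ Module.Dual.eval ℂ G t
            ◇ Module.Dual.eval ℂ G a) ω • c := by
        intro ω
        induction ω with
        | zero => simp
        | add x y hx hy => simp only [map_add, hx, hy, add_smul]
        | tmul χ ω =>
          induction ω with
          | zero => simp
          | add x y hx hy => simp only [TensorProduct.tmul_add, map_add, hx, hy, add_smul]
          | tmul χ₂ χ₃ =>
            simp only [outerSlice_tmul, mulPair_tmul, evalFst_tmul, map_smul, evalSnd_tmul,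
              LinearMap.comp_apply, Module.Dual.eval_apply, smul_smul]
            congr 1
            ring
      rw [h, mulPair_dualComul₂]
      simp

theorem evalFst_projL (Q : QuasiCommutingPair H.toWeakQuasiBialgebra M) (ψ : Module.Dual ℂ G)
    (m : M) (t : G) : evalFst M (Module.Dual.eval ℂ G t) (projL H Q (ψ ⊗ₜ m))
      = outerCoeff (coeffL H ψ t) Q.deltaLOne * m := by
  have h : ∀ n : Module.Dual ℂ G ⊗[ℂ] M, evalFst M (Module.Dual.eval ℂ G t)
      (LinearMap.lTensor (Module.Dual ℂ G) (LinearMap.mul' ℂ M)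
      (TensorProduct.assoc ℂ (Module.Dual ℂ G) M M (n ⊗ₜ m)))
      = evalFst M (Module.Dual.eval ℂ G t) n * m := by
    intro n
    induction n with
    | zero => simp
    | add x y hx hy => simp only [TensorProduct.add_tmul, map_add, hx, hy, add_mul]
    | tmul χ c => simp
  rw [projL_tmul, h, evalFst_outerSlice]

/-- `(Ŝ⁻¹(ψ₃) ⊗ id ⊗ ψ₁)(X) ⊗ ψ₂`, as a function of `ψ₁ ⊗ ψ₂ ⊗ ψ₃`. -/
def outerSliceR (X : G ⊗[ℂ] (M ⊗[ℂ] G)) :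
    Module.Dual ℂ G ⊗[ℂ] (Module.Dual ℂ G ⊗[ℂ] Module.Dual ℂ G) →ₗ[ℂ] M ⊗[ℂ] Module.Dual ℂ G :=
  (TensorProduct.comm ℂ (Module.Dual ℂ G) M).toLinearMap ∘ₗ
    LinearMap.lTensor (Module.Dual ℂ G)
      (sliceOuter X ∘ₗ
        (TensorProduct.comm ℂ (Module.Dual ℂ G) (Module.Dual ℂ G)).toLinearMap ∘ₗ
        LinearMap.lTensor (Module.Dual ℂ G) (dualAntipodeInv H)) ∘ₗ
    (TensorProduct.leftComm ℂ (Module.Dual ℂ G) (Module.Dual ℂ G)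
      (Module.Dual ℂ G)).toLinearMap

theorem projR_tmul (Q : QuasiCommutingPair H.toWeakQuasiBialgebra M) (ψ : Module.Dual ℂ G)
    (m : M) : projR H Q (m ⊗ₜ ψ) = LinearMap.rTensor (Module.Dual ℂ G) (LinearMap.mul' ℂ M)
      ((TensorProduct.assoc ℂ M M (Module.Dual ℂ G)).symm
        (m ⊗ₜ outerSliceR H Q.deltaROne (dualComul₂ G ψ))) := rfl

theorem outerSliceR_tmul (X : G ⊗[ℂ] (M ⊗[ℂ] G)) (χ₁ χ₂ χ₃ : Module.Dual ℂ G) :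
    outerSliceR H X (χ₁ ⊗ₜ (χ₂ ⊗ₜ χ₃))
      = evalSnd M χ₁ (evalFst (M ⊗[ℂ] G) (χ₃ ∘ₗ H.antipodeInv) X) ⊗ₜ χ₂ := rfl

theorem outerSliceR_add (X Y : G ⊗[ℂ] (M ⊗[ℂ] G)) :
    outerSliceR H (X + Y) = outerSliceR H X + outerSliceR H Y := by
  have : sliceOuter (X + Y) = sliceOuter X + sliceOuter Y := by ext; simp
  rw [outerSliceR, this, LinearMap.add_comp, LinearMap.lTensor_add, LinearMap.add_comp,
    LinearMap.comp_add]
  rfl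

theorem outerSliceR_zero : outerSliceR H (0 : G ⊗[ℂ] (M ⊗[ℂ] G)) = 0 := by
  have : sliceOuter (0 : G ⊗[ℂ] (M ⊗[ℂ] G)) = 0 := by ext; simp
  rw [outerSliceR, this, LinearMap.zero_comp, LinearMap.lTensor_zero, LinearMap.zero_comp,
    LinearMap.comp_zero]

theorem evalSnd_outerSliceR (X : G ⊗[ℂ] (M ⊗[ℂ] G)) (ψ : Module.Dual ℂ G) (t : G) :
    evalSnd M (Module.Dual.eval ℂ G t) (outerSliceR H X (dualComul₂ G ψ))
      = outerCoeff (coeffR H ψ t) X := by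
  induction X with
  | zero => simp [outerSliceR_zero]
  | add x y hx hy => simp only [outerSliceR_add, LinearMap.add_apply, map_add, hx, hy]
  | tmul a X =>
    induction X with
    | zero => simp [outerSliceR_zero]
    | add x y hx hy =>
      simp only [TensorProduct.tmul_add, outerSliceR_add, LinearMap.add_apply, map_add, hx, hy]
    | tmul c b =>
      have h : ∀ ω, evalSnd M (Module.Dual.eval ℂ G t) (outerSliceR H (a ⊗ₜ (c ⊗ₜ b)) ω)
          = (Module.Dual.eval ℂ G b ◇ Module.Dual.eval ℂ G t
            ◇ Module.Dual.eval ℂ G (H.antipodeInv a)) ω • c := by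
        intro ω
        induction ω with
        | zero => simp
        | add x y hx hy => simp only [map_add, hx, hy, add_smul]
        | tmul χ ω =>
          induction ω with
          | zero => simp
          | add x y hx hy => simp only [TensorProduct.tmul_add, map_add, hx, hy, add_smul]
          | tmul χ₂ χ₃ =>
            simp only [outerSliceR_tmul, mulPair_tmul, evalFst_tmul, map_smul, evalSnd_tmul,
              LinearMap.comp_apply, Module.Dual.eval_apply, smul_smul]
            congr 1
            ring
      rw [h, mulPair_dualComul₂]
      simp

theorem evalSnd_projR (Q : QuasiCommutingPair H.toWeakQuasiBialgebra M) (ψ : Module.Dual ℂ G)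
    (m : M) (t : G) : evalSnd M (Module.Dual.eval ℂ G t) (projR H Q (m ⊗ₜ ψ))
      = m * outerCoeff (coeffR H ψ t) Q.deltaROne := by
  have h : ∀ n : M ⊗[ℂ] Module.Dual ℂ G, evalSnd M (Module.Dual.eval ℂ G t)
      (LinearMap.rTensor (Module.Dual ℂ G) (LinearMap.mul' ℂ M)
      ((TensorProduct.assoc ℂ M M (Module.Dual ℂ G)).symm (m ⊗ₜ n)))
      = m * evalSnd M (Module.Dual.eval ℂ G t) n := by
    intro n
    induction n with
    | zero => simp
    | add x y hx hy => simp only [TensorProduct.tmul_add, map_add, hx, hy, mul_add]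
    | tmul χ c => simp
  rw [projR_tmul, h, evalSnd_outerSliceR]

end Coeff

section Transport

instance : FiniteDimensional ℂ (Opp G) :=
  inferInstanceAs (FiniteDimensional ℂ Gᵐᵒᵖ)

/-- The identity as a linear equivalence to the opposite algebra. -/
def opE (A : Type*) [Ring A] [Algebra ℂ A] : A ≃ₗ[ℂ] Opp A :=
  (MulOpposite.opLinearEquiv ℂ : A ≃ₗ[ℂ] Aᵐᵒᵖ)

variable (G M) in
/-- `m ⊗ ψ ↦ ψ ⊗ m`, to the opposite algebras. -/
def dualFlip : M ⊗[ℂ] Module.Dual ℂ G ≃ₗ[ℂ] Module.Dual ℂ (Opp G) ⊗[ℂ] Opp M :=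
  (TensorProduct.congr (opE M) (opE G).symm.dualMap).trans (TensorProduct.comm ℂ _ _)

omit [FiniteDimensional ℂ G] in
theorem dualFlip_tmul (m : M) (ψ : Module.Dual ℂ G) :
    dualFlip G M (m ⊗ₜ ψ) = (ψ ∘ₗ unopL G) ⊗ₜ opL M m := rfl

theorem eq_of_eval {V W : Type*} [AddCommGroup V] [Module ℂ V] [FiniteDimensional ℂ V]
    [AddCommGroup W] [Module ℂ W] {x y : Module.Dual ℂ V ⊗[ℂ] W}
    (h : ∀ a, evalFst W (Module.Dual.eval ℂ V a) x = evalFst W (Module.Dual.eval ℂ V a) y) :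
    x = y := eq_of_evalFst fun f => by
  obtain ⟨a, rfl⟩ := (Module.evalEquiv ℂ V).surjective f
  exact h a

omit [FiniteDimensional ℂ G] in
theorem evalFst_dualFlip (t : G) (x : M ⊗[ℂ] Module.Dual ℂ G) :
    evalFst (Opp M) (Module.Dual.eval ℂ (Opp G) (opL G t)) (dualFlip G M x)
      = opL M (evalSnd M (Module.Dual.eval ℂ G t) x) := by
  induction x with
  | zero => simp
  | add x y hx hy => simp only [map_add, hx, hy]
  | tmul m ψ => simp [dualFlip_tmul]

omit [FiniteDimensional ℂ G] in
theorem outerCoeff_flip₃ (H : WeakQuasiHopfAlgebra G) (ψ : Module.Dual ℂ G) (t : G)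
    (X : G ⊗[ℂ] (M ⊗[ℂ] G)) :
    outerCoeff (coeffL H.opp (ψ ∘ₗ unopL G) (opL G t)) (flip₃ G M G X)
      = opL M (outerCoeff (coeffR H ψ t) X) := by
  induction X with
  | zero => simp
  | add x y hx hy => simp only [map_add, hx, hy]
  | tmul a X =>
    induction X with
    | zero => simp
    | add x y hx hy => simp only [TensorProduct.tmul_add, map_add, hx, hy]
    | tmul m b =>
      simp only [flip₃_tmul, outerCoeff_tmul, coeffL_apply, coeffR_apply, antipodeInv_opp,
        opL_mul_opL, LinearMap.comp_apply, unopL_opL, map_smul, mul_assoc]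

omit [FiniteDimensional ℂ G] in
theorem deltaLOne_opp {H : WeakQuasiBialgebra G} (Q : QuasiCommutingPair H M) :
    Q.opp.deltaLOne = flip₃ G M G Q.deltaROne :=
  (flip₃_lTensor (Q.right.rho : M →ₗ[ℂ] M ⊗[ℂ] G) (Q.left.lam 1)).symm

/-- Compared coefficient by coefficient: the mirror of `δ_r(1)` is `δ_l(1)`, and reversing products
exchanges the two kinds of coefficients. -/
theorem dualFlip_projR (H : WeakQuasiHopfAlgebra G)
    (Q : QuasiCommutingPair H.toWeakQuasiBialgebra M) (x : M ⊗[ℂ] Module.Dual ℂ G) :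
    dualFlip G M (projR H Q x) = projL H.opp Q.opp (dualFlip G M x) := by
  induction x with
  | zero => simp
  | add x y hx hy => simp only [map_add, hx, hy]
  | tmul m ψ =>
    refine eq_of_eval fun a => ?_
    have h := evalFst_projL H.opp Q.opp (ψ ∘ₗ unopL G) (opL M m) a
    refine Eq.trans ?_ h.symm
    rw [← opL_unopL a, evalFst_dualFlip, evalSnd_projR]
    have h' := deltaLOne_opp Q
    refine Eq.trans ?_ (congrArg (fun X => outerCoeff
      (coeffL H.opp (ψ ∘ₗ unopL G) (opL G (unopL G a))) X * opL M m) h'.symm)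
    rw [outerCoeff_flip₃, opL_mul_opL]

variable {A : Type*} [Ring A] [Algebra ℂ A] (ι : M →ₐ[ℂ] A) (Γ : Module.Dual ℂ G →ₗ[ℂ] A)

theorem mul_map_dualComul_right (f : M →ₗ[ℂ] A) (p : G ⊗[ℂ] M) (T : G ⊗[ℂ] A)
    (ψ : Module.Dual ℂ G) :
    LinearMap.mul' ℂ A (TensorProduct.map (sliceFst T) (f ∘ₗ sliceFst p) (dualComul G ψ))
      = evalFst A ψ (T * f.lTensor G p) := by
  change (sliceFst T ◇ (f ∘ₗ sliceFst p)) (dualComul G ψ) = _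
  induction p with
  | zero =>
    have : sliceFst (0 : G ⊗[ℂ] M) = 0 := by ext; simp
    simp [this, mulPair]
  | add x y hx hy =>
    have : sliceFst (x + y) = sliceFst x + sliceFst y := by ext; simp
    rw [this, LinearMap.comp_add, mulPair, TensorProduct.map_add_right, LinearMap.comp_add,
      LinearMap.add_apply, map_add, mul_add, map_add, ← hx, ← hy]
    rfl
  | tmul a m =>
    induction T with
    | zero =>
      have : sliceFst (0 : G ⊗[ℂ] A) = 0 := by ext; simp
      simp [this, mulPair]
    | add x y hx hy =>
      have : sliceFst (x + y) = sliceFst x + sliceFst y := by ext; simp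
      rw [this, mulPair, TensorProduct.map_add_left, LinearMap.comp_add,
        LinearMap.add_apply, add_mul, map_add, ← hx, ← hy]
      rfl
    | tmul c x =>
      have h : ∀ ω, (sliceFst (c ⊗ₜ x) ◇ (f ∘ₗ sliceFst (a ⊗ₜ m))) ω
          = (Module.Dual.eval ℂ G c ◇ Module.Dual.eval ℂ G a) ω • (x * f m) := by
        intro ω
        induction ω with
        | zero => simp
        | add x y hx hy => simp only [map_add, hx, hy, add_smul]
        | tmul χ ψ => simp [smul_smul, mul_comm]
      rw [h, mulPair_dualComul]
      simp

theorem sliceFst_ofSlices : sliceFst (ofSlices Γ) = Γ := by ext; simp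

theorem muR_tmul (p : G ⊗[ℂ] M) (m : M) (ψ : Module.Dual ℂ G) :
    muR ι Γ p (m ⊗ₜ ψ) = ι m * evalFst A ψ (ofSlices Γ * ι.toLinearMap.lTensor G p) := by
  rw [← mul_map_dualComul_right, sliceFst_ofSlices]
  rfl

theorem muL_tmul_eq (q : M ⊗[ℂ] G) (ψ : Module.Dual ℂ G) (m : M) : muL ι Γ q (ψ ⊗ₜ m)
    = evalFst A ψ ((oneTensor G A ∘ₗ ι.toLinearMap ◇ tensorOne G A) q * ofSlices Γ) * ι m := by
  rw [← mul_map_dualComul, sliceFst_ofSlices]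
  rfl

/-- An algebra map between the opposite algebras. -/
def oppHom : Opp M →ₐ[ℂ] Opp A :=
  AlgHom.ofLinearMap (opL A ∘ₗ ι.toLinearMap ∘ₗ unopL M) (congrArg (opL A) (map_one ι))
    (fun x y => congrArg (opL A) (map_mul ι (unopL M y) (unopL M x)))

omit [FiniteDimensional ℂ G] in
theorem oppHom_opL (m : M) : oppHom ι (opL M m) = opL A (ι m) := rfl

/-- A linear map from the dual, between the opposite algebras. -/
def oppSlices : Module.Dual ℂ (Opp G) →ₗ[ℂ] Opp A := opL A ∘ₗ Γ ∘ₗ (opL G).dualMap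

theorem ofSlices_oppSlices : ofSlices (oppSlices Γ)
    = TensorProduct.map (opL G) (opL A) (ofSlices Γ) := eq_of_evalFst fun f => by
  rw [evalFst_ofSlices]
  refine Eq.trans ?_ (evalFst_map_opL (f ∘ₗ opL G) (ofSlices Γ)).symm
  rw [evalFst_ofSlices]
  rfl

omit [FiniteDimensional ℂ G] in
theorem mulPair_oppHom_flip₂ (p : G ⊗[ℂ] M) :
    (oneTensor (Opp G) (Opp A) ∘ₗ (oppHom ι).toLinearMap ◇ tensorOne (Opp G) (Opp A))
      (flip₂ G M p)
    = TensorProduct.map (opL G) (opL A) (ι.toLinearMap.lTensor G p) := by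
  induction p with
  | zero => simp
  | add x y hx hy => simp only [map_add, hx, hy]
  | tmul a m => simp [oppHom_opL]

theorem muL_dualFlip (p : G ⊗[ℂ] M) (x : M ⊗[ℂ] Module.Dual ℂ G) :
    muL (oppHom ι) (oppSlices Γ) (flip₂ G M p) (dualFlip G M x) = opL A (muR ι Γ p x) := by
  induction x with
  | zero => simp
  | add x y hx hy => simp only [map_add, hx, hy]
  | tmul m ψ =>
    rw [dualFlip_tmul, muL_tmul_eq, muR_tmul, ofSlices_oppSlices, mulPair_oppHom_flip₂,
      ← IsAnti.map_mul, evalFst_map_opL, oppHom_opL, opL_mul_opL]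

theorem adjoin_opp (h : Algebra.adjoin ℂ (Set.range ι ∪ Set.range Γ) = ⊤) :
    Algebra.adjoin ℂ (Set.range (oppHom ι) ∪ Set.range (oppSlices Γ)) = ⊤ := by
  refine eq_top_iff.2 fun x _ => ?_
  have hx : unopL A x ∈ Algebra.adjoin ℂ (Set.range ι ∪ Set.range Γ) := by rw [h]; trivial
  rw [← opL_unopL x]
  generalize unopL A x = y at hx ⊢
  induction hx using Algebra.adjoin_induction with
  | mem a ha =>
    rcases ha with ⟨m, rfl⟩ | ⟨ψ, rfl⟩
    · exact Algebra.subset_adjoin (.inl ⟨opL M m, rfl⟩)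
    · exact Algebra.subset_adjoin (.inr ⟨ψ ∘ₗ unopL G, rfl⟩)
  | algebraMap c => exact Subalgebra.algebraMap_mem _ c
  | add a b _ _ ha hb => rw [map_add]; exact Subalgebra.add_mem _ ha hb
  | mul a b _ _ ha hb => rw [IsAnti.map_mul]; exact Subalgebra.mul_mem _ hb ha

end Transport

end


/-! ### Right-handed statements by reflection -/

section

variable {G : Type u} [Ring G] [Algebra ℂ G] {M : Type v} [Ring M] [Algebra ℂ M]
  [FiniteDimensional ℂ G]

section Mirror

variable (H : WeakQuasiHopfAlgebra G) (Q : QuasiCommutingPair H.toWeakQuasiBialgebra M)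

theorem opL_injective {A : Type*} [Ring A] [Algebra ℂ A] : Function.Injective (opL A) :=
  Function.LeftInverse.injective (g := unopL A) fun _ => rfl

theorem unopL_injective {A : Type*} [Ring A] [Algebra ℂ A] : Function.Injective (unopL A) :=
  Function.LeftInverse.injective (g := opL A) fun _ => rfl

/-- The opposite quasi-commuting pair, over the opposite weak quasi-Hopf algebra. -/
def QuasiCommutingPair.oppHopf : QuasiCommutingPair H.opp.toWeakQuasiBialgebra (Opp M) := Q.opp

theorem isIntertwiner_oppSlices : IsIntertwiner (Q.oppHopf H)
    (oppHom (univLeft Q) : Opp M →ₙₐ[ℂ] Opp (UnivExt Q)) (ofSlices (oppSlices (univSlices Q))) := by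
  rw [ofSlices_oppSlices]
  exact (isIntertwiner_opp_iff (θ := opL (UnivExt Q)) opL_injective
    (γ := (univLeft Q : M →ₙₐ[ℂ] UnivExt Q)) (fun _ => rfl)).2 (isIntertwiner_univSlices Q)

/-- A non-unital algebra map from an algebra to an opposite algebra, on the opposite algebra. -/
def unopHom {A B : Type*} [Ring A] [Algebra ℂ A] [Ring B] [Algebra ℂ B] (g : A →ₙₐ[ℂ] Opp B) :
    Opp A →ₙₐ[ℂ] B :=
  { unopL B ∘ₗ (g : A →ₗ[ℂ] Opp B) ∘ₗ unopL A with
    map_mul' := fun x y => congrArg (unopL B) (map_mul g (unopL A y) (unopL A x))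
    map_zero' := map_zero (unopL B ∘ₗ (g : A →ₗ[ℂ] Opp B) ∘ₗ unopL A) }

/-- A non-unital algebra map from an opposite algebra, to the opposite algebra. -/
def toOppHom {A B : Type*} [Ring A] [Algebra ℂ A] [Ring B] [Algebra ℂ B] (g : Opp A →ₙₐ[ℂ] B) :
    A →ₙₐ[ℂ] Opp B :=
  { opL B ∘ₗ (g : Opp A →ₗ[ℂ] B) ∘ₗ opL A with
    map_mul' := fun x y => congrArg (opL B) (map_mul g (opL A y) (opL A x))
    map_zero' := map_zero (opL B ∘ₗ (g : Opp A →ₗ[ℂ] B) ∘ₗ opL A) }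

theorem map_unopL_opL {B : Type*} [Ring B] [Algebra ℂ B] (T : Opp G ⊗[ℂ] B) :
    TensorProduct.map (opL G) (unopL B) (TensorProduct.map (unopL G) (opL B) T) = T := by
  induction T with
  | zero => simp
  | add x y hx hy => simp only [map_add, hx, hy]
  | tmul a b => simp

/-- The representation built for the mirror pair is reflected into an intertwiner for `Q` with
values in an opposite algebra. The universal property of `UnivExt Q` integrates it, and reflecting
back avoids any universality claim for `Opp (UnivExt Q)`. -/
theorem exists_opp_rep : ∃ g : Opp (UnivExt Q) →ₙₐ[ℂ] RepEnd (Opp G) (Opp M),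
    (∀ m, g (oppHom (univLeft Q) m) = repLeft H.opp (Q.oppHopf H) m) ∧
      ∀ ψ, g (oppSlices (univSlices Q) ψ)
        = evalFst (RepEnd (Opp G) (Opp M)) ψ (repIntertwiner H.opp (Q.oppHopf H)) := by
  let B := RepEnd (Opp G) (Opp M)
  let γ' : Opp M →ₙₐ[ℂ] B :=
    (hat_repHat (G := Opp G) (M := Opp M)).hom (H := H.opp) (Q := Q.oppHopf H)
  let T' : Opp G ⊗[ℂ] B := repIntertwiner H.opp (Q.oppHopf H)
  have hT' : IsIntertwiner (Q.oppHopf H) γ' T' :=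
    (hat_repHat (G := Opp G) (M := Opp M)).isIntertwiner
  have hT : IsIntertwiner Q (toOppHom γ') (TensorProduct.map (unopL G) (opL B) T') := by
    refine (isIntertwiner_opp_iff (θ := unopL B) (γ' := γ') unopL_injective (fun _ => rfl)).1 ?_
    rw [map_unopL_opL]
    exact hT'
  obtain ⟨g, hg, hg'⟩ := exists_univ_lift_nonUnital (toOppHom γ') _ hT
  refine ⟨unopHom g, fun m => congrArg (unopL B) (hg (unopL M m)), fun ψ => ?_⟩
  refine (congrArg (unopL B) (hg' (ψ ∘ₗ opL G))).trans ?_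
  rw [← evalFst_map_opL, map_unopL_opL]
  rfl

theorem muL_opp_comp_dualFlip (x : M ⊗[ℂ] Module.Dual ℂ G) :
    muL (oppHom (univLeft Q)) (oppSlices (univSlices Q)) (qRho H.opp (Q.oppHopf H))
      (dualFlip G M x) = opL (UnivExt Q) (muR (univLeft Q) (univSlices Q) (pLam H Q) x) :=
  (congrArg (fun q => muL _ _ q _) (qRho_opp H Q)).trans (muL_dualFlip _ _ _ _)

theorem surjective_muR_univ :
    Function.Surjective (muR (univLeft Q) (univSlices Q) (pLam H Q)) := fun y => by
  obtain ⟨x, hx⟩ := (isIntertwiner_oppSlices H Q).surjective_muL (adjoin_opp _ _ (adjoin_univ Q))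
    (opL _ y)
  obtain ⟨x, rfl⟩ := (dualFlip G M).surjective x
  exact ⟨x, opL_injective ((muL_opp_comp_dualFlip H Q x).symm.trans hx)⟩

/-- `dualFlip` and `opL` are injective and carry `μ_R` and `P_R` to the mirror `μ_L` and `P_L`,
whose kernels agree by `ker_muL`. -/
theorem ker_muR_univ : LinearMap.ker (muR (univLeft Q) (univSlices Q) (pLam H Q))
    = LinearMap.ker (projR H Q) := by
  obtain ⟨g, hg, hg'⟩ := exists_opp_rep H Q
  have h := (isIntertwiner_oppSlices H Q).ker_muL hg hg'
  ext x
  rw [LinearMap.mem_ker, LinearMap.mem_ker, ← (dualFlip G M).map_eq_zero_iff, dualFlip_projR,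
    ← map_eq_zero_iff _ (opL_injective (A := UnivExt Q)), ← muL_opp_comp_dualFlip,
    ← LinearMap.mem_ker, h]
  exact LinearMap.mem_ker

theorem projR_comp_projR : projR H Q ∘ₗ projR H Q = projR H Q :=
  LinearMap.ext fun x => (dualFlip G M).injective <| by
    rw [LinearMap.comp_apply, dualFlip_projR, dualFlip_projR]
    exact LinearMap.congr_fun (projL_comp_projL H.opp (Q.oppHopf H)) _

end Mirror

end


end WeakQuasiHopf

end

theorem mainTheorem5
    (G : Type u) [Ring G] [Algebra ℂ G] [FiniteDimensional ℂ G]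
    (M : Type v) [Ring M] [Algebra ℂ M]
    (H : WeakQuasiHopf.WeakQuasiHopfAlgebra G)
    (Q : WeakQuasiHopf.QuasiCommutingPair H.toWeakQuasiBialgebra M) :
    ∃ (M₁ : Type (max u v)) (_ : Ring M₁) (_ : Algebra ℂ M₁)
      (ι : M →ₐ[ℂ] M₁) (Γ : Module.Dual ℂ G →ₗ[ℂ] M₁),
      -- existence of the universal extension
      WeakQuasiHopf.IsUniversalExtension.{u, v, max u v w} Q ι Γ ∧
      WeakQuasiHopf.HasNonUnitalCorrespondence.{u, v, max u v w} Q ι Γ ∧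
      -- uniqueness
      (∀ (M₂ : Type (max u v w)) [Ring M₂] [Algebra ℂ M₂]
        (ι₂ : M →ₐ[ℂ] M₂) (Γ₂ : Module.Dual ℂ G →ₗ[ℂ] M₂),
        WeakQuasiHopf.IsUniversalExtension.{u, v, max u v w} Q ι₂ Γ₂ →
          ∃! f : M₁ ≃ₐ[ℂ] M₂, (∀ m, f (ι m) = ι₂ m) ∧ ∀ ψ, Γ₂ ψ = f (Γ ψ)) ∧
      -- surjectivity of `μ_L` and `μ_R`
      Function.Surjective (WeakQuasiHopf.muL ι Γ (WeakQuasiHopf.qRho H Q)) ∧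
      Function.Surjective (WeakQuasiHopf.muR ι Γ (WeakQuasiHopf.pLam H Q)) ∧
      -- `P_L` and `P_R` are projections with the same kernels as `μ_L` and `μ_R`
      WeakQuasiHopf.projL H Q ∘ₗ WeakQuasiHopf.projL H Q = WeakQuasiHopf.projL H Q ∧
      WeakQuasiHopf.projR H Q ∘ₗ WeakQuasiHopf.projR H Q = WeakQuasiHopf.projR H Q ∧
      LinearMap.ker (WeakQuasiHopf.muL ι Γ (WeakQuasiHopf.qRho H Q))
        = LinearMap.ker (WeakQuasiHopf.projL H Q) ∧
      LinearMap.ker (WeakQuasiHopf.muR ι Γ (WeakQuasiHopf.pLam H Q))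
        = LinearMap.ker (WeakQuasiHopf.projR H Q) ∧
      -- hence `μ_L` and `μ_R` restrict to linear isomorphisms from the images of `P_L` and `P_R`
      Function.Bijective ((WeakQuasiHopf.muL ι Γ (WeakQuasiHopf.qRho H Q)).domRestrict
        (LinearMap.range (WeakQuasiHopf.projL H Q))) ∧
      Function.Bijective ((WeakQuasiHopf.muR ι Γ (WeakQuasiHopf.pLam H Q)).domRestrict
        (LinearMap.range (WeakQuasiHopf.projR H Q))) := by
  refine ⟨WeakQuasiHopf.UnivExt Q, inferInstance, inferInstance, WeakQuasiHopf.univLeft Q,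
    WeakQuasiHopf.univSlices Q,
    WeakQuasiHopf.isUniversalExtension_univ Q (WeakQuasiHopf.univLeft_injective H Q),
    WeakQuasiHopf.hasNonUnitalCorrespondence_univ Q,
    fun M₂ _ _ ι₂ Γ₂ h => WeakQuasiHopf.existsUnique_equiv_univ.{u, v, w} Q h,
    WeakQuasiHopf.surjective_muL_univ H Q, WeakQuasiHopf.surjective_muR_univ H Q,
    WeakQuasiHopf.projL_comp_projL H Q, WeakQuasiHopf.projR_comp_projR H Q,
    WeakQuasiHopf.ker_muL_univ H Q, WeakQuasiHopf.ker_muR_univ H Q,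
    WeakQuasiHopf.bijective_domRestrict_range (WeakQuasiHopf.projL_comp_projL H Q)
      (WeakQuasiHopf.surjective_muL_univ H Q) (WeakQuasiHopf.ker_muL_univ H Q),
    WeakQuasiHopf.bijective_domRestrict_range (WeakQuasiHopf.projR_comp_projR H Q)
      (WeakQuasiHopf.surjective_muR_univ H Q) (WeakQuasiHopf.ker_muR_univ H Q)⟩
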